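/- Let $\nu$ be a probability measure on $\mathbb Z$ that is centered ($\sum_k |k|\,\nu(k)<\infty$ and $\sum_k k\,\nu(k)=0$), upwards-skip-free ($\nu(k)=0$ for $k>1$) and satisfies $\nu(0)=0$. For $k\in\mathbb Z_+$ put $$\nu_\circ(k)=\nu(1)(1-\nu(1))^k,\qquad \nu_\bullet(k)=\frac{\nu(-k)}{1-\nu(1)} .$$ **Walks.** Let $P^\nu_x$ be the law of the random walk $Z=(Z_k)_{k\ge 0}$ started at $x$ with step distribution $\nu$, let $T=\inf\{k\ge 0: Z_k<0\}$, let $H=(H_k)_{k\geq 0}$ be the strict ascending ladder height process of $-Z$ (with $H_0=0$) and $V(x)=\sum_{k\ge 0}P^\nu_0(H_k\le x)$. The law $P^{\nu\uparrow}_0$ of the walk conditioned to stay nonnegative is the $h$-transform given, for all $k\geq 0$ and $F\ge 0$, by $$E^{\nu\uparrow}_0[F(Z_0,\dots,Z_k)]=\frac1{V(0)}E^\nu_0\big[V(Z_k)F(Z_0,\dots,Z_k)\mathbf 1_{k<T}\big].$$ **The glued looptree.** Let $C,C':\mathbb Z_+\to\mathbb Z$ satisfy $C_0=C'_0=0$,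 have no step $0$ and no step larger than $1$, with $\liminf C=-\infty$, $C'\ge 0$ and $C'_k\to\infty$. For a function $f$ on $\mathbb Z$ or $\mathbb Z_+$ let $i\sim_f j$ iff $f_i=f_j=\min\{f_k: i\wedge j\le k\le i\vee j\}$, and extend $C$ to $\mathbb Z$ by $C_k=k$ for $k\le 0$. The looptree $\mathbf L_C$ is the chain $\mathbb Z$ with the integers that are $\sim_C$-equivalent identified. The forest $\mathbf F_{C'}$ is the chain $\mathbb Z_+$ with $\sim_{C'}$-equivalent integers identified. It consists of a ray with vertices $0,1,2,\dots$ with a finite looptree attached on the left of each of them, its $k$-th ray vertex being the class of the indices $i$ with $C'_i=k=\min_{l\ge i}C'_l$. The looptree $\mathbf L_{C,C'}$ is obtained by gluing $\mathbf F_{C'}$ to $\mathbf L_C$, the vertex $-k$ of the left boundary of $\mathbf L_C$ being identified with the $k$-th ray vertex of $\mathbf F_{C'}$ for every $k\ge0$, and the edge $(-k,-k-1)$ with the $k$-th ray edge. Equivalently, $\mathbf L_{C,C'}$ is a quotient of the chain $\mathbb Z$ (with $C$ read on nonnegative integers, and $C'$ read backwards on nonpositive ones). It is embedded in the plane so that the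 chain $\mathbb Z$ is the contour of the infinite root face, which is on the right of every edge $i\to i+1$, and so that, turning counterclockwise around a vertex, one meets the corners of the root face in the increasing cyclic order of the corresponding integers. Its root edge goes from $0$ to $1$. **The tree of components.** The plane tree $\mathbf T_{C,C'}=\mathsf{Tree}(\mathbf L_{C,C'})$ has one white vertex for each vertex of $\mathbf L_{C,C'}$ and one black vertex for each internal face, each black vertex being joined to the white vertices on the boundary of its face, with the planar cyclic orders (children are listed from left to right, i.e. clockwise). Its root is the origin of the root edge, and the first child of the root is the face on the left of the root edge. **Kesten's tree.** For a probability measure $p$ on $\mathbb Z_+$ with mean $m\in(0,\infty)$ let $\bar p(k)=kp(k)/m$. The law $\mathsf{GW}^{(\infty)}_{\nu_\circ,\nu_\bullet}$ is that of the infinite random plane tree with a spine (an infinite path from the root) such that all offspring numbers are independent, vertices at even (white) and odd (black) heights have offspring distribution $\bar\nu_\circ$, respectively $\bar\nu_\bullet$, on the spine, and $\nu_\circ$, respectively $\nu_\bullet$, out of the spine, and the child in the spine of each spine vertex is chosen uniformly at random among its children, independently of everything else. **Statement.** Let $C$ have law $P^\nu_0$ and let $C'$ be independent of $C$ with law $P^{\nu\uparrow}_0$.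 Then almost surely $(C,C')$ satisfies the above conditions, and the tree of components $\mathbf T_{C,C'}$ of $\mathbf L_{C,C'}$ has law $\mathsf{GW}^{(\infty)}_{\nu_\circ,\nu_\bullet}$. -/

import Mathlib

open MeasureTheory ProbabilityTheory

namespace ComponentTree

open scoped ENNReal

/-! ### Plane trees and the two-type Kesten tree -/

/-- Locally finite plane trees, as prefix-closed sets of words over `ℕ`. The children of a vertex
`v` with `k` children are `v ++ [0], …, v ++ [k - 1]`, listed from left to right. -/
@[ext]
structure PlaneTree where
  verts : Set (List ℕ)
  nil_mem : [] ∈ verts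
  parent_mem : ∀ (v : List ℕ) (j : ℕ), v ++ [j] ∈ verts → v ∈ verts
  exists_numChildren : ∀ v ∈ verts, ∃ k : ℕ, ∀ j : ℕ, v ++ [j] ∈ verts ↔ j < k

/-- The sigma-algebra generated by the events `{t | w ∈ t}`; it is the Borel sigma-algebra of the
local topology. -/
instance : MeasurableSpace PlaneTree :=
  MeasurableSpace.generateFrom {A | ∃ w : List ℕ, A = {t : PlaneTree | w ∈ t.verts}}

/-- The plane tree in which every vertex `v` has `k v` children. -/
def PlaneTree.ofNumChildren (k : List ℕ → ℕ) : PlaneTree where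
  verts := {w | ∀ (v : List ℕ) (j : ℕ), v ++ [j] <+: w → j < k v}
  nil_mem := by
    intro v j h
    simp at h
  parent_mem := by
    intro v j h u i hu
    exact h u i (hu.trans (List.prefix_append v [j]))
  exists_numChildren := by
    intro v hv
    refine ⟨k v, fun j => ⟨fun h => h v j List.prefix_rfl, fun hj u i hu => ?_⟩⟩
    rcases List.prefix_concat_iff.1 hu with h | h
    · obtain ⟨rfl, h2⟩ := List.append_inj' h rfl
      obtain rfl : i = j := by simpa using h2
      exact hj
    · exact hv u i h

/-- The mean of a probability measure on `ℕ`. -/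
noncomputable def mean (p : PMF ℕ) : ℝ≥0∞ := ∑' k : ℕ, (k : ℝ≥0∞) * p k

open Classical in
/-- The size-biased distribution `k ↦ k p(k) / m` of a probability measure `p` on `ℕ` with mean
`m ∈ (0, ∞)` (and a junk value for other means). -/
noncomputable def sizeBiased (p : PMF ℕ) : PMF ℕ :=
  if h : mean p ≠ 0 ∧ mean p ≠ ∞ then
    PMF.normalize (fun k : ℕ => (k : ℝ≥0∞) * p k) h.1 h.2
  else PMF.pure 0

/-- The law of `(k, j)` with `j` uniform on `{0, …, k - 1}`. -/
noncomputable def withUniformChild : ℕ → PMF (ℕ × ℕ)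
  | 0 => PMF.pure (0, 0)
  | k + 1 => (PMF.uniformOfFintype (Fin (k + 1))).map fun j => (k + 1, (j : ℕ))

/-- The law of the offspring number of a vertex of the spine, together with the rank of its child
in the spine. -/
noncomputable def spineLaw (p : PMF ℕ) : PMF (ℕ × ℕ) := (sizeBiased p).bind withUniformChild

/-- The spine whose `n`-th vertex has its child of rank `(s n).2` in the spine. -/
def spine (s : ℕ → ℕ × ℕ) : ℕ → List ℕ
  | 0 => []
  | n + 1 => spine s n ++ [(s n).2]

/-- The tree in which the `n`-th vertex of the spine has `(x.2 n).1` children, among which that of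
rank `(x.2 n).2` is in the spine, and every vertex `v` out of the spine has `x.1 v` children. -/
def kestenTree (x : (List ℕ → ℕ) × (ℕ → ℕ × ℕ)) : PlaneTree :=
  PlaneTree.ofNumChildren fun v =>
    if v = spine x.2 v.length then (x.2 v.length).1 else x.1 v

/-- The law of the two-type Kesten tree with offspring distributions `white` (even heights) and
`black` (odd heights): all the numbers of offspring are independent, with size-biased distributions
along the spine, and the child in the spine is uniform among the offspring. -/
noncomputable def kestenLaw (white black : PMF ℕ) : Measure PlaneTree :=
  ((Measure.infinitePi fun v : List ℕ =>
      (if Even v.length then white else black).toMeasure).prod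
    (Measure.infinitePi fun n : ℕ =>
      (if Even n then spineLaw white else spineLaw black).toMeasure)).map kestenTree

/-! ### Rooted maps and trees of components -/

/-- A (possibly infinite) rooted map on an oriented surface, given by its half-edges (darts).
`rev` reverses the orientation of a dart and `rot d` is the dart that follows `d` in
counterclockwise order around the origin of `d`. Vertices are the cycles of `rot`. -/
structure RootedMap where
  Dart : Type
  rev : Equiv.Perm Dart
  rev_rev : ∀ d, rev (rev d) = d
  rev_ne : ∀ d, rev d ≠ d
  rot : Equiv.Perm Dart
  root : Dart

namespace RootedMap

variable (M : RootedMap)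

/-- The dart that follows `d` in the contour of the face on the left of `d`. Faces are the cycles
of this permutation; they are visited counterclockwise. -/
def faceNext : Equiv.Perm M.Dart := M.rot⁻¹ * M.rev

/-- The face on the left of `d` is internal, i.e. it is not the root face, which is the face on the
right of the root edge. -/
def IsInner (d : M.Dart) : Prop := ¬ M.faceNext.SameCycle (M.rev M.root) d

/-- The corners of internal faces at the origin of `d` (each corner is represented by the dart that
follows it in the contour of its face). -/
def vertexCorners (d : M.Dart) : Set M.Dart := {e | M.rot.SameCycle d e ∧ M.IsInner e}

/-- The corners of the face on the left of `d`. -/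
def faceCorners (d : M.Dart) : Set M.Dart := {e | M.faceNext.SameCycle d e}

open Classical in
/-- The corner of an internal face that follows that of `d` in clockwise order around the origin
of `d`. -/
noncomputable def nextCorner (d : M.Dart) : M.Dart :=
  if h : ∃ n : ℕ, M.IsInner ((M.rot⁻¹ ^ (n + 1)) d) then (M.rot⁻¹ ^ (Nat.find h + 1)) d else d

/-- One step of the exploration of the tree of components. Its edges are the corners of internal
faces: the corner `d` joins the (white) origin of `d` to the (black) face on the left of `d`. A
vertex other than the root is given by the edge `d` to its parent and by its colour (`true` for
black). Its children are given by the other edges at this vertex, in clockwise order after `d`. -/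
noncomputable def childStep : M.Dart × Bool → ℕ → M.Dart × Bool
  | (d, true), j => ((M.faceNext⁻¹ ^ (j + 1)) d, false)
  | (d, false), j => (M.nextCorner^[j + 1] d, true)

/-- The number of children of a vertex other than the root: all edges but that to the parent. -/
noncomputable def numChildrenAt : M.Dart × Bool → ℕ
  | (d, true) => (M.faceCorners d).ncard - 1
  | (d, false) => (M.vertexCorners d).ncard - 1

/-- The number of children of the vertex with a given word. The root is the origin of the root
edge. Its children are given by all the edges at this vertex, in clockwise order, the first one
leading to the face on the left of the root edge. -/
noncomputable def numChildren : List ℕ → ℕ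
  | [] => (M.vertexCorners M.root).ncard
  | i :: w => M.numChildrenAt (w.foldl M.childStep (M.nextCorner^[i] M.root, true))

/-- The tree of components of a looptree: one puts a black vertex in every internal face and joins
it to all the (white) vertices of the face, and the edges of the looptree are erased. The root of
the tree is the origin of the looptree, and its first child is the black vertex in the face on the
left of the root edge. -/
noncomputable def treeOfComponents : PlaneTree := PlaneTree.ofNumChildren M.numChildren

end RootedMap

/-! ### The glued looptree -/

/-- The equivalence relation `i ∼ j` iff `f i = f j = min {f k : i ∧ j ≤ k ≤ i ∨ j}`. -/
def excursionSetoid {ι : Type*} [LinearOrder ι] (f : ι → ℤ) : Setoid ι where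
  r i j := f i = f j ∧ ∀ k, min i j ≤ k → k ≤ max i j → f i ≤ f k
  iseqv := by
    refine ⟨fun i => ⟨rfl, fun k h1 h2 => ?_⟩, fun {i j} h => ⟨h.1.symm, fun k h1 h2 => ?_⟩,
      fun {i j l} h h' => ⟨h.1.trans h'.1, fun k h1 h2 => ?_⟩⟩
    · have hk : i = k := le_antisymm (by simpa using h1) (by simpa using h2)
      rw [hk]
    · rw [← h.1]
      exact h.2 k (by rwa [min_comm]) (by rwa [max_comm])
    · by_cases hk : min i j ≤ k ∧ k ≤ max i j
      · exact h.2 k hk.1 hk.2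
      · rw [h.1]
        refine h'.2 k ?_ ?_ <;> grind

/-- The extension of `C` to `ℤ` by `C k = k` for `k ≤ 0`. -/
def extend (C : ℕ → ℤ) (k : ℤ) : ℤ := if 0 < k then C k.toNat else k

/-- The index `i` belongs to the `k`-th vertex of the ray of the forest coded by `C'`, that is, to
the origin of the looptree coded by the excursion of `C'` above its future infimum at level `k`. -/
def OnRay (C' : ℕ → ℤ) (k i : ℕ) : Prop := C' i = k ∧ ∀ l, i ≤ l → (k : ℤ) ≤ C' l

/-- The vertices of the glued looptree, as an equivalence relation on `ℤ`: nonnegative integers are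
the indices of `C`, nonpositive integers are the opposites of the indices of `C'`. On each side we
use the relation coded by `C`, respectively `C'`. The gluing identifies, for every `k`, the vertex
`-k` of the left boundary of the looptree coded by `C` with the `k`-th vertex of the ray of the
forest coded by `C'`. -/
def gluedSetoid (C C' : ℕ → ℤ) : Setoid ℤ where
  r i j :=
    (0 < i ∧ 0 < j ∧ excursionSetoid (extend C) i j) ∨
    (i ≤ 0 ∧ j ≤ 0 ∧ excursionSetoid C' (-i).toNat (-j).toNat) ∨
    (i ≤ 0 ∧ 0 < j ∧ ∃ k : ℕ, OnRay C' k (-i).toNat ∧ excursionSetoid (extend C) (-(k : ℤ)) j) ∨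
    (0 < i ∧ j ≤ 0 ∧ ∃ k : ℕ, OnRay C' k (-j).toNat ∧ excursionSetoid (extend C) (-(k : ℤ)) i)
  iseqv := by
    have ray : ∀ {k a b : ℕ}, OnRay C' k a → excursionSetoid C' a b → OnRay C' k b := by
      intro k a b h h'
      refine ⟨h'.1.symm.trans h.1, fun l hl => ?_⟩
      by_cases hal : a ≤ l
      · exact h.2 l hal
      · have := h'.2 l (by omega) (by omega)
        rw [h.1] at this
        exact this
    have ray2 : ∀ {k a b : ℕ}, OnRay C' k a → OnRay C' k b → excursionSetoid C' a b := by
      intro k a b h h'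
      refine ⟨h.1.trans h'.1.symm, fun l hl _ => ?_⟩
      rw [h.1]
      rcases min_le_iff.1 hl with h1 | h1
      · exact h.2 l h1
      · exact h'.2 l h1
    have lev : ∀ {k k' : ℕ} {j : ℤ}, excursionSetoid (extend C) (-(k : ℤ)) j →
        excursionSetoid (extend C) (-(k' : ℤ)) j → k = k' := by
      intro k k' j h h'
      have e := h.1.trans h'.1.symm
      simp only [extend] at e
      rw [if_neg (by omega), if_neg (by omega)] at e
      omega
    have lev' : ∀ {k k' a : ℕ}, OnRay C' k a → OnRay C' k' a → k = k' := by
      intro k k' a h h'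
      exact_mod_cast h.1.symm.trans h'.1
    refine ⟨fun i => ?_, fun {i j} h => ?_, fun {i j l} h h' => ?_⟩
    · rcases le_or_gt i 0 with h | h
      · exact Or.inr (Or.inl ⟨h, h, Setoid.refl' _ _⟩)
      · exact Or.inl ⟨h, h, Setoid.refl' _ _⟩
    · rcases h with ⟨h1, h2, h⟩ | ⟨h1, h2, h⟩ | ⟨h1, h2, h⟩ | ⟨h1, h2, h⟩
      · exact Or.inl ⟨h2, h1, Setoid.symm' _ h⟩
      · exact Or.inr (Or.inl ⟨h2, h1, Setoid.symm' _ h⟩)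
      · exact Or.inr (Or.inr (Or.inr ⟨h2, h1, h⟩))
      · exact Or.inr (Or.inr (Or.inl ⟨h2, h1, h⟩))
    · rcases h with ⟨h1, h2, h⟩ | ⟨h1, h2, h⟩ | ⟨h1, h2, k, hk, h⟩ | ⟨h1, h2, k, hk, h⟩ <;>
        rcases h' with ⟨h3, h4, h'⟩ | ⟨h3, h4, h'⟩ | ⟨h3, h4, k', hk', h'⟩ | ⟨h3, h4, k', hk', h'⟩ <;>
        try omega
      · exact Or.inl ⟨h1, h4, Setoid.trans' _ h h'⟩
      · exact Or.inr (Or.inr (Or.inr ⟨h1, h4, k', hk', Setoid.trans' _ h' (Setoid.symm' _ h)⟩))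
      · exact Or.inr (Or.inl ⟨h1, h4, Setoid.trans' _ h h'⟩)
      · exact Or.inr (Or.inr (Or.inl ⟨h1, h4, k', ray hk' (Setoid.symm' _ h), h'⟩))
      · exact Or.inr (Or.inr (Or.inl ⟨h1, h4, k, hk, Setoid.trans' _ h h'⟩))
      · obtain rfl := lev h h'
        exact Or.inr (Or.inl ⟨h1, h4, ray2 hk hk'⟩)
      · exact Or.inr (Or.inr (Or.inr ⟨h1, h4, k, ray hk h', h⟩))
      · obtain rfl := lev' hk hk'
        exact Or.inl ⟨h1, h4, Setoid.trans' _ (Setoid.symm' _ h) h'⟩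

/-- The equivalence class of an integer. -/
def classOf (s : Setoid ℤ) (i : ℤ) : Set ℤ := {j | s i j}

open Classical in
/-- The cyclic successor of an integer in its (finite) equivalence class, in increasing order. By
convention, the elements of infinite classes are fixed. -/
noncomputable def cyclicSucc (s : Setoid ℤ) (i : ℤ) : ℤ :=
  if (classOf s i).Finite then
    if (classOf s i ∩ Set.Ioi i).Nonempty then sInf (classOf s i ∩ Set.Ioi i)
    else sInf (classOf s i)
  else i

open Classical in
/-- The cyclic predecessor of an integer in its equivalence class. -/
noncomputable def cyclicPred (s : Setoid ℤ) (i : ℤ) : ℤ :=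
  if (classOf s i).Finite then
    if (classOf s i ∩ Set.Iio i).Nonempty then sSup (classOf s i ∩ Set.Iio i)
    else sSup (classOf s i)
  else i

theorem classOf_eq {s : Setoid ℤ} {i j : ℤ} (h : j ∈ classOf s i) : classOf s j = classOf s i := by
  ext k
  exact ⟨fun hk => Setoid.trans' _ h hk, fun hk => Setoid.trans' _ (Setoid.symm' _ h) hk⟩

theorem self_mem_classOf (s : Setoid ℤ) (i : ℤ) : i ∈ classOf s i := Setoid.refl' s i

theorem cyclicPred_cyclicSucc (s : Setoid ℤ) (i : ℤ) : cyclicPred s (cyclicSucc s i) = i := by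
  by_cases hf : (classOf s i).Finite
  · have hb := hf.bddBelow
    have ha := hf.bddAbove
    have hi := self_mem_classOf s i
    by_cases hn : (classOf s i ∩ Set.Ioi i).Nonempty
    · have e : cyclicSucc s i = sInf (classOf s i ∩ Set.Ioi i) := by
        rw [cyclicSucc, if_pos hf, if_pos hn]
      have hm : cyclicSucc s i ∈ classOf s i ∩ Set.Ioi i :=
        e ▸ Int.csInf_mem hn (hb.mono Set.inter_subset_left)
      have hl : ∀ j ∈ classOf s i ∩ Set.Ioi i, cyclicSucc s i ≤ j := fun j hj =>
        e ▸ csInf_le (hb.mono Set.inter_subset_left) hj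
      generalize cyclicSucc s i = m at hm hl
      rw [cyclicPred, classOf_eq hm.1, if_pos hf, if_pos ⟨i, hi, hm.2⟩]
      refine le_antisymm (csSup_le ⟨i, hi, hm.2⟩ fun j hj => ?_)
        (le_csSup (ha.mono Set.inter_subset_left) ⟨hi, hm.2⟩)
      by_contra! hc
      exact absurd (hl j ⟨hj.1, hc⟩) (not_le.2 hj.2)
    · have e : cyclicSucc s i = sInf (classOf s i) := by
        rw [cyclicSucc, if_pos hf, if_neg hn]
      have hm : cyclicSucc s i ∈ classOf s i := e ▸ Int.csInf_mem ⟨i, hi⟩ hb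
      have hl : ∀ j ∈ classOf s i, cyclicSucc s i ≤ j := fun j hj => e ▸ csInf_le hb hj
      generalize cyclicSucc s i = m at hm hl
      rw [cyclicPred, classOf_eq hm, if_pos hf, if_neg]
      · refine le_antisymm (csSup_le ⟨i, hi⟩ fun j hj => ?_) (le_csSup ha hi)
        by_contra! hc
        exact hn ⟨j, hj, hc⟩
      · rintro ⟨j, hj, hj'⟩
        exact absurd (hl j hj) (not_le.2 hj')
  · have e : cyclicSucc s i = i := by rw [cyclicSucc, if_neg hf]
    rw [e, cyclicPred, if_neg hf]

theorem cyclicSucc_cyclicPred (s : Setoid ℤ) (i : ℤ) : cyclicSucc s (cyclicPred s i) = i := by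
  by_cases hf : (classOf s i).Finite
  · have hb := hf.bddBelow
    have ha := hf.bddAbove
    have hi := self_mem_classOf s i
    by_cases hn : (classOf s i ∩ Set.Iio i).Nonempty
    · have e : cyclicPred s i = sSup (classOf s i ∩ Set.Iio i) := by
        rw [cyclicPred, if_pos hf, if_pos hn]
      have hm : cyclicPred s i ∈ classOf s i ∩ Set.Iio i :=
        e ▸ Int.csSup_mem hn (ha.mono Set.inter_subset_left)
      have hl : ∀ j ∈ classOf s i ∩ Set.Iio i, j ≤ cyclicPred s i := fun j hj =>
        e ▸ le_csSup (ha.mono Set.inter_subset_left) hj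
      generalize cyclicPred s i = m at hm hl
      rw [cyclicSucc, classOf_eq hm.1, if_pos hf, if_pos ⟨i, hi, hm.2⟩]
      refine le_antisymm (csInf_le (hb.mono Set.inter_subset_left) ⟨hi, hm.2⟩)
        (le_csInf ⟨i, hi, hm.2⟩ fun j hj => ?_)
      by_contra! hc
      exact absurd (hl j ⟨hj.1, hc⟩) (not_le.2 hj.2)
    · have e : cyclicPred s i = sSup (classOf s i) := by
        rw [cyclicPred, if_pos hf, if_neg hn]
      have hm : cyclicPred s i ∈ classOf s i := e ▸ Int.csSup_mem ⟨i, hi⟩ ha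
      have hl : ∀ j ∈ classOf s i, j ≤ cyclicPred s i := fun j hj => e ▸ le_csSup ha hj
      generalize cyclicPred s i = m at hm hl
      rw [cyclicSucc, classOf_eq hm, if_pos hf, if_neg]
      · refine le_antisymm (csInf_le hb hi) (le_csInf ⟨i, hi⟩ fun j hj => ?_)
        by_contra! hc
        exact hn ⟨j, hj, hc⟩
      · rintro ⟨j, hj, hj'⟩
        exact absurd (hl j hj) (not_le.2 hj')
  · have e : cyclicPred s i = i := by rw [cyclicPred, if_neg hf]
    rw [e, cyclicSucc, if_neg hf]

/-- The map coded by an equivalence relation on `ℤ`, obtained from the chain `ℤ` by identifying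
equivalent integers, in such a way that the chain is the contour of the root face.

The dart `(i, true)` goes from `i` to `i + 1`, with an internal face on its left, and `(i, false)`
is its reverse, with the root face on its left. The corner of the root face at `i` is between
`(i - 1, false)` and `(i, true)`. When one turns counterclockwise around a vertex, the corners of
the root face are met in the increasing cyclic order of the integers of the class, so that `(i,
true)` is followed by `(j - 1, false)`, where `j` is the cyclic successor of `i`. The root edge goes
from `0` to `1`. -/
noncomputable def chainMap (s : Setoid ℤ) : RootedMap where
  Dart := ℤ × Bool
  rev :=
    { toFun := fun d => (d.1, !d.2)
      invFun := fun d => (d.1, !d.2)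
      left_inv := by intro d; simp
      right_inv := by intro d; simp }
  rev_rev := by intro d; simp
  rev_ne := by rintro ⟨i, b⟩; cases b <;> simp
  rot :=
    { toFun := fun d => if d.2 then (cyclicSucc s d.1 - 1, false) else (d.1 + 1, true)
      invFun := fun d => if d.2 then (d.1 - 1, false) else (cyclicPred s (d.1 + 1), true)
      left_inv := by rintro ⟨i, b⟩; cases b <;> simp [cyclicPred_cyclicSucc]
      right_inv := by rintro ⟨i, b⟩; cases b <;> simp [cyclicSucc_cyclicPred] }
  root := (0, true)

/-- The infinite looptree coded by `C` and `C'`. -/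
noncomputable def gluedLooptree (C C' : ℕ → ℤ) : RootedMap := chainMap (gluedSetoid C C')

/-- The tree of components of the looptree coded by `C` and `C'`. -/
noncomputable def componentTree (C C' : ℕ → ℤ) : PlaneTree := (gluedLooptree C C').treeOfComponents

/-- The assumptions under which `C` and `C'` code an infinite looptree: both start at `0` and have
no positive jump (i.e. no step greater than one) and no constant step, the inferior limit of `C` is
`-∞`, and `C'` is nonnegative and converges to `∞`. -/
structure IsCodingPair (C C' : ℕ → ℤ) : Prop where
  zero : C 0 = 0
  zero' : C' 0 = 0
  step_le : ∀ k, C (k + 1) - C k ≤ 1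
  step_le' : ∀ k, C' (k + 1) - C' k ≤ 1
  step_ne : ∀ k, C (k + 1) ≠ C k
  step_ne' : ∀ k, C' (k + 1) ≠ C' k
  frequently_lt : ∀ b : ℤ, ∃ᶠ k in Filter.atTop, C k < b
  nonneg' : ∀ k, 0 ≤ C' k
  tendsto' : Filter.Tendsto C' Filter.atTop Filter.atTop

/-! ### Random walks -/

/-- The law of the random walk started at `x` with step distribution `ν`. -/
noncomputable def walkLaw (ν : PMF ℤ) (x : ℤ) : Measure (ℕ → ℤ) :=
  (Measure.infinitePi fun _ : ℕ => ν.toMeasure).map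
    fun ξ n => x + ∑ i ∈ Finset.range n, ξ i

/-- The times of the strict ascending ladder process of `-z` (`⊤` if there are less than `k`
of them). -/
noncomputable def ladderTime (z : ℕ → ℤ) : ℕ → ℕ∞
  | 0 => 0
  | k + 1 => sInf ((fun j : ℕ => (j : ℕ∞)) ''
      {j : ℕ | ladderTime z k < j ∧ -z j > -z (ladderTime z k).toNat})

open Classical in
/-- The strict ascending ladder height process of `-z` (`⊤` when it is not defined). -/
noncomputable def ladderHeight (z : ℕ → ℤ) (k : ℕ) : WithTop ℤ :=
  if ladderTime z k = ⊤ then ⊤ else ((-z (ladderTime z k).toNat : ℤ) : WithTop ℤ)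

/-- The renewal function `V x = ∑ₖ P₀(Hₖ ≤ x)` of the strict ascending ladder height process `H` of
the opposite of the walk. -/
noncomputable def renewal (ν : PMF ℤ) (x : ℤ) : ℝ≥0∞ :=
  ∑' k : ℕ, walkLaw ν 0 {z | ladderHeight z k ≤ (x : WithTop ℤ)}

open Classical in
/-- `Q` is the law of the random walk started at `x` conditioned to stay nonnegative, i.e. the
Doob `h`-transform by `V` of the law `P_x` of the walk killed at its first entrance time `T` in
the negative integers: `E_Q[F(Z₀, …, Zₖ)] = V(x)⁻¹ E_x[V(Zₖ) F(Z₀, …, Zₖ) 1_{k < T}]` for all `k`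
and all `F ≥ 0`. -/
def IsConditionedWalkLaw (ν : PMF ℤ) (x : ℤ) (Q : Measure (ℕ → ℤ)) : Prop :=
  ∀ (k : ℕ) (F : (Fin (k + 1) → ℤ) → ℝ≥0∞),
    ∫⁻ z, F (fun i => z i) ∂Q =
      (renewal ν x)⁻¹ *
        ∫⁻ z, (if ∀ i ≤ k, 0 ≤ z i then renewal ν (z k) * F (fun i => z i) else 0) ∂walkLaw ν x

/-- The standing assumptions on the step distribution: it is upwards-skip-free and centered, and it
has no mass at `0`. -/
structure IsStepLaw (ν : PMF ℤ) : Prop where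
  eq_zero_of_one_lt : ∀ k : ℤ, 1 < k → ν k = 0
  apply_zero : ν 0 = 0
  centered : HasSum (fun k : ℤ => (k : ℝ) * (ν k).toReal) 0

namespace IsStepLaw

variable {ν : PMF ℤ}

theorem apply_one_ne_zero (h : IsStepLaw ν) : ν 1 ≠ 0 := by
  intro h1
  have hpos : ∀ k : ℤ, 0 ≤ k → ν k = 0 := by
    intro k hk
    rcases hk.eq_or_lt with rfl | hk
    · exact h.apply_zero
    · rcases (show 1 ≤ k from hk).eq_or_lt with rfl | hk
      · exact h1
      · exact h.eq_zero_of_one_lt k hk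
  have hneg := (hasSum_zero_iff_of_nonneg (f := fun k : ℤ => -((k : ℝ) * (ν k).toReal)) (by
    intro k
    rcases le_or_gt 0 k with hk | hk
    · simp [hpos k hk]
    · have : (k : ℝ) ≤ 0 := by exact_mod_cast hk.le
      simpa using mul_nonpos_of_nonpos_of_nonneg this ENNReal.toReal_nonneg)).1
    (by simpa using h.centered.neg)
  have hz : ∀ k : ℤ, ν k = 0 := by
    intro k
    rcases le_or_gt 0 k with hk | hk
    · exact hpos k hk
    · have := congrFun hneg k
      have hk' : (k : ℝ) ≠ 0 := by exact_mod_cast hk.ne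
      simpa [hk', ENNReal.toReal_eq_zero_iff, ν.apply_ne_top k] using this
  have := ν.tsum_coe
  simp [hz] at this

theorem apply_one_ne_one (h : IsStepLaw ν) : ν 1 ≠ 1 := by
  intro h1
  have hs : ν.support = {1} := (ν.apply_eq_one_iff 1).1 h1
  have hz : ∀ k : ℤ, k ≠ 1 → ν k = 0 := by
    intro k hk
    rw [PMF.apply_eq_zero_iff, hs]
    exact hk
  have := (hasSum_single (f := fun k : ℤ => (k : ℝ) * (ν k).toReal) 1
    (by intro k hk; simp [hz k hk])).unique h.centered
  simp [h1] at this

theorem tsum_neg (h : IsStepLaw ν) : ∑' k : ℕ, ν (-(k : ℤ)) = 1 - ν 1 := by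
  have h1 := ν.tsum_coe
  rw [tsum_of_nat_of_neg_add_one ENNReal.summable ENNReal.summable] at h1
  have h2 : ∑' n : ℕ, ν (n : ℤ) = ν 1 := by
    rw [tsum_eq_single 1]
    · simp
    · intro n hn
      rcases Nat.eq_zero_or_pos n with rfl | hn'
      · simpa using h.apply_zero
      · exact h.eq_zero_of_one_lt _ (by omega)
  rw [h2] at h1
  rw [tsum_eq_zero_add' ENNReal.summable]
  have h3 : ν (-((0 : ℕ) : ℤ)) = 0 := by simpa using h.apply_zero
  rw [h3, zero_add]
  simp only [Nat.cast_add, Nat.cast_one]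
  rw [← h1, ENNReal.add_sub_cancel_left (ν.apply_ne_top 1)]

end IsStepLaw

/-- The white offspring distribution `k ↦ ν(1) (1 - ν(1))^k`. -/
noncomputable def nuWhite (ν : PMF ℤ) (h : IsStepLaw ν) : PMF ℕ :=
  ⟨fun k => ν 1 * (1 - ν 1) ^ k, by
    rw [ENNReal.summable.hasSum_iff, ENNReal.tsum_mul_left, ENNReal.tsum_geometric,
      ENNReal.sub_sub_cancel ENNReal.one_ne_top (ν.coe_le_one 1),
      ENNReal.mul_inv_cancel h.apply_one_ne_zero (ν.apply_ne_top 1)]⟩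

/-- The black offspring distribution `k ↦ ν(-k) / (1 - ν(1))`. -/
noncomputable def nuBlack (ν : PMF ℤ) (h : IsStepLaw ν) : PMF ℕ :=
  ⟨fun k => ν (-(k : ℤ)) / (1 - ν 1), by
    rw [ENNReal.summable.hasSum_iff]
    simp only [div_eq_mul_inv]
    rw [ENNReal.tsum_mul_right, h.tsum_neg, ENNReal.mul_inv_cancel]
    · rw [Ne, tsub_eq_zero_iff_le, not_le]
      exact lt_of_le_of_ne (ν.coe_le_one 1) h.apply_one_ne_one
    · exact ENNReal.sub_ne_top ENNReal.one_ne_top⟩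

end ComponentTree

namespace ComponentTree

open scoped ENNReal

/-! ### Plane trees given by numbers of children -/

namespace PlaneTree

/-! The integer `i` names the corner of an internal face at the origin of `i → i + 1`, hence an edge
of the tree of components. The tree is thus coded by two permutations of `ℤ`: `predPerm`, which
turns around white vertices, and `facePerm`, which sends `i` to the cyclic predecessor of `i + 1`
and turns around black vertices. Each internal face contains exactly one down-step of the pair of
walks, and a down-step of size `k` gives a face with `k + 1` edges, that is, a black vertex with `k`
children.

Cut at the `n`-th strict descending record time `N` of `C`, and at the time `-x` after which `C'`
stays at or above `-C N`. The edges in `[x, N)` are exactly those that are not above the white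
vertex `v` of height `2n` on the spine. The relations `i + 1 = predPerm⁻¹ (facePerm i)` and `i - 1 =
facePerm⁻¹ (predPerm i)` let one read the contour off the tree, so this finite piece of the tree and
the two finite path segments determine each other (`IsCodingPair.agree_of_cutKey_eq`,
`IsCodingPair.cutKey_eq_of_agree`).

The weights also match. Without `v`, the finite piece has as many white vertices as there are
up-steps, and the offspring numbers of its white vertices add up to the number of its black
vertices; so its Galton-Watson weight is the product of `ν` over the steps
(`IsEdgeCut.prod_weights`). For Kesten's tree this weight is the probability of the piece together
with its spine: size-biasing and the uniform choice of a child leave `p(k) / m` at each spine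
vertex, and the two means have product one (`kestenMeasure_kestenEvent`). For the walks it is the
probability that `C` follows its segment and that `C'` follows its own and then stays at or above
its endpoint (`measure_forall_le`). Both laws are therefore described by partitions with the same
weights, and `n` is arbitrary.

The probabilistic input is potential theory for the walk killed below `0`. The renewal series is
never unfolded: since `Q` is a probability measure, the normalized `V` is finite, harmonic and equal
to `1` at `0`. Centering gives it increments in `[0, 1]` and makes it unbounded, and skip-freeness
makes harmonic functions unique up to a factor. So there is no nonzero bounded harmonic function
with values in `[0, 1]` and the killed walk dies almost surely. Hence `C` has inferior limit `-∞`,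
`C'` is transient, and `V` disappears from the last-passage probabilities. -/

theorem concat_mem_ofNumChildren {k : List ℕ → ℕ} {w : List ℕ} {j : ℕ} :
    w ++ [j] ∈ (ofNumChildren k).verts ↔ w ∈ (ofNumChildren k).verts ∧ j < k w := by
  constructor
  · intro h
    exact ⟨(ofNumChildren k).parent_mem w j h, h w j List.prefix_rfl⟩
  · rintro ⟨hw, hj⟩ u i hu
    rcases List.prefix_concat_iff.1 hu with h | h
    · obtain ⟨rfl, h2⟩ := List.append_inj' h rfl
      obtain rfl : i = j := by simpa using h2
      exact hj
    · exact hw u i h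

theorem mem_of_prefix {k : List ℕ → ℕ} {u w : List ℕ} (h : u <+: w)
    (hw : w ∈ (ofNumChildren k).verts) : u ∈ (ofNumChildren k).verts :=
  fun v j hv => hw v j (hv.trans h)

/-- The vertices of a tree that are not descendants of `v` (including `v` itself). -/
def offVerts (k : List ℕ → ℕ) (v : List ℕ) : Set (List ℕ) :=
  {w | w ∈ (ofNumChildren k).verts ∧ ¬ v <+: w}

/-- The vertices of a tree that are not strict descendants of `v`. -/
def offVerts' (k : List ℕ → ℕ) (v : List ℕ) : Set (List ℕ) :=
  {w | w ∈ (ofNumChildren k).verts ∧ (v <+: w → w = v)}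

theorem offVerts_subset (k : List ℕ → ℕ) (v : List ℕ) : offVerts k v ⊆ offVerts' k v :=
  fun _ h => ⟨h.1, fun h' => absurd h' h.2⟩

/-- `offVerts` holds the vertices whose numbers of children are prescribed, and `offVerts'` the
vertices that these numbers produce, possibly including `v` itself. -/
theorem concat_mem_offVerts' {k : List ℕ → ℕ} {v w : List ℕ} {j : ℕ} :
    w ++ [j] ∈ offVerts' k v ↔ w ∈ offVerts k v ∧ j < k w := by
  simp only [offVerts, offVerts', Set.mem_ofPred_eq, concat_mem_ofNumChildren]
  constructor
  · rintro ⟨⟨h1, h2⟩, h3⟩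
    refine ⟨⟨h1, fun h => ?_⟩, h2⟩
    have := h3 (h.trans (List.prefix_append _ _))
    have hl := h.length_le
    rw [← this] at hl
    simp at hl
  · rintro ⟨⟨h1, h2⟩, h3⟩
    refine ⟨⟨h1, h3⟩, fun h => ?_⟩
    rcases List.prefix_concat_iff.1 h with h | h
    · exact h.symm
    · exact absurd h h2

theorem nil_mem_offVerts' (k : List ℕ → ℕ) (v : List ℕ) : [] ∈ offVerts' k v :=
  ⟨(ofNumChildren k).nil_mem, fun h => (List.prefix_nil.1 h).symm⟩

/-- Two families of numbers of children that agree off the descendants of `v` give trees that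
agree off the strict descendants of `v`. -/
theorem offVerts'_subset_of_agree {k k' : List ℕ → ℕ} {v : List ℕ}
    (h : ∀ w ∈ offVerts k v, k w = k' w) : offVerts' k v ⊆ offVerts' k' v := by
  intro w
  induction w using List.reverseRecOn with
  | nil => exact fun _ => nil_mem_offVerts' _ _
  | append_singleton u j ih =>
    intro hw
    have h1 := concat_mem_offVerts'.1 hw
    have h2 := ih (offVerts_subset _ _ h1.1)
    exact concat_mem_offVerts'.2 ⟨⟨h2.1, h1.1.2⟩, by rw [← h u h1.1]; exact h1.2⟩

theorem offVerts_subset_of_agree {k k' : List ℕ → ℕ} {v : List ℕ}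
    (h : ∀ w ∈ offVerts k v, k w = k' w) : offVerts k v ⊆ offVerts k' v :=
  fun _ hw => ⟨(offVerts'_subset_of_agree h (offVerts_subset _ _ hw)).1, hw.2⟩

theorem mem_iff_mem_offVerts' {k : List ℕ → ℕ} {v w : List ℕ} (h : w.length ≤ v.length) :
    w ∈ (ofNumChildren k).verts ↔ w ∈ offVerts' k v :=
  ⟨fun hw => ⟨hw, fun hv => (hv.eq_of_length_le h).symm⟩, fun hw => hw.1⟩

end PlaneTree

/-! ### Finite cycles of permutations -/

section Cycles

variable {α : Type*}

/-- The cycle of `d` under the permutation `g`. -/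
def cycleSet (g : Equiv.Perm α) (d : α) : Set α := {e | g.SameCycle d e}

theorem self_mem_cycleSet (g : Equiv.Perm α) (d : α) : d ∈ cycleSet g d := Equiv.Perm.SameCycle.rfl

theorem cycleSet_eq {g : Equiv.Perm α} {d e : α} (h : g.SameCycle d e) :
    cycleSet g e = cycleSet g d := by
  ext x; exact ⟨fun hx => h.trans hx, fun hx => h.symm.trans hx⟩

theorem cycleSet_inv (g : Equiv.Perm α) (d : α) : cycleSet g⁻¹ d = cycleSet g d := by
  ext x; exact Equiv.Perm.sameCycle_inv

theorem isCycleOn_cycleSet (g : Equiv.Perm α) (d : α) : g.IsCycleOn (cycleSet g d) := by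
  refine ⟨⟨fun x hx => Equiv.Perm.sameCycle_apply_right.2 hx, g.injective.injOn, fun x hx => ?_⟩,
    fun x hx y hy => hx.symm.trans hy⟩
  exact ⟨g⁻¹ x, by simpa [cycleSet] using hx, by simp⟩

variable {g : Equiv.Perm α} {d : α}

theorem pow_apply_eq_pow_apply_iff (hf : (cycleSet g d).Finite) {e : α} (he : e ∈ cycleSet g d)
    {i j : ℕ} : (g ^ i) e = (g ^ j) e ↔ i ≡ j [MOD (cycleSet g d).ncard] := by
  have h : g.IsCycleOn (hf.toFinset : Set α) := by simpa using isCycleOn_cycleSet g d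
  rw [Set.ncard_eq_toFinset_card _ hf]
  exact h.pow_apply_eq_pow_apply (by simpa using he)

theorem ncard_cycleSet_pos (hf : (cycleSet g d).Finite) : 0 < (cycleSet g d).ncard :=
  (Set.ncard_pos hf).2 ⟨d, self_mem_cycleSet g d⟩

theorem exists_pow_lt (hf : (cycleSet g d).Finite) {e e' : α} (he : e ∈ cycleSet g d)
    (he' : e' ∈ cycleSet g d) : ∃ j < (cycleSet g d).ncard, (g ^ j) e = e' := by
  have h : g.IsCycleOn (hf.toFinset : Set α) := by simpa using isCycleOn_cycleSet g d
  rw [Set.ncard_eq_toFinset_card _ hf]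
  exact h.exists_pow_eq (by simpa using he) (by simpa using he')

/-- Exponents run over `1, …, n` and not `0, …, n - 1`: children are listed after the edge to the
parent, which comes back at exponent `n`. -/
theorem exists_pow_succ (hf : (cycleSet g d).Finite) {e e' : α} (he : e ∈ cycleSet g d)
    (he' : e' ∈ cycleSet g d) : ∃ j < (cycleSet g d).ncard, (g ^ (j + 1)) e = e' := by
  obtain ⟨j, hj, h⟩ := exists_pow_lt hf (e := g e) (Equiv.Perm.sameCycle_apply_right.2 he) he'
  exact ⟨j, hj, by rwa [pow_succ, Equiv.Perm.mul_apply]⟩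

theorem pow_succ_inj (hf : (cycleSet g d).Finite) {e : α} (he : e ∈ cycleSet g d) {i j : ℕ}
    (hi : i < (cycleSet g d).ncard) (hj : j < (cycleSet g d).ncard)
    (h : (g ^ (i + 1)) e = (g ^ (j + 1)) e) : i = j :=
  Nat.ModEq.eq_of_lt_of_lt (Nat.ModEq.add_right_cancel' 1
    ((pow_apply_eq_pow_apply_iff hf he).1 h)) hi hj

theorem pow_succ_ne (hf : (cycleSet g d).Finite) {e : α} (he : e ∈ cycleSet g d) {i : ℕ}
    (hi : i + 1 < (cycleSet g d).ncard) : (g ^ (i + 1)) e ≠ e := by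
  intro h
  have := (pow_apply_eq_pow_apply_iff hf he (i := i + 1) (j := 0)).1 (by simpa using h)
  have := Nat.ModEq.eq_of_lt_of_lt this hi (by omega)
  omega

end Cycles

/-! ### Trees coded by two permutations of their edges -/

section EdgeTree

variable {α : Type*} (p f : Equiv.Perm α) (o : α)

/-- The permutation that turns around the vertices of colour `c` (`true` for black). -/
def turn : Bool → Equiv.Perm α
  | true => f⁻¹
  | false => p

/-- The `j`-th child of the vertex of colour `x.2` with edge `x.1` to its parent. -/
def edgeStep (x : α × Bool) (j : ℕ) : α × Bool := ((turn p f x.2 ^ (j + 1)) x.1, !x.2)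

/-- The edge to the parent and the colour of the vertex with a given word. The root is white and
its children are given by the edges `o`, `p o`, `p (p o)`, etc. -/
def edgeAt (w : List ℕ) : α × Bool := w.foldl (edgeStep p f) (p⁻¹ o, false)

/-- The number of children of the vertex with a given word. -/
noncomputable def edgeCount (w : List ℕ) : ℕ :=
  (cycleSet (turn p f (edgeAt p f o w).2) (edgeAt p f o w).1).ncard - if w = [] then 0 else 1

theorem edgeAt_concat (w : List ℕ) (j : ℕ) :
    edgeAt p f o (w ++ [j]) = edgeStep p f (edgeAt p f o w) j := by
  simp [edgeAt, List.foldl_append]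

theorem edgeAt_snd (w : List ℕ) : (edgeAt p f o w).2 = !decide (Even w.length) := by
  induction w using List.reverseRecOn with
  | nil => simp [edgeAt]
  | append_singleton u j ih =>
    rw [edgeAt_concat, edgeStep, ih]
    by_cases h : Even u.length <;> simp [h, Nat.even_add_one]

/-- The conditions under which the permutations `p` and `f` code a plane tree with edges `α`: `col`
is the colour of the lower endpoint of an edge, and `r` is a potential that bounds the height. -/
structure IsEdgeTree (col : α → Bool) (r : α → ℕ) : Prop where
  finite : ∀ c d, (cycleSet (turn p f c) d).Finite
  root : ∀ d, p.SameCycle o d → col d = true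
  exists_white : ∀ d, ¬ p.SameCycle o d → ∃ e, p.SameCycle d e ∧ col e = false ∧ r e ≤ r d
  unique : ∀ c d e, (turn p f c).SameCycle d e → col d = c → col e = c → d = e
  exists_black : ∀ d, ∃ e, f.SameCycle d e ∧ col e = true ∧ (col d = false → r e < r d)

/-- The vertices of the tree coded by `p` and `f`. -/
def edgeVerts : Set (List ℕ) := (PlaneTree.ofNumChildren (edgeCount p f o)).verts

namespace IsEdgeTree

variable {p f o} {col : α → Bool} {r : α → ℕ}

/-- The fictitious parent edge `p⁻¹ o` makes `p ^ j o` the `j`-th child of the root by the rule that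
serves at all other vertices. -/
theorem edgeAt_nil : edgeAt p f o [] = (p⁻¹ o, false) := rfl

theorem cycleSet_root : cycleSet p (p⁻¹ o) = cycleSet p o :=
  cycleSet_eq ⟨-1, by simp⟩

/-- Around a vertex other than the root, `unique` allows only the parent edge to carry the colour of
the vertex, so the edges to the children carry the other one. Around the root, all edges are black.
-/
theorem col_edgeAt (h : IsEdgeTree p f o col r) {w : List ℕ} (hw : w ∈ edgeVerts p f o)
    (hn : w ≠ []) : col (edgeAt p f o w).1 = (edgeAt p f o w).2 := by
  induction w using List.reverseRecOn with
  | nil => exact absurd rfl hn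
  | append_singleton u j ih =>
    obtain ⟨hu, hj⟩ := PlaneTree.concat_mem_ofNumChildren.1 hw
    rw [edgeAt_concat]
    rcases eq_or_ne u [] with rfl | hu0
    · exact h.root _ ⟨(j : ℤ), by simp [edgeStep, edgeAt, turn, pow_succ]⟩
    · have ih := ih hu hu0
      rw [edgeCount, if_neg hu0] at hj
      set x := edgeAt p f o u with hx
      have hf := h.finite x.2 x.1
      have hne := pow_succ_ne hf (self_mem_cycleSet _ _) (i := j) (by omega)
      have hs : (turn p f x.2).SameCycle x.1 ((turn p f x.2 ^ (j + 1)) x.1) := ⟨((j + 1 : ℕ) : ℤ), by rw [zpow_natCast]⟩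
      by_contra hc
      refine hne (h.unique x.2 _ _ hs ih ?_).symm
      simpa [edgeStep] using hc

/-- The exponent that returns to the parent edge is excluded by `hn`, except at the root, where it
gives the last child. -/
theorem exists_child (h : IsEdgeTree p f o col r) {w : List ℕ} {e : α}
    (he : (turn p f (edgeAt p f o w).2).SameCycle (edgeAt p f o w).1 e)
    (hn : w ≠ [] → e ≠ (edgeAt p f o w).1) :
    ∃ j < edgeCount p f o w, edgeAt p f o (w ++ [j]) = (e, !(edgeAt p f o w).2) := by
  have hf := h.finite (edgeAt p f o w).2 (edgeAt p f o w).1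
  obtain ⟨j, hj, hje⟩ := exists_pow_succ hf (self_mem_cycleSet _ _) he
  refine ⟨j, ?_, by rw [edgeAt_concat, edgeStep, hje]⟩
  rw [edgeCount]
  split_ifs with h0
  · exact hj
  · by_contra hc
    have : j + 1 = (cycleSet (turn p f (edgeAt p f o w).2) (edgeAt p f o w).1).ncard := by omega
    refine hn h0 ?_
    rw [← hje]
    have := (pow_apply_eq_pow_apply_iff hf (self_mem_cycleSet _ _) (i := j + 1) (j := 0)).2
      (by rw [this]; simp [Nat.ModEq])
    simpa using this

theorem concat_mem {w : List ℕ} {j : ℕ} :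
    w ++ [j] ∈ edgeVerts p f o ↔ w ∈ edgeVerts p f o ∧ j < edgeCount p f o w :=
  PlaneTree.concat_mem_ofNumChildren

theorem nil_mem : [] ∈ edgeVerts p f o := PlaneTree.nil_mem _

theorem exists_white_child (h : IsEdgeTree p f o col r) {w : List ℕ} (hw : w ∈ edgeVerts p f o)
    {b d : α} (hb : edgeAt p f o w = (b, true)) (hd : f.SameCycle b d) (hne : d ≠ b) :
    ∃ j, w ++ [j] ∈ edgeVerts p f o ∧ edgeAt p f o (w ++ [j]) = (d, false) := by
  obtain ⟨j, hj, hje⟩ := h.exists_child (w := w) (e := d)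
    (by rw [hb]; exact Equiv.Perm.sameCycle_inv.2 hd) (fun _ => by rwa [hb])
  exact ⟨j, concat_mem.2 ⟨hw, hj⟩, by rw [hje, hb]; rfl⟩

theorem exists_black_child (h : IsEdgeTree p f o col r) {w : List ℕ} (hw : w ∈ edgeVerts p f o)
    {b d : α} (hb : edgeAt p f o w = (b, false)) (hd : p.SameCycle b d) (hne : w ≠ [] → d ≠ b) :
    ∃ j, w ++ [j] ∈ edgeVerts p f o ∧ edgeAt p f o (w ++ [j]) = (d, true) := by
  obtain ⟨j, hj, hje⟩ := h.exists_child (w := w) (e := d)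
    (by rw [hb]; exact hd) (fun h0 => by rw [hb]; exact hne h0)
  exact ⟨j, concat_mem.2 ⟨hw, hj⟩, by rw [hje, hb]; rfl⟩

/-- Every edge is the edge of a vertex to its parent. -/
theorem exists_word (h : IsEdgeTree p f o col r) (d : α) :
    ∃ w ∈ edgeVerts p f o, w ≠ [] ∧ edgeAt p f o w = (d, col d) := by
  induction hn : r d using Nat.strong_induction_on generalizing d with
  | _ n ih =>
    subst hn
    -- A white edge is reached from the black edge of its face, whose potential is smaller. A black
    -- edge away from the root is reached from the white edge at its white vertex, whose potential
    -- is not larger.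
    have white : ∀ d', r d' ≤ r d → col d' = false →
        ∃ w ∈ edgeVerts p f o, w ≠ [] ∧ edgeAt p f o w = (d', col d') := by
      intro d' hr hc
      obtain ⟨b, hb, hbc, hbr⟩ := h.exists_black d'
      obtain ⟨w, hw, -, hwb⟩ := ih (r b) (by have := hbr hc; omega) b rfl
      rw [hbc] at hwb
      obtain ⟨j, hj, hje⟩ := h.exists_white_child hw hwb hb.symm
        (by rintro rfl; rw [hc] at hbc; cases hbc)
      exact ⟨_, hj, by simp, by rw [hje, hc]⟩
    rcases hc : col d with _ | _
    · simpa [hc] using white d le_rfl hc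
    · by_cases hd : p.SameCycle o d
      · obtain ⟨j, hj, hje⟩ := h.exists_black_child (w := []) nil_mem rfl
          (show p.SameCycle (p⁻¹ o) d from by simpa using hd) (by simp)
        exact ⟨_, hj, by simp, hje⟩
      · obtain ⟨e, he, hec, her⟩ := h.exists_white d hd
        obtain ⟨w, hw, hw0, hwe⟩ := white e her hec
        rw [hec] at hwe
        obtain ⟨j, hj, hje⟩ := h.exists_black_child hw hwe he.symm
          (by rintro - rfl; rw [hc] at hec; cases hec)
        exact ⟨_, hj, by simp, hje⟩

theorem sameCycle_concat (w : List ℕ) (j : ℕ) :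
    (turn p f (edgeAt p f o w).2).SameCycle (edgeAt p f o w).1 (edgeAt p f o (w ++ [j])).1 := by
  rw [edgeAt_concat]
  exact ⟨((j + 1 : ℕ) : ℤ), by rw [zpow_natCast]; rfl⟩

/-- Distinct vertices have distinct edges to their parents. -/
theorem edgeAt_injOn (h : IsEdgeTree p f o col r) {w w' : List ℕ} (hw : w ∈ edgeVerts p f o)
    (hw' : w' ∈ edgeVerts p f o) (hn : w ≠ []) (hn' : w' ≠ [])
    (he : (edgeAt p f o w).1 = (edgeAt p f o w').1) : w = w' := by
  induction w using List.reverseRecOn generalizing w' with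
  | nil => exact absurd rfl hn
  | append_singleton u j ih =>
    rcases List.eq_nil_or_concat' w' with rfl | ⟨u', j', rfl⟩
    · exact absurd rfl hn'
    have hc := h.col_edgeAt hw hn
    rw [he, h.col_edgeAt hw' hn'] at hc
    have hcu : (edgeAt p f o u).2 = (edgeAt p f o u').2 := by
      simpa [edgeAt_concat, edgeStep] using hc.symm
    obtain ⟨hu, hj⟩ := concat_mem.1 hw
    obtain ⟨hu', hj'⟩ := concat_mem.1 hw'
    have hs := sameCycle_concat (p := p) (f := f) (o := o) u j
    have hs' := sameCycle_concat (p := p) (f := f) (o := o) u' j'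
    rw [← he, ← hcu] at hs'
    have hss := hs.trans hs'.symm
    -- The two parents share a cycle, so `unique` identifies their parent edges. The root is told
    -- apart from the other vertices because all its edges are black.
    have huu : u = u' := by
      by_cases h0 : u = [] <;> by_cases h0' : u' = []
      · rw [h0, h0']
      · exfalso
        subst h0
        have hc' := h.col_edgeAt hu' h0'
        have := h.root (edgeAt p f o u').1 (by
          simpa [edgeAt_nil, turn] using hss)
        rw [this, ← hcu] at hc'
        simp [edgeAt_nil] at hc'
      · exfalso
        subst h0'
        have hc' := h.col_edgeAt hu h0
        rw [hcu] at hss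
        have := h.root (edgeAt p f o u).1 (by
          simpa [edgeAt_nil, turn] using hss.symm)
        rw [this, hcu] at hc'
        simp [edgeAt_nil] at hc'
      · exact ih hu hu' h0 h0' (h.unique _ _ _ hss (h.col_edgeAt hu h0)
          (by rw [h.col_edgeAt hu' h0', hcu]))
    subst huu
    have hf := h.finite (edgeAt p f o u).2 (edgeAt p f o u).1
    rw [edgeAt_concat, edgeAt_concat] at he
    rw [pow_succ_inj hf (self_mem_cycleSet _ _) (by unfold edgeCount at hj; omega)
      (by unfold edgeCount at hj'; omega) he]

end IsEdgeTree
end EdgeTree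

/-- Cycles are transported as soon as single steps are. This serves to pass between darts and chain
indices in both directions. -/
theorem sameCycle_map {α β : Type*} {g : Equiv.Perm α} {g' : Equiv.Perm β} (q : α → β)
    (h : ∀ a, g'.SameCycle (q a) (q (g a))) {a b : α} (hab : g.SameCycle a b) :
    g'.SameCycle (q a) (q b) := by
  obtain ⟨n, rfl⟩ := hab
  induction n using Int.induction_on with
  | zero => simpa using Equiv.Perm.SameCycle.rfl
  | succ n ih =>
    refine ih.trans ?_
    rw [add_comm, zpow_add, zpow_one, Equiv.Perm.mul_apply]
    exact h _
  | pred n ih =>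
    refine ih.trans (Equiv.Perm.SameCycle.symm ?_)
    have := h ((g ^ (-(n : ℤ) - 1)) a)
    rwa [← Equiv.Perm.mul_apply, ← zpow_one_add, add_sub_cancel] at this

/-! ### The tree of components of a map coded by an equivalence relation -/

section ChainMap

variable (s : Setoid ℤ)

/-- The cyclic predecessor in the equivalence class, as a permutation. -/
noncomputable def predPerm : Equiv.Perm ℤ where
  toFun := cyclicPred s
  invFun := cyclicSucc s
  left_inv := cyclicSucc_cyclicPred s
  right_inv := cyclicPred_cyclicSucc s

/-- The permutation that describes the contours of the internal faces. -/
noncomputable def facePerm : Equiv.Perm ℤ := predPerm s * Equiv.addRight 1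

theorem predPerm_apply (i : ℤ) : predPerm s i = cyclicPred s i := rfl

theorem facePerm_apply (i : ℤ) : facePerm s i = predPerm s (i + 1) := rfl

theorem predPerm_inv_facePerm (i : ℤ) : (predPerm s)⁻¹ (facePerm s i) = i + 1 := by
  rw [Equiv.Perm.inv_eq_iff_eq, facePerm_apply]

theorem facePerm_inv_predPerm (i : ℤ) : (facePerm s)⁻¹ (predPerm s i) = i - 1 := by
  rw [Equiv.Perm.inv_eq_iff_eq, facePerm_apply, sub_add_cancel]

/-- The dart from `i` to `i + 1` for `b = true`, and its reverse for `b = false`. -/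
def chainDart (i : ℤ) (b : Bool) : (chainMap s).Dart := (i, b)

theorem chainDart_cases (d : (chainMap s).Dart) : ∃ i b, d = chainDart s i b := ⟨d.1, d.2, rfl⟩

theorem chainMap_rot_inv_true (i : ℤ) :
    (chainMap s).rot⁻¹ (chainDart s i true) = chainDart s (i - 1) false := rfl

theorem chainMap_rot_inv_false (i : ℤ) :
    (chainMap s).rot⁻¹ (chainDart s i false) = chainDart s (predPerm s (i + 1)) true := rfl

theorem chainMap_faceNext_true (i : ℤ) :
    (chainMap s).faceNext (chainDart s i true) = chainDart s (facePerm s i) true := rfl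

theorem chainMap_faceNext_false (i : ℤ) :
    (chainMap s).faceNext (chainDart s i false) = chainDart s (i - 1) false := rfl

/-- The Boolean of a dart is invariant along faces. -/
theorem chainMap_faceNext_color {i j : ℤ} {b c : Bool}
    (h : (chainMap s).faceNext.SameCycle (chainDart s i b) (chainDart s j c)) : b = c := by
  have := sameCycle_map (g := (chainMap s).faceNext) (g' := (1 : Equiv.Perm Bool))
    (q := fun d : (chainMap s).Dart => (show ℤ × Bool from d).2)
    (by rintro ⟨i, _ | _⟩ <;> exact Equiv.Perm.SameCycle.rfl) h
  exact Equiv.Perm.sameCycle_one.1 this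

/-- The darts `(i, false)` form a single cycle, along which `i` decreases by one: this is the root
face. -/
theorem chainMap_isInner (i : ℤ) (b : Bool) :
    (chainMap s).IsInner (chainDart s i b) ↔ b = true := by
  constructor
  · intro h
    rcases b with _ | _
    · exact absurd (sameCycle_map (g := (Equiv.addRight (-1) : Equiv.Perm ℤ))
        (g' := (chainMap s).faceNext) (q := fun i => chainDart s i false)
        (fun a => ⟨1, by rw [zpow_one]; exact chainMap_faceNext_false s a⟩) (a := 0) (b := i)
        ⟨-i, by simp⟩) h
    · rfl
  · rintro rfl h
    exact Bool.false_ne_true (chainMap_faceNext_color s (i := 0) h)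

theorem chainDart_injective : Function.Injective fun j => chainDart s j true :=
  fun _ _ h => congrArg (fun d : (chainMap s).Dart => (show ℤ × Bool from d).1) h

/-- Around a vertex, internal corners alternate with corners of the root face, so two rotations make
one step of `predPerm`. -/
theorem chainMap_rot_inv_sq (i : ℤ) :
    ((chainMap s).rot⁻¹ ^ (1 + 1)) (chainDart s i true) = chainDart s (predPerm s i) true := by
  rw [pow_succ, pow_one, Equiv.Perm.mul_apply, chainMap_rot_inv_true, chainMap_rot_inv_false,
    sub_add_cancel]

theorem chainMap_vertexCorners (i : ℤ) :
    (chainMap s).vertexCorners (chainDart s i true)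
      = (fun j => chainDart s j true) '' cycleSet (predPerm s) i := by
  ext d
  obtain ⟨j, b, rfl⟩ := chainDart_cases s d
  constructor
  · rintro ⟨h1, h2⟩
    obtain rfl := (chainMap_isInner s j b).1 h2
    refine ⟨j, ?_, rfl⟩
    -- A dart is sent to the chain index of its origin, which is `i + 1` for `(i, false)`.
    exact sameCycle_map (g := (chainMap s).rot) (g' := predPerm s)
      (q := fun d : (chainMap s).Dart =>
        if (show ℤ × Bool from d).2 then (show ℤ × Bool from d).1 else
          (show ℤ × Bool from d).1 + 1) (by
        rintro ⟨k, _ | _⟩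
        · exact Equiv.Perm.SameCycle.rfl
        · exact ⟨-1, (sub_add_cancel _ _).symm⟩) h1
  · rintro ⟨k, hk, h⟩
    obtain ⟨rfl, rfl⟩ := Prod.mk.inj h
    refine ⟨?_, (chainMap_isInner s k true).2 rfl⟩
    exact sameCycle_map (g := predPerm s) (g' := (chainMap s).rot)
      (q := fun i => chainDart s i true)
      (fun a => ⟨-2, by
        rw [zpow_neg, show (2 : ℤ) = ((1 + 1 : ℕ) : ℤ) from rfl, zpow_natCast, ← inv_pow,
          chainMap_rot_inv_sq]⟩) hk

theorem chainMap_faceCorners (i : ℤ) :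
    (chainMap s).faceCorners (chainDart s i true)
      = (fun j => chainDart s j true) '' cycleSet (facePerm s) i := by
  ext d
  obtain ⟨j, b, rfl⟩ := chainDart_cases s d
  constructor
  · intro h1
    obtain rfl : true = b := chainMap_faceNext_color s h1
    refine ⟨j, ?_, rfl⟩
    exact sameCycle_map (g := (chainMap s).faceNext)
      (g' := facePerm s) (q := fun d : (chainMap s).Dart =>
        if (show ℤ × Bool from d).2 then (show ℤ × Bool from d).1 else i) (by
        rintro ⟨k, _ | _⟩
        · exact Equiv.Perm.SameCycle.rfl
        · exact ⟨1, rfl⟩) h1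
  · rintro ⟨k, hk, h⟩
    obtain ⟨rfl, rfl⟩ := Prod.mk.inj h
    exact sameCycle_map (g := facePerm s) (g' := (chainMap s).faceNext)
      (q := fun i => chainDart s i true)
      (fun a => ⟨1, by rw [zpow_one, chainMap_faceNext_true]⟩) hk

theorem chainMap_nextCorner (i : ℤ) :
    (chainMap s).nextCorner (chainDart s i true) = chainDart s (predPerm s i) true := by
  have h0 : ¬ (chainMap s).IsInner (((chainMap s).rot⁻¹ ^ (0 + 1)) (chainDart s i true)) := by
    rw [zero_add, pow_one, chainMap_rot_inv_true, chainMap_isInner]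
    exact Bool.false_ne_true
  have h1 : (chainMap s).IsInner (((chainMap s).rot⁻¹ ^ (1 + 1)) (chainDart s i true)) := by
    rw [chainMap_rot_inv_sq, chainMap_isInner]
  have h : ∃ n : ℕ, (chainMap s).IsInner (((chainMap s).rot⁻¹ ^ (n + 1)) (chainDart s i true)) :=
    ⟨1, h1⟩
  classical
  rw [RootedMap.nextCorner, dif_pos h]
  have : Nat.find h = 1 := by
    rw [Nat.find_eq_iff]
    refine ⟨h1, fun n hn => ?_⟩
    obtain rfl : n = 0 := by omega
    exact h0
  rw [this, chainMap_rot_inv_sq]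

theorem chainMap_nextCorner_iterate (i : ℤ) (n : ℕ) :
    (chainMap s).nextCorner^[n] (chainDart s i true) = chainDart s ((predPerm s ^ n) i) true := by
  induction n with
  | zero => rfl
  | succ n ih =>
    rw [Function.iterate_succ_apply', ih, pow_succ', Equiv.Perm.mul_apply, chainMap_nextCorner]

theorem chainMap_faceNext_inv_pow (i : ℤ) (n : ℕ) :
    ((chainMap s).faceNext⁻¹ ^ n) (chainDart s i true)
      = chainDart s (((facePerm s)⁻¹ ^ n) i) true := by
  induction n with
  | zero => rfl
  | succ n ih =>
    rw [pow_succ', Equiv.Perm.mul_apply, ih, pow_succ', Equiv.Perm.mul_apply,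
      Equiv.Perm.inv_eq_iff_eq, chainMap_faceNext_true]
    simp

/-- The state of the exploration of the tree of components at a given edge. -/
def chainState (x : ℤ × Bool) : (chainMap s).Dart × Bool := (chainDart s x.1 true, x.2)

theorem chainMap_childStep (x : ℤ × Bool) (j : ℕ) :
    (chainMap s).childStep (chainState s x) j
      = chainState s (edgeStep (predPerm s) (facePerm s) x j) := by
  rcases x with ⟨i, _ | _⟩
  · exact Prod.ext (chainMap_nextCorner_iterate s i (j + 1)) rfl
  · exact Prod.ext (chainMap_faceNext_inv_pow s i (j + 1)) rfl

theorem chainMap_foldl_childStep (w : List ℕ) (x : ℤ × Bool) :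
    w.foldl (chainMap s).childStep (chainState s x)
      = chainState s (w.foldl (edgeStep (predPerm s) (facePerm s)) x) := by
  induction w generalizing x with
  | nil => rfl
  | cons j w ih => rw [List.foldl_cons, List.foldl_cons, chainMap_childStep, ih]

theorem chainMap_numChildren (w : List ℕ) :
    (chainMap s).numChildren w = edgeCount (predPerm s) (facePerm s) 0 w := by
  have inj := chainDart_injective s
  rcases w with _ | ⟨i, w⟩
  · change ((chainMap s).vertexCorners (chainDart s 0 true)).ncard = _
    rw [chainMap_vertexCorners, Set.ncard_image_of_injective _ inj, edgeCount, if_pos rfl]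
    exact congrArg Set.ncard IsEdgeTree.cycleSet_root.symm
  · rw [RootedMap.numChildren, edgeCount, if_neg (by simp)]
    have e0 : ((chainMap s).nextCorner^[i] (chainMap s).root, true)
        = chainState s (edgeStep (predPerm s) (facePerm s) ((predPerm s)⁻¹ 0, false) i) := by
      refine Prod.ext ((chainMap_nextCorner_iterate s 0 i).trans ?_) rfl
      simp [chainState, edgeStep, turn, pow_succ]
    rw [e0, chainMap_foldl_childStep]
    have e1 : edgeAt (predPerm s) (facePerm s) 0 (i :: w)
      = w.foldl (edgeStep (predPerm s) (facePerm s))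
          (edgeStep (predPerm s) (facePerm s) ((predPerm s)⁻¹ 0, false) i) := rfl
    rw [← e1]
    generalize edgeAt (predPerm s) (facePerm s) 0 (i :: w) = x
    rcases x with ⟨d, _ | _⟩
    · rw [chainState, RootedMap.numChildrenAt, chainMap_vertexCorners,
        Set.ncard_image_of_injective _ inj]
      rfl
    · rw [chainState, RootedMap.numChildrenAt, chainMap_faceCorners,
        Set.ncard_image_of_injective _ inj]
      simp only [turn, cycleSet_inv]

theorem chainMap_treeOfComponents :
    (chainMap s).treeOfComponents
      = PlaneTree.ofNumChildren (edgeCount (predPerm s) (facePerm s) 0) := by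
  rw [RootedMap.treeOfComponents, funext (chainMap_numChildren s)]

end ChainMap

/-! ### Cyclic predecessors in finite classes -/

section Pred

variable {s : Setoid ℤ}

theorem predPerm_mem_classOf (i : ℤ) : predPerm s i ∈ classOf s i := by
  rw [predPerm_apply, cyclicPred]
  split_ifs with h1 h2
  · exact (Int.csSup_mem h2 (h1.bddAbove.mono Set.inter_subset_left)).1
  · exact Int.csSup_mem ⟨i, self_mem_classOf s i⟩ h1.bddAbove
  · exact self_mem_classOf s i

theorem predPerm_eq_of_lt {i j : ℤ} (hf : (classOf s i).Finite) (hj : s i j) (hji : j < i)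
    (hb : ∀ k, j < k → k < i → ¬ s i k) : predPerm s i = j := by
  have hn : (classOf s i ∩ Set.Iio i).Nonempty := ⟨j, hj, hji⟩
  rw [predPerm_apply, cyclicPred, if_pos hf, if_pos hn]
  refine le_antisymm (csSup_le hn fun k hk => ?_)
    (le_csSup (hf.bddAbove.mono Set.inter_subset_left) ⟨hj, hji⟩)
  by_contra! hc
  exact hb k hc hk.2 hk.1

theorem predPerm_eq_of_max {i j : ℤ} (hf : (classOf s i).Finite) (hj : s i j)
    (hm : ∀ k, s i k → i ≤ k) (hM : ∀ k, s i k → k ≤ j) : predPerm s i = j := by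
  have hn : ¬ (classOf s i ∩ Set.Iio i).Nonempty := by
    rintro ⟨k, hk, hk'⟩
    exact absurd (hm k hk) (not_le.2 hk')
  rw [predPerm_apply, cyclicPred, if_pos hf, if_neg hn]
  exact le_antisymm (csSup_le ⟨j, hj⟩ hM) (le_csSup hf.bddAbove hj)

/-- Starting from the maximum of a finite class, repeated predecessors run through all its elements;
`key` is an induction on the distance to the maximum. -/
theorem cycleSet_predPerm (hf : ∀ i, (classOf s i).Finite) (i : ℤ) :
    cycleSet (predPerm s) i = classOf s i := by
  have sub : ∀ i, cycleSet (predPerm s) i ⊆ classOf s i := by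
    intro i j hj
    have : ∀ n : ℕ, (predPerm s ^ n) i ∈ classOf s i := by
      intro n
      induction n with
      | zero => exact self_mem_classOf s i
      | succ n ih =>
        rw [pow_succ', Equiv.Perm.mul_apply]
        exact Setoid.trans' _ ih (predPerm_mem_classOf _)
    obtain ⟨n, rfl⟩ := hj
    rcases Int.eq_nat_or_neg n with ⟨m, rfl | rfl⟩
    · simpa using this m
    · have : ∀ n : ℕ, ((predPerm s)⁻¹ ^ n) i ∈ classOf s i := by
        intro n
        induction n with
        | zero => exact self_mem_classOf s i
        | succ n ih =>
          rw [pow_succ', Equiv.Perm.mul_apply]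
          have := predPerm_mem_classOf (s := s) ((predPerm s)⁻¹ (((predPerm s)⁻¹ ^ n) i))
          rw [show predPerm s ((predPerm s)⁻¹ (((predPerm s)⁻¹ ^ n) i)) = ((predPerm s)⁻¹ ^ n) i by simp] at this
          exact Setoid.trans' _ ih (Setoid.symm' _ this)
      simpa [zpow_neg] using this m
  refine (sub i).antisymm fun j hj => ?_
  have key : ∀ n : ℕ, ∀ j, s i j → sSup (classOf s i) - j ≤ n →
      (predPerm s).SameCycle (sSup (classOf s i)) j := by
    intro n
    induction n with
    | zero =>
      intro j hj hn
      have := le_csSup (hf i).bddAbove (show j ∈ classOf s i from hj)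
      rw [show j = sSup (classOf s i) by push_cast at hn; omega]
    | succ n ih =>
      intro j hj hn
      by_cases hlt : (classOf s i ∩ Set.Ioi j).Nonempty
      · have hb : BddBelow (classOf s i ∩ Set.Ioi j) := (hf i).bddBelow.mono Set.inter_subset_left
        have hm := Int.csInf_mem hlt hb
        set k := sInf (classOf s i ∩ Set.Ioi j) with hk
        have h1 := ih k hm.1 (by have : j < k := hm.2; push_cast at hn; omega)
        have h2 : predPerm s k = j := by
          refine predPerm_eq_of_lt (hf k) (Setoid.trans' _ (Setoid.symm' _ hm.1) hj) hm.2 ?_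
          intro l hl1 hl2 hkl
          have : k ≤ l := csInf_le hb ⟨Setoid.trans' _ hm.1 hkl, hl1⟩
          omega
        rw [← h2]
        exact Equiv.Perm.sameCycle_apply_right.2 h1
      · have h1 : sSup (classOf s i) ≤ j := by
          refine csSup_le ⟨j, hj⟩ fun k hk => ?_
          by_contra! hc
          exact hlt ⟨k, hk, hc⟩
        have := le_csSup (hf i).bddAbove (show j ∈ classOf s i from hj)
        rw [show j = sSup (classOf s i) by omega]
  have h1 := key (sSup (classOf s i) - j).toNat j hj (by omega)
  have h2 := key (sSup (classOf s i) - i).toNat i (Setoid.refl' _ _) (by omega)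
  exact h2.symm.trans h1

theorem sameCycle_predPerm_iff (hf : ∀ i, (classOf s i).Finite) {i j : ℤ} :
    (predPerm s).SameCycle i j ↔ s i j := by
  have := Set.ext_iff.1 (cycleSet_predPerm hf i) j
  exact this

end Pred

/-! ### The combinatorics of coding pairs -/

theorem exists_first {P : ℤ → Prop} {a b : ℤ} (hab : a ≤ b) (hb : P b) :
    ∃ t, a ≤ t ∧ t ≤ b ∧ P t ∧ ∀ s, a ≤ s → s < t → ¬ P s := by
  obtain ⟨t, ⟨h1, h2⟩, h3⟩ := Int.exists_least_of_bdd (P := fun z => a ≤ z ∧ P z)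
    ⟨a, fun z hz => hz.1⟩ ⟨b, hab, hb⟩
  exact ⟨t, h1, h3 b ⟨hab, hb⟩, h2, fun s hs1 hs2 hs3 => absurd (h3 s ⟨hs1, hs3⟩) (by omega)⟩

theorem exists_last {P : ℤ → Prop} {a b : ℤ} (hab : a ≤ b) (ha : P a) :
    ∃ t, a ≤ t ∧ t ≤ b ∧ P t ∧ ∀ s, t < s → s ≤ b → ¬ P s := by
  obtain ⟨t, ⟨h1, h2⟩, h3⟩ := Int.exists_greatest_of_bdd (P := fun z => z ≤ b ∧ P z)
    ⟨b, fun z hz => hz.1⟩ ⟨a, hab, ha⟩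
  exact ⟨t, h3 a ⟨hab, ha⟩, h1, h2, fun s hs1 hs2 hs3 => absurd (h3 s ⟨hs2, hs3⟩) (by omega)⟩

/-- The chain `i ≤ j` of `f` stays above the common value at its endpoints. -/
def Exc (g : ℤ → ℤ) (i j : ℤ) : Prop := g i = g j ∧ ∀ k, i ≤ k → k ≤ j → g i ≤ g k

/-- A coding pair read on the integers: `E` on the nonnegative ones, and `D` on the nonpositive
ones, together with the gluing relation. -/
structure IsWalkPair (E D : ℤ → ℤ) (s : Setoid ℤ) : Prop where
  E_zero : E 0 = 0
  D_zero : D 0 = 0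
  E_step : ∀ i, 0 ≤ i → E (i + 1) ≤ E i + 1
  E_ne : ∀ i, 0 ≤ i → E (i + 1) ≠ E i
  D_step : ∀ i < 0, D i ≤ D (i + 1) + 1
  D_ne : ∀ i < 0, D i ≠ D (i + 1)
  E_lim : ∀ b i : ℤ, ∃ j, i ≤ j ∧ 0 ≤ j ∧ E j < b
  D_nonneg : ∀ i ≤ 0, 0 ≤ D i
  D_lim : ∀ b : ℤ, ∃ i₀ ≤ 0, ∀ i ≤ i₀, b ≤ D i
  rel_pos : ∀ i j, 0 ≤ i → i ≤ j → (s i j ↔ Exc E i j)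
  rel_neg : ∀ i j, i ≤ j → j ≤ 0 → (s i j ↔ Exc D i j)
  rel_ray : ∀ i j, i ≤ 0 → 0 ≤ j →
    (s i j ↔ (∀ l ≤ i, D i ≤ D l) ∧ E j = -D i ∧ ∀ k, 0 ≤ k → k ≤ j → -D i ≤ E k)

/-- The edge `i` is at position `l` in the face that contains the down-step `t`. -/
def Face (E D : ℤ → ℤ) (t l i : ℤ) : Prop :=
  -- In the order of the cases: `i` is the last index up to `t` at a level crossed by a down-step `t
  -- ≥ 0`; `i` is a ray edge at a level first reached by such a down-step, which then goes below the
  -- earlier minimum; `i` is itself a down-step on the negative side; `i` is an up-step of `C'`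
  -- whose level is crossed by the down-step `t < 0`.
  (0 ≤ i ∧ i ≤ t ∧ E (t + 1) ≤ E i ∧ (∀ s, i < s → s ≤ t → E i < E s) ∧ l = E i - E (t + 1)) ∨
  (i < 0 ∧ 0 ≤ t ∧ D (i + 1) < D i ∧ (∀ s ≤ i, D i ≤ D s) ∧ E (t + 1) ≤ -D i ∧
    (∀ s, 0 ≤ s → s ≤ t → -D i < E s) ∧ l = -D i - E (t + 1)) ∨
  (t < 0 ∧ i = t ∧ D t < D (t + 1) ∧ l = 0) ∨
  (t < i ∧ i < 0 ∧ D (i + 1) < D i ∧ D t < D i ∧ (∀ s, t < s → s ≤ i → D i ≤ D s) ∧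
    l = D (t + 1) - D i + 1)

/-- The size of the down-step `t`. -/
def jump (E D : ℤ → ℤ) (t : ℤ) : ℤ := if 0 ≤ t then E t - E (t + 1) else D (t + 1) - D t

namespace IsWalkPair

variable {E D : ℤ → ℤ} {s : Setoid ℤ}

/-- A class is bounded above because `E` goes below every level, and below because `D` tends to
infinity. -/
theorem classOf_finite (h : IsWalkPair E D s) (i : ℤ) : (classOf s i).Finite := by
  have up : ∃ T, ∀ j, s i j → j ≤ T := by
    rcases le_total 0 i with hi | hi
    · obtain ⟨T, hT1, hT2, hT3⟩ := h.E_lim (E i) i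
      refine ⟨T, fun j hj => ?_⟩
      by_contra! hc
      have := ((h.rel_pos i j hi (by omega)).1 hj).2 T hT1 hc.le
      omega
    · obtain ⟨T, hT1, hT2, hT3⟩ := h.E_lim (-D i) 0
      refine ⟨T, fun j hj => ?_⟩
      by_contra! hc
      have := ((h.rel_ray i j hi (by omega)).1 hj).2.2 T hT1 hc.le
      omega
  have low : ∃ T, ∀ j, s i j → T ≤ j := by
    rcases le_total i 0 with hi | hi
    · obtain ⟨T, hT1, hT2⟩ := h.D_lim (D i + 1)
      refine ⟨min T i, fun j hj => ?_⟩
      by_contra! hc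
      have h1 := ((h.rel_neg j i (by omega) hi).1 (Setoid.symm' _ hj)).1
      have h2 := hT2 j (by omega)
      omega
    · obtain ⟨T, hT1, hT2⟩ := h.D_lim (-E i + 1)
      refine ⟨T, fun j hj => ?_⟩
      by_contra! hc
      have h1 := ((h.rel_ray j i (by omega) hi).1 (Setoid.symm' _ hj)).2.1
      have h2 := hT2 j (by omega)
      omega
  obtain ⟨T, hT⟩ := up
  obtain ⟨T', hT'⟩ := low
  exact (Set.finite_Icc T' T).subset fun j hj => ⟨hT' j hj, hT j hj⟩

/-- The first index of the chain of `D` at the level of `m`. -/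
theorem exists_top (h : IsWalkPair E D s) {m : ℤ} (hm : m ≤ 0) (hD : 0 < D m) :
    ∃ j, m ≤ j ∧ j < 0 ∧ D j = D m ∧ D (j + 1) < D j ∧ ∀ k, m ≤ k → k ≤ j → D m ≤ D k := by
  obtain ⟨t, h1, h2, h3, h4⟩ := exists_first (P := fun k => D k < D m) hm
    (by rw [h.D_zero]; exact hD)
  have hmt : m ≠ t := by rintro rfl; omega
  have h5 := h4 (t - 1) (by omega) (by omega)
  have h6 := h.D_step (t - 1) (by omega)
  rw [sub_add_cancel] at h6
  refine ⟨t - 1, by omega, by omega, by omega, by rw [sub_add_cancel]; omega, fun k hk1 hk2 => ?_⟩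
  have := h4 k hk1 (by omega)
  omega

theorem rel_top (h : IsWalkPair E D s) {m j : ℤ} (hmj : m ≤ j) (hj : j < 0) (hD : D j = D m)
    (hk : ∀ k, m ≤ k → k ≤ j → D m ≤ D k) : s m j :=
  (h.rel_neg m j hmj hj.le).2 ⟨hD.symm, hk⟩

/-- As `m` is the smallest element of its class, its cyclic predecessor is the largest one, which is
the index just before `D` drops below `D m`. -/
theorem exists_predPerm_neg (h : IsWalkPair E D s) {m : ℤ} (hm : m ≤ 0) (hD : 0 < D m)
    (hmin : ∀ k < m, ¬ s k m) (hpos : ∀ k, 0 ≤ k → ¬ s m k) :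
    ∃ j, m ≤ j ∧ j < 0 ∧ D j = D m ∧ D (j + 1) < D j ∧ (∀ k, m ≤ k → k ≤ j → D m ≤ D k) ∧
      predPerm s m = j := by
  obtain ⟨j, h1, h2, h3, h4, h5⟩ := h.exists_top hm hD
  refine ⟨j, h1, h2, h3, h4, h5, predPerm_eq_of_max (h.classOf_finite m)
    (h.rel_top h1 h2 h3 h5) (fun k hk => ?_) (fun k hk => ?_)⟩
  · by_contra! hc
    exact hmin k hc (Setoid.symm' _ hk)
  · by_contra! hc
    rcases le_or_gt 0 k with hk0 | hk0
    · exact hpos k hk0 hk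
    · have := ((h.rel_neg m k (by omega) hk0.le).1 hk).2 (j + 1) (by omega) (by omega)
      omega

/-- The first index on the ray at a positive level. -/
theorem exists_ray (h : IsWalkPair E D s) {b : ℤ} (hb : 0 < b) :
    ∃ x < 0, D x = b ∧ D (x + 1) < D x ∧ ∀ l ≤ x, D x ≤ D l := by
  obtain ⟨i₀, hi₀, hi⟩ := h.D_lim b
  obtain ⟨x, h1, h2, h3, h4⟩ := exists_last (P := fun i => ∀ l ≤ i, b ≤ D l) hi₀ hi
  have hx0 : x ≠ 0 := by
    rintro rfl
    have := h3 0 le_rfl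
    rw [h.D_zero] at this
    omega
  have h5 := h4 (x + 1) (by omega) (by omega)
  push Not at h5
  obtain ⟨l, hl1, hl2⟩ := h5
  have hl : l = x + 1 := by
    by_contra hc
    exact absurd (h3 l (by omega)) (by omega)
  subst hl
  have h6 := h.D_step x (by omega)
  have h7 := h3 x le_rfl
  refine ⟨x, by omega, by omega, by omega, fun l hl => ?_⟩
  have := h3 l hl
  omega

/-- The cyclic predecessor of a strict descending record is on the ray. -/
theorem predPerm_record (h : IsWalkPair E D s) {N x : ℤ} (hN : 0 < N)
    (hrec : ∀ k, 0 ≤ k → k < N → E N < E k) (hx : x < 0) (hDx : D x = -E N)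
    (hx1 : D (x + 1) < D x) (hray : ∀ l ≤ x, D x ≤ D l) : predPerm s N = x := by
  refine predPerm_eq_of_lt (h.classOf_finite N) (Setoid.symm' _ ((h.rel_ray x N hx.le hN.le).2
    ⟨hray, by omega, fun k hk1 hk2 => ?_⟩)) (by omega) fun k hk1 hk2 hk => ?_
  · rcases eq_or_lt_of_le hk2 with rfl | hk2
    · omega
    · have := hrec k hk1 hk2
      omega
  · rcases le_or_gt 0 k with hk0 | hk0
    · have h1 := ((h.rel_pos k N hk0 hk2.le).1 (Setoid.symm' _ hk)).1
      have := hrec k hk0 hk2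
      omega
    · obtain ⟨h1, h2, -⟩ := (h.rel_ray k N hk0.le hN.le).1 (Setoid.symm' _ hk)
      have := h1 (x + 1) (by omega)
      omega

/-- An edge `i ≥ 0` is in the face of the first step that brings `E` back to `E i` or below. On the
negative side, a down-step is in its own face, a ray edge in the face of the first step of `E` to
`-D i` or below, and any other edge in the face of the nearest index on its left at a level less
than `D i`. -/
theorem exists_face (h : IsWalkPair E D s) (i : ℤ) : ∃ t l, Face E D t l i := by
  rcases le_or_gt 0 i with hi | hi
  · obtain ⟨j, hj1, hj2, hj3⟩ := h.E_lim (E i) (i + 1)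
    obtain ⟨t, h1, h2, h3, h4⟩ := exists_first (P := fun t => E (t + 1) ≤ E i) (a := i) (b := j - 1)
      (by omega) (by rw [sub_add_cancel]; omega)
    refine ⟨t, _, Or.inl ⟨hi, h1, h3, fun k hk1 hk2 => ?_, rfl⟩⟩
    have := h4 (k - 1) (by omega) (by omega)
    rw [sub_add_cancel] at this
    omega
  · have hne := h.D_ne i hi
    rcases lt_or_gt_of_ne hne with hlt | hlt
    · exact ⟨i, 0, Or.inr (Or.inr (Or.inl ⟨hi, rfl, hlt, rfl⟩))⟩
    · by_cases hray : ∀ l ≤ i, D i ≤ D l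
      · have hD := h.D_nonneg (i + 1) (by omega)
        obtain ⟨j, hj1, hj2, hj3⟩ := h.E_lim (-D i) 1
        obtain ⟨t, h1, h2, h3, h4⟩ := exists_first (P := fun t => E (t + 1) ≤ -D i) (a := 0)
          (b := j - 1) (by omega) (by rw [sub_add_cancel]; omega)
        refine ⟨t, _, Or.inr (Or.inl ⟨hi, h1, hlt, hray, h3, fun k hk1 hk2 => ?_, rfl⟩)⟩
        rcases eq_or_lt_of_le hk1 with rfl | hk1
        · rw [h.E_zero]; omega
        · have := h4 (k - 1) (by omega) (by omega)
          rw [sub_add_cancel] at this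
          omega
      · push Not at hray
        obtain ⟨l, hl1, hl2⟩ := hray
        obtain ⟨t, h1, h2, h3, h4⟩ := exists_last (P := fun t => D t < D i) hl1 hl2
        have hti : t ≠ i := by rintro rfl; omega
        refine ⟨t, _, Or.inr (Or.inr (Or.inr ⟨by omega, hi, hlt, h3, fun k hk1 hk2 => ?_, rfl⟩))⟩
        have := h4 k hk1 hk2
        omega

theorem face_bounds {t l i : ℤ} (hF : Face E D t l i) : 0 ≤ l ∧ l ≤ jump E D t := by
  rcases hF with ⟨h1, h2, h3, h4, h5⟩ | ⟨h1, h2, h3, h4, h5, h6, h7⟩ | ⟨h1, h2, h3, h4⟩ |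
    ⟨h1, h2, h3, h4, h5, h6⟩
  · rw [jump, if_pos (by omega)]
    rcases eq_or_lt_of_le h2 with rfl | h2
    · omega
    · have := h4 t h2 le_rfl
      omega
  · rw [jump, if_pos h2]
    have := h6 t h2 le_rfl
    omega
  · rw [jump, if_neg (by omega)]
    omega
  · rw [jump, if_neg (by omega)]
    have := h5 (t + 1) (by omega) (by omega)
    omega

theorem face_unique {t l t' l' i : ℤ} (hF : Face E D t l i) (hF' : Face E D t' l' i) :
    t = t' ∧ l = l' := by
  have key : t = t' := by
    rcases hF with ⟨h1, h2, h3, h4, h5⟩ | ⟨h1, h2, h3, h4, h5, h6, h7⟩ | ⟨h1, h2, h3, h4⟩ |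
      ⟨h1, h2, h3, h4, h5, h6⟩ <;>
    rcases hF' with ⟨g1, g2, g3, g4, g5⟩ | ⟨g1, g2, g3, g4, g5, g6, g7⟩ | ⟨g1, g2, g3, g4⟩ |
      ⟨g1, g2, g3, g4, g5, g6⟩ <;> try omega
    · by_contra hc
      rcases lt_or_gt_of_ne hc with hc | hc
      · have := g4 (t + 1) (by omega) (by omega); omega
      · have := h4 (t' + 1) (by omega) (by omega); omega
    · by_contra hc
      rcases lt_or_gt_of_ne hc with hc | hc
      · have := g6 (t + 1) (by omega) (by omega); omega
      · have := h6 (t' + 1) (by omega) (by omega); omega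
    · subst g2; omega
    · have := h4 t' g1.le; omega
    · subst h2; omega
    · subst h2; omega
    · have := g4 t h1.le; omega
    · subst g2; omega
    · by_contra hc
      rcases lt_or_gt_of_ne hc with hc | hc
      · have := h5 t' (by omega) (by omega); omega
      · have := g5 t (by omega) (by omega); omega
  subst key
  refine ⟨rfl, ?_⟩
  rcases hF with ⟨h1, h2, h3, h4, h5⟩ | ⟨h1, h2, h3, h4, h5, h6, h7⟩ | ⟨h1, h2, h3, h4⟩ |
    ⟨h1, h2, h3, h4, h5, h6⟩ <;>
  rcases hF' with ⟨g1, g2, g3, g4, g5⟩ | ⟨g1, g2, g3, g4, g5, g6, g7⟩ | ⟨g1, g2, g3, g4⟩ |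
    ⟨g1, g2, g3, g4, g5, g6⟩ <;> omega

theorem face_inj {t l i j : ℤ} (hF : Face E D t l i) (hF' : Face E D t l j) : i = j := by
  rcases hF with ⟨h1, h2, h3, h4, h5⟩ | ⟨h1, h2, h3, h4, h5, h6, h7⟩ | ⟨h1, h2, h3, h4⟩ |
    ⟨h1, h2, h3, h4, h5, h6⟩ <;>
  rcases hF' with ⟨g1, g2, g3, g4, g5⟩ | ⟨g1, g2, g3, g4, g5, g6, g7⟩ | ⟨g1, g2, g3, g4⟩ |
    ⟨g1, g2, g3, g4, g5, g6⟩ <;> try omega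
  · by_contra hc
    rcases lt_or_gt_of_ne hc with hc | hc
    · have := h4 j hc g2; omega
    · have := g4 i hc h2; omega
  · have := g6 i h1 h2; omega
  · have := h6 j g1 g2; omega
  · by_contra hc
    rcases lt_or_gt_of_ne hc with hc | hc
    · have := g4 (i + 1) (by omega); omega
    · have := h4 (j + 1) (by omega); omega
  · have := g5 (t + 1) (by omega) (by omega); omega
  · have := h5 (t + 1) (by omega) (by omega); omega
  · by_contra hc
    rcases lt_or_gt_of_ne hc with hc | hc
    · have := g5 (i + 1) (by omega) (by omega); omega
    · have := h5 (j + 1) (by omega) (by omega); omega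

/-- The vertex reached by the down-step is glued to the last earlier index at the same height or, at
a strict record, to the ray. -/
theorem face_rotate_down (h : IsWalkPair E D s) {t : ℤ} (ht : 0 ≤ t) (hd : E (t + 1) < E t) :
    Face E D t 0 (predPerm s (t + 1)) := by
  by_cases hex : ∃ j, 0 ≤ j ∧ j ≤ t ∧ E j ≤ E (t + 1)
  · obtain ⟨j₀, hj0, hj1, hj2⟩ := hex
    obtain ⟨j, h1, h2, h3, h4⟩ := exists_last (P := fun j => E j ≤ E (t + 1)) hj1 hj2
    have hjt : j ≠ t := by rintro rfl; omega
    have h5 := h4 (j + 1) (by omega) (by omega)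
    have h6 := h.E_step j (by omega)
    have hp : predPerm s (t + 1) = j := by
      refine predPerm_eq_of_lt (h.classOf_finite _) (Setoid.symm' _ ((h.rel_pos j (t + 1)
        (by omega) (by omega)).2 ⟨by omega, fun k hk1 hk2 => ?_⟩)) (by omega) fun k hk1 hk2 hk => ?_
      · by_cases hkj : k = j
        · rw [hkj]
        · by_cases hkt : k = t + 1
          · rw [hkt]; omega
          · have := h4 k (by omega) (by omega); omega
      · have h7 := ((h.rel_pos k (t + 1) (by omega) hk2.le).1 (Setoid.symm' _ hk)).1
        have := h4 k hk1 (by omega)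
        omega
    rw [hp]
    refine Or.inl ⟨by omega, h2, by omega, fun k hk1 hk2 => ?_, by omega⟩
    have := h4 k hk1 hk2
    omega
  · push Not at hex
    have h0 := hex 0 le_rfl ht
    rw [h.E_zero] at h0
    obtain ⟨x, hx, hDx, hx1, hray⟩ := h.exists_ray (b := -E (t + 1)) (by omega)
    rw [h.predPerm_record (by omega) (fun k hk1 hk2 => hex k hk1 (by omega)) hx hDx hx1 hray]
    refine Or.inr (Or.inl ⟨hx, ht, hx1, hray, by omega, fun k hk1 hk2 => ?_, by omega⟩)
    have := hex k hk1 hk2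
    omega

/-- Except where the turn closes, `i + 1` is the smallest index of its class, so its cyclic
predecessor is the largest one, which is one position further in the face. For `t ≥ 0` the turn
closes at `i = t`; for `t < 0` it closes at the edge with `D (i + 1) = D t`, which is glued back to
`t`. -/
theorem face_rotate (h : IsWalkPair E D s) {t l i : ℤ} (hF : Face E D t l i) :
    (l < jump E D t → Face E D t (l + 1) (facePerm s i)) ∧
      (l = jump E D t → Face E D t 0 (facePerm s i)) := by
  rw [facePerm_apply]
  rcases hF with ⟨h1, h2, h3, h4, h5⟩ | ⟨h1, h2, h3, h4, h5, h6, h7⟩ | ⟨h1, h2, h3, h4⟩ |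
    ⟨h1, h2, h3, h4, h5, h6⟩
  · rw [jump, if_pos (by omega)]
    rcases eq_or_lt_of_le h2 with rfl | h2
    · refine ⟨fun hl => by omega, fun _ => h.face_rotate_down h1 ?_⟩
      have := h.E_ne i h1
      omega
    · have h6 := h4 t h2 le_rfl
      refine ⟨fun _ => ?_, fun hl => by omega⟩
      have h7 := h4 (i + 1) (by omega) (by omega)
      have h8 := h.E_step i h1
      obtain ⟨j, g1, g2, g3, g4⟩ := exists_last (P := fun j => E j ≤ E i + 1) (a := i + 1) (b := t)
        (by omega) (by omega)
      have g5 := h4 j (by omega) g2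
      have hp : predPerm s (i + 1) = j := by
        refine predPerm_eq_of_max (h.classOf_finite _) ((h.rel_pos (i + 1) j (by omega) g1).2
          ⟨by omega, fun k hk1 hk2 => ?_⟩) (fun k hk => ?_) (fun k hk => ?_)
        · have := h4 k (by omega) (by omega); omega
        · by_contra! hc
          rcases le_or_gt 0 k with hk0 | hk0
          · obtain ⟨e1, e2⟩ := (h.rel_pos k (i + 1) hk0 hc.le).1 (Setoid.symm' _ hk)
            have := e2 i (by omega) (by omega); omega
          · obtain ⟨-, e1, e2⟩ := (h.rel_ray k (i + 1) hk0.le (by omega)).1 (Setoid.symm' _ hk)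
            have := e2 i (by omega) (by omega); omega
        · by_contra! hc
          obtain ⟨e1, e2⟩ := (h.rel_pos (i + 1) k (by omega) (by omega)).1 hk
          rcases le_or_gt k t with hkt | hkt
          · have := g4 k hc hkt; omega
          · have := e2 (t + 1) (by omega) (by omega); omega
      rw [hp]
      refine Or.inl ⟨by omega, g2, by omega, fun k hk1 hk2 => ?_, by omega⟩
      have := g4 k hk1 hk2
      omega
  · rw [jump, if_pos h2]
    have h8 := h6 t h2 le_rfl
    refine ⟨fun _ => ?_, fun hl => by omega⟩
    have h9 := h.D_step i h1
    have hmin : ∀ k < i + 1, ¬ s k (i + 1) := fun k hk hs => by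
      have e1 := ((h.rel_neg k (i + 1) hk.le (by omega)).1 hs).1
      have := h4 k (by omega)
      omega
    have hray : ∀ k ≤ i + 1, D (i + 1) ≤ D k := fun k hk => by
      rcases eq_or_lt_of_le hk with rfl | hk
      · exact le_rfl
      · have := h4 k (by omega); omega
    by_cases hex : ∃ j, 0 ≤ j ∧ j ≤ t ∧ E j ≤ -D (i + 1)
    · obtain ⟨j₀, hj0, hj1, hj2⟩ := hex
      obtain ⟨j, g1, g2, g3, g4⟩ := exists_last (P := fun j => E j ≤ -D (i + 1)) hj1 hj2
      have g5 := h6 j (by omega) g2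
      have hp : predPerm s (i + 1) = j := by
        refine predPerm_eq_of_max (h.classOf_finite _) ((h.rel_ray (i + 1) j (by omega)
          (by omega)).2 ⟨hray, by omega, fun k hk1 hk2 => ?_⟩) (fun k hk => ?_) (fun k hk => ?_)
        · have := h6 k hk1 (by omega); omega
        · by_contra! hc
          exact hmin k hc (Setoid.symm' _ hk)
        · by_contra! hc
          obtain ⟨-, e1, e2⟩ := (h.rel_ray (i + 1) k (by omega) (by omega)).1 hk
          rcases le_or_gt k t with hkt | hkt
          · have := g4 k hc hkt; omega
          · have := e2 (t + 1) (by omega) (by omega); omega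
      rw [hp]
      refine Or.inl ⟨by omega, g2, by omega, fun k hk1 hk2 => ?_, by omega⟩
      have := g4 k hk1 hk2
      omega
    · push Not at hex
      have e0 := hex 0 le_rfl h2
      rw [h.E_zero] at e0
      obtain ⟨j, g1, g2, g3, g4, g5, hp⟩ := h.exists_predPerm_neg (m := i + 1) (by omega) (by omega)
        hmin (fun k hk hs => by
          obtain ⟨-, e1, e2⟩ := (h.rel_ray (i + 1) k (by omega) hk).1 hs
          rcases le_or_gt k t with hkt | hkt
          · have := hex k hk hkt; omega
          · have := e2 (t + 1) (by omega) (by omega); omega)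
      rw [hp]
      refine Or.inr (Or.inl ⟨g2, h2, g4, fun k hk => ?_, by omega, fun k hk1 hk2 => ?_, by omega⟩)
      · rcases le_or_gt k (i + 1) with hk' | hk'
        · have := hray k hk'; omega
        · have := g5 k hk'.le hk; omega
      · have := hex k hk1 hk2; omega
  · subst h2
    rw [jump, if_neg (by omega)]
    refine ⟨fun _ => ?_, fun hl => by omega⟩
    have h0 := h.D_nonneg i h1.le
    obtain ⟨j, g1, g2, g3, g4, g5, hp⟩ := h.exists_predPerm_neg (m := i + 1) (by omega) (by omega)
      (fun k hk hs => by
        obtain ⟨e1, e2⟩ := (h.rel_neg k (i + 1) hk.le (by omega)).1 hs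
        have := e2 i (by omega) (by omega)
        omega)
      (fun k hk hs => by
        have := ((h.rel_ray (i + 1) k (by omega) hk).1 hs).1 i (by omega)
        omega)
    rw [hp]
    refine Or.inr (Or.inr (Or.inr ⟨by omega, g2, g4, by omega, fun k hk1 hk2 => ?_, by omega⟩))
    have := g5 k (by omega) hk2
    omega
  · rw [jump, if_neg (by omega)]
    have h7 := h.D_step i h2
    have h8 := h5 (t + 1) (by omega) (by omega)
    by_cases ht : D t = D (i + 1)
    · refine ⟨fun hl => by omega, fun _ => ?_⟩
      have hp : predPerm s (i + 1) = t := by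
        refine predPerm_eq_of_lt (h.classOf_finite _) (Setoid.symm' _ ((h.rel_neg t (i + 1)
          (by omega) (by omega)).2 ⟨ht, fun k hk1 hk2 => ?_⟩)) (by omega) fun k hk1 hk2 hk => ?_
        · by_cases e1 : k = t
          · rw [e1]
          · by_cases e2 : k = i + 1
            · rw [e2, ht]
            · have := h5 k (by omega) (by omega); omega
        · have e1 := ((h.rel_neg k (i + 1) hk2.le (by omega)).1 (Setoid.symm' _ hk)).1
          have := h5 k hk1 (by omega)
          omega
      rw [hp]
      exact Or.inr (Or.inr (Or.inl ⟨by omega, rfl, by omega, rfl⟩))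
    · refine ⟨fun _ => ?_, fun hl => by omega⟩
      have h0 := h.D_nonneg t (by omega)
      obtain ⟨j, g1, g2, g3, g4, g5, hp⟩ := h.exists_predPerm_neg (m := i + 1) (by omega) (by omega)
        (fun k hk hs => by
          obtain ⟨e1, e2⟩ := (h.rel_neg k (i + 1) hk.le (by omega)).1 hs
          rcases le_or_gt k t with hkt | hkt
          · have := e2 t (by omega) (by omega); omega
          · have := h5 k hkt (by omega); omega)
        (fun k hk hs => by
          have := ((h.rel_ray (i + 1) k (by omega) hk).1 hs).1 t (by omega)
          omega)
      rw [hp]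
      refine Or.inr (Or.inr (Or.inr ⟨by omega, g2, g4, by omega, fun k hk1 hk2 => ?_, by omega⟩))
      rcases le_or_gt k i with hk' | hk'
      · have := h5 k hk1 hk'; omega
      · have := g5 k (by omega) hk2; omega

end IsWalkPair

/-! ### The tree structure on the edges of a walk pair -/

open Classical in
/-- The colour of the lower endpoint of an edge of the looptree coded by a walk pair (`true` for
black). -/
noncomputable def edgeColor (E D : ℤ → ℤ) (i : ℤ) : Bool :=
  -- The edge to the parent of a white vertex is the last index of its class, unless the vertex is
  -- on the left boundary. In that case the parent edge is on the ray, so weak running minima of `E`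
  -- are always black.
  decide ((0 ≤ i ∧ ((∃ j, i < j ∧ Exc E i j) ∨ ∀ k, 0 ≤ k → k ≤ i → E i ≤ E k)) ∨
    (i < 0 ∧ D i < D (i + 1)))

/-- The minimum of a walk up to time `i`. -/
noncomputable def runMin (E : ℤ → ℤ) (i : ℤ) : ℤ := sInf (E '' Set.Icc 0 i)

/-- A potential that decreases towards the root of the tree of components. -/
noncomputable def edgeRank (E D : ℤ → ℤ) (i : ℤ) : ℕ :=
  -- The value `E i - 2 * runMin E i` is the height of `E` above its running minimum plus the depth
  -- of that minimum. At a running minimum it is the level of the corresponding vertex of the ray,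
  -- in agreement with `D`.
  if i ≤ 0 then (D i).toNat else (E i - 2 * runMin E i).toNat

theorem runMin_le (E : ℤ → ℤ) {i k : ℤ} (hk : 0 ≤ k) (hki : k ≤ i) : runMin E i ≤ E k :=
  csInf_le ((Set.finite_Icc 0 i).image E).bddBelow ⟨k, ⟨hk, hki⟩, rfl⟩

theorem exists_eq_runMin (E : ℤ → ℤ) {i : ℤ} (hi : 0 ≤ i) :
    ∃ k, 0 ≤ k ∧ k ≤ i ∧ E k = runMin E i := by
  obtain ⟨k, ⟨h1, h2⟩, h3⟩ := Int.csInf_mem (s := E '' Set.Icc 0 i) ⟨E i, i, ⟨hi, le_rfl⟩, rfl⟩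
    ((Set.finite_Icc 0 i).image E).bddBelow
  exact ⟨k, h1, h2, h3⟩

theorem edgeColor_pos {E D : ℤ → ℤ} {i : ℤ} (hi : 0 ≤ i) : edgeColor E D i = true ↔
    (∃ j, i < j ∧ Exc E i j) ∨ ∀ k, 0 ≤ k → k ≤ i → E i ≤ E k := by
  simp [edgeColor, hi, not_lt.2 hi]

theorem edgeColor_neg {E D : ℤ → ℤ} {i : ℤ} (hi : i < 0) :
    edgeColor E D i = true ↔ D i < D (i + 1) := by
  simp [edgeColor, hi, not_le.2 hi]

namespace IsWalkPair

variable {E D : ℤ → ℤ} {s : Setoid ℤ}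

theorem edgeRank_pos (h : IsWalkPair E D s) {i : ℤ} (hi : 0 ≤ i) :
    edgeRank E D i = (E i - 2 * runMin E i).toNat := by
  rcases eq_or_lt_of_le hi with rfl | hi
  · obtain ⟨k, h1, h2, h3⟩ := exists_eq_runMin E (le_refl 0)
    obtain rfl : k = 0 := by omega
    rw [edgeRank, if_pos le_rfl, ← h3, h.D_zero, h.E_zero]
    simp
  · rw [edgeRank, if_neg (by omega)]

theorem runMin_nonpos (h : IsWalkPair E D s) {i : ℤ} (hi : 0 ≤ i) : runMin E i ≤ 0 := by
  have := runMin_le E le_rfl hi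
  rwa [h.E_zero] at this

/-- By `face_rotate`, `facePerm` acts on the positions `0, …, jump E D t` as the cyclic shift, so
every edge of the face is linked to position `0`. -/
theorem sameCycle_facePerm_iff (h : IsWalkPair E D s) {t l i j : ℤ} (hF : Face E D t l i) :
    (facePerm s).SameCycle i j ↔ ∃ l', Face E D t l' j := by
  have fwd : ∀ a, (∃ l', Face E D t l' a) → ∃ l', Face E D t l' (facePerm s a) := by
    rintro a ⟨l', ha⟩
    rcases eq_or_lt_of_le (face_bounds ha).2 with hl | hl
    · exact ⟨_, (h.face_rotate ha).2 hl⟩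
    · exact ⟨_, (h.face_rotate ha).1 hl⟩
  have bwd : ∀ a, (∃ l', Face E D t l' (facePerm s a)) → ∃ l', Face E D t l' a := by
    rintro a ⟨l', ha⟩
    obtain ⟨t', l'', ha'⟩ := h.exists_face a
    have : ∃ m, Face E D t' m (facePerm s a) := by
      rcases eq_or_lt_of_le (face_bounds ha').2 with hl | hl
      · exact ⟨_, (h.face_rotate ha').2 hl⟩
      · exact ⟨_, (h.face_rotate ha').1 hl⟩
    obtain ⟨m, hm⟩ := this
    obtain ⟨rfl, -⟩ := face_unique ha hm
    exact ⟨_, ha'⟩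
  have up : ∀ n : ℕ, ∀ l₀ a, Face E D t l₀ a → l₀ + n ≤ jump E D t →
      Face E D t (l₀ + n) ((facePerm s ^ n) a) := by
    intro n
    induction n with
    | zero => intro l₀ a ha _; simpa using ha
    | succ n ih =>
      intro l₀ a ha hn
      rw [pow_succ', Equiv.Perm.mul_apply]
      have := (h.face_rotate (ih l₀ a ha (by push_cast at hn; omega))).1
        (by push_cast at hn; omega)
      rwa [show l₀ + ((n + 1 : ℕ) : ℤ) = l₀ + n + 1 by push_cast; ring]
  have zero : ∀ l₀ a, Face E D t l₀ a → ∃ b, Face E D t 0 b ∧ (facePerm s).SameCycle a b := by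
    intro l₀ a ha
    have hb := face_bounds ha
    have h1 := up (jump E D t - l₀).toNat l₀ a ha (by omega)
    refine ⟨_, (h.face_rotate h1).2 (by omega), ?_⟩
    rw [Equiv.Perm.sameCycle_apply_right, Equiv.Perm.sameCycle_pow_right]
  constructor
  · rintro ⟨n, rfl⟩
    induction n using Int.induction_on with
    | zero => exact ⟨l, by simpa using hF⟩
    | succ n ih =>
      rw [add_comm, zpow_add, zpow_one, Equiv.Perm.mul_apply]
      exact fwd _ ih
    | pred n ih =>
      refine bwd _ ?_
      rwa [← Equiv.Perm.mul_apply, ← zpow_one_add, add_sub_cancel]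
  · rintro ⟨l', hj⟩
    obtain ⟨b, hb, hib⟩ := zero l i hF
    obtain ⟨b', hb', hjb⟩ := zero l' j hj
    rw [face_inj hb' hb] at hjb
    exact hib.trans hjb.symm

theorem exists_face_of_le (h : IsWalkPair E D s) {t l i l' : ℤ} (hF : Face E D t l i)
    (h0 : 0 ≤ l') (h1 : l' ≤ jump E D t) : ∃ j, Face E D t l' j := by
  have hb := face_bounds hF
  have key : ∀ n : ℕ, ∀ l₀ a, Face E D t l₀ a → l₀ + n ≤ jump E D t →
      ∃ b, Face E D t (l₀ + n) b := by
    intro n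
    induction n with
    | zero => intro l₀ a ha _; exact ⟨a, by simpa using ha⟩
    | succ n ih =>
      intro l₀ a ha hn
      obtain ⟨b, hb⟩ := ih l₀ a ha (by push_cast at hn; omega)
      rw [show l₀ + ((n + 1 : ℕ) : ℤ) = l₀ + n + 1 by push_cast; ring]
      exact ⟨_, (h.face_rotate hb).1 (by push_cast at hn; omega)⟩
  obtain ⟨a, ha⟩ := key (jump E D t - l).toNat l i hF (by omega)
  have := (h.face_rotate ha).2 (by omega)
  obtain ⟨b, hb⟩ := key l'.toNat 0 _ this (by omega)
  rw [zero_add, Int.toNat_of_nonneg h0] at hb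
  exact ⟨b, hb⟩

theorem ncard_cycleSet_facePerm (h : IsWalkPair E D s) {t l i : ℤ} (hF : Face E D t l i) :
    ((cycleSet (facePerm s) i).ncard : ℤ) = jump E D t + 1 ∧ (cycleSet (facePerm s) i).Finite := by
  have hb := face_bounds hF
  choose! g hg using fun (l' : ℤ) (hl : 0 ≤ l' ∧ l' ≤ jump E D t) =>
    h.exists_face_of_le hF hl.1 hl.2
  have himg : cycleSet (facePerm s) i = g '' Set.Icc 0 (jump E D t) := by
    ext j
    rw [cycleSet, Set.mem_ofPred_eq, h.sameCycle_facePerm_iff hF]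
    constructor
    · rintro ⟨l', hl'⟩
      exact ⟨l', face_bounds hl', face_inj (hg l' (face_bounds hl')) hl'⟩
    · rintro ⟨l', hl', rfl⟩
      exact ⟨l', hg l' hl'⟩
  have hinj : Set.InjOn g (Set.Icc 0 (jump E D t)) := by
    intro a ha b hb hab
    have h1 := hg a ha
    rw [hab] at h1
    exact (face_unique h1 (hg b hb)).2
  rw [himg]
  refine ⟨?_, (Set.finite_Icc _ _).image _⟩
  rw [hinj.ncard_image, ← Finset.coe_Icc, Set.ncard_coe_finset, Int.card_Icc]
  omega

theorem edgeColor_ray (h : IsWalkPair E D s) {i j : ℤ} (hi : i ≤ 0) (hj : 0 ≤ j) (hs : s i j) :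
    edgeColor E D j = true := by
  obtain ⟨-, h1, h2⟩ := (h.rel_ray i j hi hj).1 hs
  exact (edgeColor_pos hj).2 (Or.inr fun k hk1 hk2 => by have := h2 k hk1 hk2; omega)

theorem edgeColor_root (h : IsWalkPair E D s) {d : ℤ} (hd : s 0 d) : edgeColor E D d = true := by
  rcases le_or_gt 0 d with h0 | h0
  · exact h.edgeColor_ray le_rfl h0 hd
  · rw [edgeColor_neg h0]
    obtain ⟨h1, h2⟩ := (h.rel_neg d 0 h0.le le_rfl).1 (Setoid.symm' _ hd)
    have h3 := h2 (d + 1) (by omega) (by omega)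
    have := h.D_ne d h0
    omega

/-- The witness is the edge to the parent: for `d ≤ 0`, the last index before `D` drops below `D d`;
for a weak running minimum of `E`, the ray edge at its level; otherwise the largest element of the
class. -/
theorem exists_white (h : IsWalkPair E D s) {d : ℤ} (hd : ¬ s 0 d) :
    ∃ e, s d e ∧ edgeColor E D e = false ∧ edgeRank E D e ≤ edgeRank E D d := by
  rcases le_or_gt d 0 with h0 | h0
  · have hD : 0 < D d := by
      have h1 := h.D_nonneg d h0
      rcases eq_or_lt_of_le h1 with h2 | h2
      · refine absurd (Setoid.symm' _ ((h.rel_neg d 0 h0 le_rfl).2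
          ⟨by rw [h.D_zero, h2], fun k hk1 hk2 => ?_⟩)) hd
        have := h.D_nonneg k hk2
        omega
      · exact h2
    obtain ⟨j, h1, h2, h3, h4, h5⟩ := h.exists_top h0 hD
    refine ⟨j, h.rel_top h1 h2 h3 h5, ?_, ?_⟩
    · rw [Bool.eq_false_iff, Ne, edgeColor_neg h2]
      omega
    · rw [edgeRank, edgeRank, if_pos h2.le, if_pos h0, h3]
  · by_cases hrec : ∀ k, 0 ≤ k → k ≤ d → E d ≤ E k
    · have hE := hrec 0 le_rfl h0.le
      rw [h.E_zero] at hE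
      have hE' : E d < 0 := by
        rcases eq_or_lt_of_le hE with h2 | h2
        · refine absurd ((h.rel_pos 0 d le_rfl h0.le).2
            ⟨by rw [h.E_zero, h2], fun k hk1 hk2 => ?_⟩) hd
          have := hrec k hk1 hk2
          rw [h.E_zero]
          omega
        · exact h2
      obtain ⟨x, hx, hDx, hx1, hray⟩ := h.exists_ray (b := -E d) (by omega)
      refine ⟨x, Setoid.symm' _ ((h.rel_ray x d hx.le h0.le).2 ⟨hray, by omega,
        fun k hk1 hk2 => ?_⟩), ?_, ?_⟩
      · have := hrec k hk1 hk2
        omega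
      · rw [Bool.eq_false_iff, Ne, edgeColor_neg hx]
        omega
      · rw [h.edgeRank_pos h0.le, edgeRank, if_pos hx.le]
        have := runMin_le E h0.le le_rfl
        omega
    · obtain ⟨T, hT1, hT2, hT3⟩ := h.E_lim (E d) d
      obtain ⟨t, h1, h2, h3, h4⟩ := exists_first (P := fun k => E k < E d) hT1 hT3
      have hdt : d ≠ t := by rintro rfl; omega
      obtain ⟨j, g1, g2, g3, g4⟩ := exists_last (P := fun j => E j ≤ E d) (a := d) (b := t - 1)
        (by omega) le_rfl
      have g5 := h4 j g1 (by omega)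
      refine ⟨j, (h.rel_pos d j h0.le g1).2 ⟨by omega, fun k hk1 hk2 => ?_⟩, ?_, ?_⟩
      · have := h4 k hk1 (by omega)
        omega
      · rw [Bool.eq_false_iff, Ne, edgeColor_pos (by omega)]
        rintro (⟨k, hk1, hk2, hk3⟩ | hk)
        · rcases lt_or_ge k t with hkt | hkt
          · have := g4 k hk1 (by omega)
            omega
          · have := hk3 t (by omega) hkt
            omega
        · refine hrec fun k hk1 hk2 => ?_
          have := hk k hk1 (by omega)
          omega
      · rw [h.edgeRank_pos h0.le, h.edgeRank_pos (by omega)]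
        obtain ⟨k, hk1, hk2, hk3⟩ := exists_eq_runMin E (show 0 ≤ j by omega)
        rcases le_or_gt k d with hkd | hkd
        · have := runMin_le E hk1 hkd
          omega
        · have h6 := runMin_le E h0.le le_rfl
          have := h4 k (by omega) (by omega)
          omega

/-- The smaller index is black, except possibly when it is negative and the larger one is not; then
the larger one is a running minimum, hence black. -/
theorem white_unique (h : IsWalkPair E D s) {d e : ℤ} (hs : s d e) (hde : d < e) :
    edgeColor E D d = true ∨ edgeColor E D e = true := by
  rcases le_or_gt 0 d with h0 | h0
  · exact Or.inl ((edgeColor_pos h0).2 (Or.inl ⟨e, hde, (h.rel_pos d e h0 hde.le).1 hs⟩))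
  · rcases le_or_gt 0 e with h1 | h1
    · exact Or.inr (h.edgeColor_ray h0.le h1 hs)
    · left
      obtain ⟨h2, h3⟩ := (h.rel_neg d e hde.le h1.le).1 hs
      have h4 := h3 (d + 1) (by omega) (by omega)
      have := h.D_ne d h0
      rw [edgeColor_neg h0]
      omega

/-- In a face with `t ≥ 0` only the smallest nonnegative edge can be black: a larger one is above
it, hence is no running minimum, and is not met again because `E` passes below its level at `t + 1`.
In a face with `t < 0` only `t` is black. -/
theorem black_unique {t l l' d e : ℤ} (hd : Face E D t l d) (he : Face E D t l' e)
    (hcd : edgeColor E D d = true) (hce : edgeColor E D e = true) : d = e := by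
  have key : ∀ {l l' d e : ℤ}, Face E D t l d → Face E D t l' e → 0 ≤ d → d < e → e ≤ t →
      edgeColor E D e = true → False := by
    intro l l' d e hd he h0 hlt het hce
    rcases hd with ⟨h1, h2, h3, h4, h5⟩ | ⟨h1, -⟩ | ⟨h1, h2, h3, h4⟩ | ⟨h1, h2, -⟩
    · have hde := h4 e hlt het
      rcases he with ⟨g1, g2, g3, g4, g5⟩ | ⟨g1, -⟩ | ⟨g1, g2, -⟩ | ⟨g1, g2, -⟩
      · rcases (edgeColor_pos g1).1 hce with ⟨k, hk1, hk2, hk3⟩ | hk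
        · rcases le_or_gt k t with hkt | hkt
          · have := g4 k hk1 hkt
            omega
          · have := hk3 (t + 1) (by omega) (by omega)
            omega
        · have := hk d h1 hlt.le
          omega
      all_goals omega
    all_goals omega
  by_contra hne
  have hd' := hd
  have he' := he
  rcases hd with ⟨h1, h2, h3, h4, h5⟩ | ⟨h1, h2, h3, h4, h5, h6, h7⟩ | ⟨h1, h2, h3, h4⟩ |
    ⟨h1, h2, h3, h4, h5, h6⟩
  · rcases he with ⟨g1, g2, g3, g4, g5⟩ | ⟨g1, g2, g3, g4, g5, g6, g7⟩ | ⟨g1, g2, g3, g4⟩ |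
      ⟨g1, g2, g3, g4, g5, g6⟩
    · rcases lt_or_gt_of_ne hne with hlt | hlt
      · exact key hd' he' h1 hlt g2 hce
      · exact key he' hd' g1 hlt h2 hcd
    · rw [edgeColor_neg g1] at hce; omega
    · omega
    · omega
  · rw [edgeColor_neg h1] at hcd; omega
  · rcases he with ⟨g1, g2, g3, g4, g5⟩ | ⟨g1, g2, g3, g4, g5, g6, g7⟩ | ⟨g1, g2, g3, g4⟩ |
      ⟨g1, g2, g3, g4, g5, g6⟩
    · omega
    · omega
    · omega
    · rw [edgeColor_neg g2] at hce; omega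
  · rw [edgeColor_neg h2] at hcd; omega

/-- If `t ≥ 0`, the witness is the last index up to `t` at height `E (t + 1)` or, when `t + 1` is a
strict record, the last minimum of `E` on `[0, t]`. If `t < 0`, it is `t` itself. -/
theorem exists_black (h : IsWalkPair E D s) {t l d : ℤ} (hd : Face E D t l d) :
    ∃ e l', Face E D t l' e ∧ edgeColor E D e = true ∧
      (edgeColor E D d = false → edgeRank E D e < edgeRank E D d) := by
  rcases le_or_gt 0 t with ht | ht
  · -- `t` is a down-step of `E`
    -- After an edge of the face, `E` stays higher until `t`, so the minimum up to any `j ≤ t` is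
    -- already reached at time `d`.
    have hmin : ∀ {j d : ℤ}, 0 ≤ d → 0 ≤ j → j ≤ t → (∀ k, d < k → k ≤ t → E d < E k) →
        runMin E d ≤ runMin E j := by
      intro j d h0 hj hjt hk
      obtain ⟨k, hk1, hk2, hk3⟩ := exists_eq_runMin E hj
      rcases le_or_gt k d with hkd | hkd
      · have := runMin_le E hk1 hkd
        omega
      · have h6 := runMin_le E h0 le_rfl
        have := hk k hkd (by omega)
        omega
    by_cases hex : ∃ j, 0 ≤ j ∧ j ≤ t ∧ E j ≤ E (t + 1)
    · obtain ⟨j₀, hj0, hj1, hj2⟩ := hex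
      obtain ⟨j, h1, h2, h3, h4⟩ := exists_last (P := fun j => E j ≤ E (t + 1)) hj1 hj2
      have h5 : E (t + 1) ≤ E j := by
        rcases eq_or_lt_of_le h2 with rfl | h2
        · have h6 := h.E_ne j ht
          exfalso
          rcases hd with ⟨g1, g2, g3, g4, g5⟩ | ⟨g1, g2, g3, g4, g5, g6, g7⟩ | ⟨g1, g2, g3, g4⟩ |
            ⟨g1, g2, g3, g4, g5, g6⟩
          · rcases eq_or_lt_of_le g2 with rfl | g2
            · omega
            · have := g4 j g2 le_rfl; omega
          · have := g6 j ht le_rfl; omega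
          · omega
          · omega
        · have h5 := h4 (j + 1) (by omega) (by omega)
          have h6 := h.E_step j (by omega)
          omega
      have hblack : ∀ {a : ℤ}, 0 ≤ a → a ≤ t → E a = E (t + 1) →
          (∀ k, a < k → k ≤ t → E a < E k) → edgeColor E D a = true := by
        intro a ha0 hat ha hk
        refine (edgeColor_pos ha0).2 (Or.inl ⟨t + 1, by omega, ha, fun k hk1 hk2 => ?_⟩)
        by_cases hka : k = a
        · rw [hka]
        · by_cases hkt : k = t + 1
          · rw [hkt, ha]
          · exact (hk k (by omega) (by omega)).le
      have hjk : ∀ k, j < k → k ≤ t → E j < E k := fun k hk1 hk2 => by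
        have := h4 k hk1 hk2; omega
      refine ⟨j, _, Or.inl ⟨by omega, h2, h5, hjk, rfl⟩,
        hblack (by omega) h2 (by omega) hjk, fun hc => ?_⟩
      rcases hd with ⟨g1, g2, g3, g4, g5⟩ | ⟨g1, g2, g3, g4, g5, g6, g7⟩ | ⟨g1, g2, g3, g4⟩ |
        ⟨g1, g2, g3, g4, g5, g6⟩
      · rw [h.edgeRank_pos g1, h.edgeRank_pos (by omega)]
        have e1 := hmin g1 (show 0 ≤ j by omega) h2 g4
        have e2 : E d ≠ E (t + 1) := fun e2 => by
          rw [hblack g1 g2 e2 g4] at hc; cases hc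
        have e3 := h.runMin_nonpos g1
        have e4 := runMin_le E g1 le_rfl
        have e5 := runMin_le E (show 0 ≤ j by omega) le_rfl
        omega
      · have := g6 j (by omega) h2; omega
      · omega
      · omega
    · push Not at hex
      obtain ⟨j₀, hj0, hj1, hj2⟩ := exists_eq_runMin E ht
      obtain ⟨j, h1, h2, h3, h4⟩ := exists_last (P := fun j => E j ≤ runMin E t) hj1 hj2.le
      have h5 := runMin_le E (show 0 ≤ j by omega) h2
      have hjk : ∀ k, j < k → k ≤ t → E j < E k := fun k hk1 hk2 => by
        have := h4 k hk1 hk2; omega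
      have hj : runMin E j = runMin E t := by
        have e1 := runMin_le E (show 0 ≤ j by omega) le_rfl
        obtain ⟨k, hk1, hk2, hk3⟩ := exists_eq_runMin E (show 0 ≤ j by omega)
        have e2 := runMin_le E hk1 (show k ≤ t by omega)
        omega
      refine ⟨j, _, Or.inl ⟨by omega, h2, (hex j (by omega) h2).le, hjk, rfl⟩,
        (edgeColor_pos (by omega)).2 (Or.inr fun k hk1 hk2 => ?_), fun hc => ?_⟩
      · have := runMin_le E hk1 (show k ≤ t by omega)
        omega
      · rw [h.edgeRank_pos (show 0 ≤ j by omega)]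
        rcases hd with ⟨g1, g2, g3, g4, g5⟩ | ⟨g1, g2, g3, g4, g5, g6, g7⟩ | ⟨g1, g2, g3, g4⟩ |
          ⟨g1, g2, g3, g4, g5, g6⟩
        · rw [h.edgeRank_pos g1]
          have e1 := hmin g1 (show 0 ≤ j by omega) h2 g4
          have e2 : E d ≠ runMin E t := fun e2 => by
            rw [(edgeColor_pos g1).2 (Or.inr fun k hk1 hk2 => by
              have := runMin_le E hk1 (show k ≤ t by omega); omega)] at hc
            cases hc
          have e3 := h.runMin_nonpos g1
          have e4 := runMin_le E g1 g2
          omega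
        · rw [edgeRank, if_pos g1.le]
          have e1 := g6 j (by omega) h2
          have e2 := h.runMin_nonpos ht
          omega
        · omega
        · omega
  · rcases hd with ⟨g1, g2, g3, g4, g5⟩ | ⟨g1, g2, g3, g4, g5, g6, g7⟩ | ⟨g1, g2, g3, g4⟩ |
      ⟨g1, g2, g3, g4, g5, g6⟩
    · omega
    · omega
    · subst g2
      have hb := (edgeColor_neg (E := E) g1).2 g3
      exact ⟨d, 0, Or.inr (Or.inr (Or.inl ⟨g1, rfl, g3, rfl⟩)), hb, fun hc => by
        rw [hb] at hc; cases hc⟩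
    · have e1 := g5 (t + 1) (by omega) (by omega)
      refine ⟨t, 0, Or.inr (Or.inr (Or.inl ⟨ht, rfl, by omega, rfl⟩)),
        (edgeColor_neg ht).2 (by omega), fun _ => ?_⟩
      rw [edgeRank, edgeRank, if_pos ht.le, if_pos g2.le]
      have := h.D_nonneg t ht.le
      omega

theorem sameCycle_iff (h : IsWalkPair E D s) {i j : ℤ} : (predPerm s).SameCycle i j ↔ s i j :=
  sameCycle_predPerm_iff h.classOf_finite

/-- The looptree coded by a walk pair has a tree of components. -/
theorem isEdgeTree (h : IsWalkPair E D s) :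
    IsEdgeTree (predPerm s) (facePerm s) 0 (edgeColor E D) (edgeRank E D) where
  finite c d := by
    rcases c with _ | _
    · rw [turn, cycleSet_predPerm h.classOf_finite]
      exact h.classOf_finite d
    · rw [turn, cycleSet_inv]
      obtain ⟨t, l, hF⟩ := h.exists_face d
      exact (h.ncard_cycleSet_facePerm hF).2
  root d hd := h.edgeColor_root (h.sameCycle_iff.1 hd)
  exists_white d hd := by
    obtain ⟨e, he⟩ := h.exists_white fun hs => hd (h.sameCycle_iff.2 hs)
    exact ⟨e, h.sameCycle_iff.2 he.1, he.2⟩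
  unique c d e hs hd he := by
    rcases c with _ | _
    · have hs := h.sameCycle_iff.1 hs
      by_contra hne
      rcases lt_or_gt_of_ne hne with hlt | hlt
      · rcases h.white_unique hs hlt with h1 | h1 <;> simp_all
      · rcases h.white_unique (Setoid.symm' _ hs) hlt with h1 | h1 <;> simp_all
    · obtain ⟨t, l, hF⟩ := h.exists_face d
      obtain ⟨l', hF'⟩ := (h.sameCycle_facePerm_iff hF).1 (Equiv.Perm.sameCycle_inv.1 hs)
      exact black_unique hF hF' hd he
  exists_black d := by
    obtain ⟨t, l, hF⟩ := h.exists_face d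
    obtain ⟨e, l', hF', he⟩ := h.exists_black hF
    exact ⟨e, (h.sameCycle_facePerm_iff hF).2 ⟨l', hF'⟩, he⟩

end IsWalkPair

/-! ### Coding pairs as walk pairs -/

/-- A sequence read on the nonnegative integers. -/
def fwd (C : ℕ → ℤ) (i : ℤ) : ℤ := C i.toNat

/-- A sequence read backwards on the nonpositive integers. -/
def back (C' : ℕ → ℤ) (i : ℤ) : ℤ := C' (-i).toNat

theorem fwd_natCast (C : ℕ → ℤ) (n : ℕ) : fwd C n = C n := rfl

theorem back_neg_natCast (C' : ℕ → ℤ) (n : ℕ) : back C' (-(n : ℤ)) = C' n := by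
  rw [back, neg_neg, Int.toNat_natCast]

theorem extend_of_nonpos (C : ℕ → ℤ) {i : ℤ} (hi : i ≤ 0) : extend C i = i := if_neg (by omega)

theorem extend_of_pos (C : ℕ → ℤ) {i : ℤ} (hi : 0 < i) : extend C i = fwd C i := if_pos hi

theorem excursionSetoid_iff {g : ℤ → ℤ} {i j : ℤ} (hij : i ≤ j) :
    excursionSetoid g i j ↔ Exc g i j := by
  change (g i = g j ∧ ∀ k, min i j ≤ k → k ≤ max i j → g i ≤ g k) ↔ _
  rw [min_eq_left hij, max_eq_right hij]
  rfl

theorem excursionSetoid_back {C' : ℕ → ℤ} {i j : ℤ} (hij : i ≤ j) (hj : j ≤ 0) :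
    excursionSetoid C' (-i).toNat (-j).toNat ↔ Exc (back C') i j := by
  change (C' _ = C' _ ∧ ∀ k, min _ _ ≤ k → k ≤ max _ _ → C' _ ≤ C' k) ↔ _
  rw [min_eq_right (by omega), max_eq_left (by omega)]
  refine and_congr_right fun _ => ⟨fun h k hk1 hk2 => h _ (by omega) (by omega),
    fun h k hk1 hk2 => ?_⟩
  have := h (-(k : ℤ)) (by omega) (by omega)
  rwa [back_neg_natCast] at this

theorem onRay_iff {C' : ℕ → ℤ} {i : ℤ} (hi : i ≤ 0) {k : ℕ} :
    OnRay C' k (-i).toNat ↔ back C' i = k ∧ ∀ l ≤ i, back C' i ≤ back C' l := by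
  refine and_congr_right fun hk => ⟨fun h l hl => ?_, fun h l hl => ?_⟩
  · have := h (-l).toNat (by omega)
    exact hk.le.trans this
  · have := h (-(l : ℤ)) (by omega)
    rw [back_neg_natCast] at this
    exact hk.ge.trans this

/-- The index `j` is equivalent to `-k` in the extended chain. On nonpositive indices the extension
is the identity, so the lower bound is automatic there and only `(0, j]` matters. The third conjunct
is vacuous because `back C' i` is nonnegative. -/
theorem gluedSetoid_ray {C C' : ℕ → ℤ} (hC' : ∀ k, 0 ≤ C' k) {i j : ℤ} (hi : i ≤ 0) (hj : 0 < j) :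
    gluedSetoid C C' i j ↔ (∀ l ≤ i, back C' i ≤ back C' l) ∧ fwd C j = -back C' i ∧
      (0 ≤ -back C' i → 0 ≤ back C' i) ∧
      ∀ k, 0 < k → k ≤ j → -back C' i ≤ fwd C k := by
  have e : gluedSetoid C C' i j ↔
      ∃ k : ℕ, OnRay C' k (-i).toNat ∧ excursionSetoid (extend C) (-(k : ℤ)) j := by
    change (_ ∨ _ ∨ _ ∨ _) ↔ _
    constructor
    · rintro (h | h | h | h)
      · omega
      · omega
      · exact h.2.2
      · omega
    · exact fun h => Or.inr (Or.inr (Or.inl ⟨hi, hj, h⟩))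
  rw [e]
  have hb : 0 ≤ back C' i := hC' _
  constructor
  · rintro ⟨k, h1, h2⟩
    obtain ⟨h3, h4⟩ := (onRay_iff hi).1 h1
    obtain ⟨h5, h6⟩ := (excursionSetoid_iff (by omega)).1 h2
    rw [extend_of_nonpos C (by omega), extend_of_pos C hj] at h5
    refine ⟨h4, by omega, by omega, fun l hl1 hl2 => ?_⟩
    have := h6 l (by omega) hl2
    rwa [extend_of_nonpos C (by omega), extend_of_pos C hl1, ← h3] at this
  · rintro ⟨h1, h2, -, h3⟩
    refine ⟨(back C' i).toNat, (onRay_iff hi).2 ⟨by omega, h1⟩,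
      (excursionSetoid_iff (by omega)).2 ⟨?_, fun l hl1 hl2 => ?_⟩⟩
    · rw [extend_of_nonpos C (by omega), extend_of_pos C hj]
      omega
    · rw [extend_of_nonpos C (by omega)]
      rcases le_or_gt l 0 with hl | hl
      · rw [extend_of_nonpos C hl]
        exact hl1
      · rw [extend_of_pos C hl]
        have := h3 l hl hl2
        omega

namespace IsCodingPair

variable {C C' : ℕ → ℤ}

/-- The gluing relation counts `0` among the nonpositive indices only. The content is that at `0`
the descriptions by `C` and by `C'` coincide, since both start at `0` and `0` is on the ray. -/
theorem isWalkPair (h : IsCodingPair C C') :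
    IsWalkPair (fwd C) (back C') (gluedSetoid C C') := by
  have E0 : fwd C 0 = 0 := h.zero
  have D0 : back C' 0 = 0 := h.zero'
  have neg : ∀ i j, i ≤ j → j ≤ 0 → (gluedSetoid C C' i j ↔ Exc (back C') i j) := by
    intro i j hij hj
    rw [← excursionSetoid_back hij hj]
    change (_ ∨ _ ∨ _ ∨ _) ↔ _
    constructor
    · rintro (h | h | h | h)
      · omega
      · exact h.2.2
      · omega
      · omega
    · exact fun h => Or.inr (Or.inl ⟨by omega, hj, h⟩)
  have ray : ∀ i j, i ≤ 0 → 0 ≤ j → (gluedSetoid C C' i j ↔ (∀ l ≤ i, back C' i ≤ back C' l) ∧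
      fwd C j = -back C' i ∧ ∀ k, 0 ≤ k → k ≤ j → -back C' i ≤ fwd C k) := by
    intro i j hi hj
    have hb : 0 ≤ back C' i := h.nonneg' _
    rcases eq_or_lt_of_le hj with rfl | hj
    · rw [neg i 0 hi le_rfl]
      constructor
      · rintro ⟨h1, h2⟩
        refine ⟨fun l _ => ?_, by omega, fun k hk1 hk2 => ?_⟩
        · rw [h1, D0]; exact h.nonneg' _
        · obtain rfl : k = 0 := by omega
          omega
      · rintro ⟨h1, h2, h3⟩
        refine ⟨by omega, fun k _ _ => ?_⟩
        have : 0 ≤ back C' k := h.nonneg' _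
        omega
    · rw [gluedSetoid_ray h.nonneg' hi hj]
      constructor
      · rintro ⟨h1, h2, -, h3⟩
        refine ⟨h1, h2, fun k hk1 hk2 => ?_⟩
        rcases eq_or_lt_of_le hk1 with rfl | hk1
        · omega
        · exact h3 k hk1 hk2
      · rintro ⟨h1, h2, h3⟩
        exact ⟨h1, h2, by omega, fun k hk1 hk2 => h3 k hk1.le hk2⟩
  refine ⟨E0, D0, fun i hi => ?_, fun i hi => ?_, fun i hi => ?_, fun i hi => ?_, fun b i => ?_,
    fun i _ => h.nonneg' _, fun b => ?_, fun i j hi hij => ?_, neg, ray⟩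
  · have := h.step_le i.toNat
    rw [fwd, fwd, show (i + 1).toNat = i.toNat + 1 by omega]
    omega
  · rw [fwd, fwd, show (i + 1).toNat = i.toNat + 1 by omega]
    exact h.step_ne _
  · have := h.step_le' (-(i + 1)).toNat
    rw [back, back, show (-i).toNat = (-(i + 1)).toNat + 1 by omega]
    omega
  · rw [back, back, show (-i).toNat = (-(i + 1)).toNat + 1 by omega]
    exact h.step_ne' _
  · obtain ⟨j, hj, hjb⟩ := Filter.frequently_atTop.1 (h.frequently_lt b) i.toNat
    exact ⟨j, by omega, by omega, hjb⟩
  · obtain ⟨m, hm⟩ := Filter.eventually_atTop.1 (h.tendsto'.eventually_ge_atTop b)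
    exact ⟨-m, by omega, fun i hi => hm _ (by omega)⟩
  · rcases eq_or_lt_of_le hi with rfl | hi
    · rw [ray 0 j le_rfl hij, D0, Exc, E0]
      constructor
      · rintro ⟨-, h2, h3⟩
        exact ⟨by omega, fun k hk1 hk2 => by have := h3 k hk1 hk2; omega⟩
      · rintro ⟨h2, h3⟩
        exact ⟨fun l _ => h.nonneg' _, by omega, fun k hk1 hk2 => by have := h3 k hk1 hk2; omega⟩
    · have e : gluedSetoid C C' i j ↔ excursionSetoid (extend C) i j := by
        change (_ ∨ _ ∨ _ ∨ _) ↔ _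
        constructor
        · rintro (h | h | h | h)
          · exact h.2.2
          · omega
          · omega
          · omega
        · exact fun h => Or.inl ⟨hi, by omega, h⟩
      rw [e, excursionSetoid_iff hij, Exc, Exc, extend_of_pos C hi, extend_of_pos C (by omega)]
      refine and_congr_right fun _ => forall_congr' fun k => forall_congr' fun hk => ?_
      rw [extend_of_pos C (by omega)]

end IsCodingPair

/-! ### Cutting the spine -/

/-- The time `N` is a strict descending record of `E`, and `x` is the first index of the ray at the
same level. -/
structure IsCut (E D : ℤ → ℤ) (N x : ℤ) : Prop where
  pos : 0 < N
  record : ∀ k, 0 ≤ k → k < N → E N < E k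
  neg : x < 0
  level : D x = -E N
  up : D (x + 1) < D x
  ray : ∀ l ≤ x, D x ≤ D l

namespace IsCut

variable {E D : ℤ → ℤ} {s : Setoid ℤ} {N x : ℤ}

theorem predPerm_eq (c : IsCut E D N x) (h : IsWalkPair E D s) : predPerm s N = x :=
  h.predPerm_record c.pos c.record c.neg c.level c.up c.ray

theorem edgeColor_eq (c : IsCut E D N x) : edgeColor E D x = false := by
  have := c.up
  rw [Bool.eq_false_iff, Ne, edgeColor_neg c.neg]
  omega

/-- Since `E N` is a strict record, no index in the window has a level low enough to be joined to
something from `N` on. At and before `x` the values of `D` are at least `-E N`, which is too high to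
be joined to the window. -/
theorem class_mem (c : IsCut E D N x) (h : IsWalkPair E D s) {i j : ℤ} (hxi : x < i) (hiN : i < N)
    (hs : s i j) : x < j ∧ j < N := by
  have hx := c.neg
  have hN := c.pos
  have hlev := c.level
  have hup := c.up
  constructor
  · by_contra! hj
    rcases le_or_gt i 0 with hi | hi
    · obtain ⟨h1, h2⟩ := (h.rel_neg j i (by omega) hi).1 (Setoid.symm' _ hs)
      have := h2 (x + 1) (by omega) (by omega)
      have := c.ray j hj
      omega
    · obtain ⟨-, h1, -⟩ := (h.rel_ray j i (by omega) hi.le).1 (Setoid.symm' _ hs)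
      have := c.ray j hj
      have := c.record i hi.le hiN
      omega
  · by_contra! hj
    rcases lt_or_ge i 0 with hi | hi
    · obtain ⟨h1, h2, h3⟩ := (h.rel_ray i j hi.le (by omega)).1 hs
      have := h3 N hN.le hj
      have := h1 x hxi.le
      have := h1 (x + 1) (by omega)
      have := c.ray x le_rfl
      have := h.D_step x hx
      omega
    · obtain ⟨h1, h2⟩ := (h.rel_pos i j hi (by omega)).1 hs
      have := h2 N hiN.le hj
      have := c.record i hi hiN
      omega

theorem eq_of_rel (c : IsCut E D N x) (h : IsWalkPair E D s) {i : ℤ} (hxi : x ≤ i) (hiN : i < N)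
    (hs : s x i) : i = x := by
  by_contra hne
  have := c.class_mem h (by omega) hiN (Setoid.symm' _ hs)
  omega

/-- Faces do not cross the cut: the edge `N - 1` is followed by `predPerm s N = x`. -/
theorem facePerm_mem (c : IsCut E D N x) (h : IsWalkPair E D s) {i : ℤ} (hxi : x ≤ i)
    (hiN : i < N) : x ≤ facePerm s i ∧ facePerm s i < N := by
  have hx := c.neg
  have hN := c.pos
  rw [facePerm_apply]
  by_cases hi : i + 1 = N
  · rw [hi, c.predPerm_eq h]
    omega
  · have := c.class_mem h (i := i + 1) (by omega) (by omega) (predPerm_mem_classOf (i + 1))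
    omega

end IsCut

namespace IsWalkPair

variable {E D : ℤ → ℤ} {s : Setoid ℤ}

/-- After an up-step the contour of the face goes on at a later index, and after a down-step it
comes back. Down-steps on the nonnegative side are thereby visible on the permutation alone. -/
theorem facePerm_le_iff (h : IsWalkPair E D s) {i : ℤ} (hi : 0 ≤ i) :
    facePerm s i ≤ i ↔ E (i + 1) < E i := by
  constructor
  · intro hle
    by_contra! hup
    have hne := h.E_ne i hi
    have hst := h.E_step i hi
    obtain ⟨t, l, hF⟩ := h.exists_face i
    have hrot := h.face_rotate hF
    rcases hF with ⟨h1, h2, h3, h4, h5⟩ | ⟨h1, -⟩ | ⟨h1, h2, -⟩ | ⟨h1, h2, -⟩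
    · have hit : i ≠ t := by rintro rfl; omega
      have := h4 t (by omega) le_rfl
      have hj : jump E D t = E t - E (t + 1) := by rw [jump, if_pos (by omega)]
      rcases hrot.1 (by omega) with ⟨g1, g2, g3, g4, g5⟩ | ⟨g1, g2, g3, g4, g5, g6, g7⟩ |
        ⟨g1, -⟩ | ⟨g1, g2, g3, g4, g5, g6⟩
      · have hne : facePerm s i ≠ i := by intro he; rw [he] at g5; omega
        have := g4 i (by omega) h2
        omega
      · have := g6 i hi h2
        omega
      · omega
      · omega
    · omega
    · omega
    · omega
  · intro hd
    rcases h.face_rotate_down hi hd with ⟨g1, g2, g3, g4, g5⟩ | ⟨g1, -⟩ | ⟨g1, g2, -⟩ |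
      ⟨g1, g2, -⟩ <;> rw [facePerm_apply] <;> omega

theorem face_down {i : ℤ} (hi : 0 ≤ i) (hd : E (i + 1) < E i) :
    Face E D i (jump E D i) i := by
  refine Or.inl ⟨hi, le_rfl, hd.le, fun k hk1 hk2 => by omega, ?_⟩
  rw [jump, if_pos hi]

theorem face_down_neg {i : ℤ} (hi : i < 0) (hd : D i < D (i + 1)) : Face E D i 0 i :=
  Or.inr (Or.inr (Or.inl ⟨hi, rfl, hd, rfl⟩))

/-- The step of the walks along the edge `i`, towards infinity. -/
def step (E D : ℤ → ℤ) (i : ℤ) : ℤ := if 0 ≤ i then E (i + 1) - E i else D i - D (i + 1)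

open Classical in
/-- The down-steps are recognized in terms of the permutations and the colours. -/
theorem step_eq (h : IsWalkPair E D s) (i : ℤ) :
    step E D i = if (0 ≤ i ∧ facePerm s i ≤ i) ∨ (i < 0 ∧ edgeColor E D i = true) then
      1 - ((cycleSet (facePerm s) i).ncard : ℤ) else 1 := by
  rcases le_or_gt 0 i with hi | hi
  · have h1 := h.E_step i hi
    have h2 := h.E_ne i hi
    have h3 := h.facePerm_le_iff hi
    rw [step, if_pos hi]
    split_ifs with hc
    · have := (h.ncard_cycleSet_facePerm (face_down hi (by omega))).1
      rw [jump, if_pos hi] at this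
      omega
    · omega
  · have h1 := h.D_step i hi
    have h2 := h.D_ne i hi
    have h3 := edgeColor_neg (E := E) (D := D) hi
    rw [step, if_neg (by omega)]
    split_ifs with hc
    · have hd := h3.1 (hc.resolve_left fun hc => absurd hc.1 (by omega)).2
      have := (h.ncard_cycleSet_facePerm (face_down_neg hi hd)).1
      rw [jump, if_neg (by omega)] at this
      omega
    · have hd : ¬ D i < D (i + 1) := fun hd => hc (Or.inr ⟨hi, h3.2 hd⟩)
      omega

/-- Each internal face contains a unique down-step. -/
theorem exists_unique_down (h : IsWalkPair E D s) (i : ℤ) :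
    ∃! t, (facePerm s).SameCycle i t ∧ step E D t < 0 := by
  have hdown : ∀ t, step E D t < 0 ↔ ∃ l, Face E D t l t := by
    intro t
    rcases le_or_gt 0 t with ht | ht
    · rw [step, if_pos ht]
      refine ⟨fun hd => ⟨_, face_down ht (by omega)⟩, ?_⟩
      have := h.E_ne t ht
      rintro ⟨l, ⟨h1, h2, h3, h4, h5⟩ | ⟨h1, -⟩ | ⟨h1, h2, -⟩ | ⟨h1, h2, -⟩⟩ <;> omega
    · rw [step, if_neg (by omega)]
      refine ⟨fun hd => ⟨_, face_down_neg ht (by omega)⟩, ?_⟩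
      rintro ⟨l, ⟨h1, -⟩ | ⟨h1, h2, -⟩ | ⟨h1, h2, h3, h4⟩ | ⟨h1, h2, -⟩⟩ <;> omega
  obtain ⟨t, l, hF⟩ := h.exists_face i
  have ht : step E D t < 0 := by
    rcases hF with ⟨h1, h2, h3, h4, h5⟩ | ⟨h1, h2, h3, h4, h5, h6, h7⟩ | ⟨h1, h2, h3, h4⟩ |
      ⟨h1, h2, h3, h4, h5, h6⟩
    · rw [step, if_pos (by omega)]
      have := h.E_ne t (by omega)
      rcases eq_or_lt_of_le h2 with rfl | h2
      · omega
      · have := h4 t h2 le_rfl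
        omega
    · rw [step, if_pos h2]
      have := h6 t h2 le_rfl
      omega
    · rw [step, if_neg (by omega)]
      omega
    · rw [step, if_neg (by omega)]
      have := h5 (t + 1) (by omega) (by omega)
      omega
  refine ⟨t, ⟨(h.sameCycle_facePerm_iff hF).2 ((hdown t).1 ht), ht⟩, ?_⟩
  · rintro t' ⟨ht1, ht2⟩
    obtain ⟨l', hF'⟩ := (h.sameCycle_facePerm_iff hF).1 ht1
    obtain ⟨l'', hF''⟩ := (hdown t').1 ht2
    exact (face_unique hF'' hF').1

end IsWalkPair

/-! ### Finite pieces of trees coded by permutations -/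

section EdgeCut

variable {α : Type*} (p f : Equiv.Perm α) (o : α) (col : α → Bool)

/-- The edges in the finite set `S` are those out of the subtree above the edge `x`. -/
structure IsEdgeCut (S : Finset α) (x : α) : Prop where
  mem : x ∈ S
  root_mem : o ∈ S
  white : col x = false
  face_mem : ∀ i ∈ S, f i ∈ S
  class_mem : ∀ i ∈ S, i ≠ x → ∀ j, p.SameCycle i j → j ∈ S
  eq_of_class : ∀ i ∈ S, p.SameCycle x i → i = x

variable {p f o col} {r : α → ℕ} {S : Finset α} {x : α}

namespace IsEdgeCut

/-- An injection of the finite set `S` into itself is onto, so `S` is also stable under `f⁻¹`. -/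
theorem sameCycle_mem (c : IsEdgeCut p f o col S x) {i j : α} (hi : i ∈ S)
    (h : f.SameCycle i j) : j ∈ S := by
  have inv : ∀ i ∈ S, f⁻¹ i ∈ S := by
    intro i hi
    obtain ⟨j, hj, rfl⟩ := Finset.surj_on_of_inj_on_of_card_le (s := S) (t := S) (fun a _ => f a)
      (fun a ha => c.face_mem a ha) (fun a b _ _ hab => f.injective hab) le_rfl i hi
    simpa using hj
  obtain ⟨n, rfl⟩ := h
  induction n using Int.induction_on with
  | zero => simpa using hi
  | succ n ih =>
    rw [add_comm, zpow_add, zpow_one, Equiv.Perm.mul_apply]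
    exact c.face_mem _ ih
  | pred n ih =>
    rw [sub_eq_neg_add, zpow_add, zpow_neg_one, Equiv.Perm.mul_apply]
    exact inv _ ih

variable {v : List ℕ}

theorem ne_nil (hv : edgeAt p f o v = (x, false)) (h : IsEdgeTree p f o col r)
    (c : IsEdgeCut p f o col S x) : v ≠ [] := by
  rintro rfl
  rw [IsEdgeTree.edgeAt_nil] at hv
  have h1 : x = p⁻¹ o := (congrArg Prod.fst hv).symm
  have h2 := h.root x ⟨-1, by rw [h1]; simp⟩
  rw [c.white] at h2
  cases h2

/-- When one explores from the root, `S` can be left only through the class of `x`, that is, through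
the children of `v`, which are excluded. -/
theorem edgeAt_mem (h : IsEdgeTree p f o col r) (c : IsEdgeCut p f o col S x)
    (hv : v ∈ edgeVerts p f o) (hvx : edgeAt p f o v = (x, false)) {w : List ℕ}
    (hw : w ∈ PlaneTree.offVerts' (edgeCount p f o) v) (hw0 : w ≠ []) :
    (edgeAt p f o w).1 ∈ S := by
  have hv0 := c.ne_nil hvx h
  induction w using List.reverseRecOn with
  | nil => exact absurd rfl hw0
  | append_singleton u j ih =>
    have hu := (PlaneTree.concat_mem_offVerts'.1 hw).1
    have hs := IsEdgeTree.sameCycle_concat (p := p) (f := f) (o := o) u j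
    by_cases hu0 : u = []
    · subst hu0
      refine c.class_mem o c.root_mem ?_ _ (by simpa [IsEdgeTree.edgeAt_nil, turn] using hs)
      intro he
      have := h.root o Equiv.Perm.SameCycle.rfl
      rw [he, c.white] at this
      cases this
    · have hS := ih (PlaneTree.offVerts_subset _ _ hu) hu0
      rcases hc : (edgeAt p f o u).2 with _ | _
      · rw [hc] at hs
        refine c.class_mem _ hS (fun he => hu.2 ?_) _ hs
        rw [h.edgeAt_injOn hu.1 hv hu0 hv0 (by rw [he, hvx])]
      · rw [hc] at hs
        exact c.sameCycle_mem hS (Equiv.Perm.sameCycle_inv.1 hs)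

/-- Conversely, the parent of a vertex whose edge is in `S` is the root or has its own edge in `S`,
and it is not `v` because `x` is the only edge of `S` at `v`. -/
theorem mem_offVerts' (h : IsEdgeTree p f o col r) (c : IsEdgeCut p f o col S x)
    (hvx : edgeAt p f o v = (x, false)) {w : List ℕ}
    (hw : w ∈ edgeVerts p f o) (hw0 : w ≠ []) (hS : (edgeAt p f o w).1 ∈ S) :
    w ∈ PlaneTree.offVerts' (edgeCount p f o) v := by
  have hv0 := c.ne_nil hvx h
  induction w using List.reverseRecOn with
  | nil => exact absurd rfl hw0
  | append_singleton u j ih =>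
    obtain ⟨hu, hj⟩ := IsEdgeTree.concat_mem.1 hw
    have hs := IsEdgeTree.sameCycle_concat (p := p) (f := f) (o := o) u j
    have hcw := h.col_edgeAt hw hw0
    refine PlaneTree.concat_mem_offVerts'.2 ⟨?_, hj⟩
    by_cases hu0 : u = []
    · subst hu0
      exact ⟨hu, fun hc => hv0 (List.prefix_nil.1 hc)⟩
    · have key : (edgeAt p f o u).1 ∈ S ∧ u ≠ v := by
        rcases hc : (edgeAt p f o u).2 with _ | _
        · rw [hc] at hs
          rw [edgeAt_concat] at hcw
          simp only [edgeStep, hc, Bool.not_false] at hcw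
          rw [edgeAt_concat] at hS hs
          simp only [edgeStep, hc] at hS hs
          have hne : (turn p f false ^ (j + 1)) (edgeAt p f o u).1 ≠ x := by
            intro he
            rw [he, c.white] at hcw
            cases hcw
          refine ⟨c.class_mem _ hS hne _ hs.symm, ?_⟩
          rintro rfl
          rw [hvx] at hS hs hne
          exact hne (c.eq_of_class _ hS hs)
        · rw [hc] at hs
          refine ⟨c.sameCycle_mem hS (Equiv.Perm.sameCycle_inv.1 hs).symm, ?_⟩
          rintro rfl
          rw [hvx] at hc
          cases hc
      have hu' := ih hu hu0 key.1
      exact ⟨hu, fun hc => key.2 (hu'.2 hc)⟩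

theorem injOn (h : IsEdgeTree p f o col r) :
    Set.InjOn (fun w => (edgeAt p f o w).1) {w | w ∈ edgeVerts p f o ∧ w ≠ []} :=
  fun _ hw _ hw' he => h.edgeAt_injOn hw.1 hw'.1 hw.2 hw'.2 he

theorem finite_offVerts' (h : IsEdgeTree p f o col r) (c : IsEdgeCut p f o col S x)
    (hv : v ∈ edgeVerts p f o) (hvx : edgeAt p f o v = (x, false)) :
    (PlaneTree.offVerts' (edgeCount p f o) v).Finite := by
  have h1 : (PlaneTree.offVerts' (edgeCount p f o) v \ {[]}).Finite := by
    refine Set.Finite.of_finite_image (f := fun w => (edgeAt p f o w).1)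
      (S.finite_toSet.subset ?_) ((injOn h).mono fun w hw => show w ∈ _ ∧ w ≠ _ from ⟨hw.1.1, hw.2⟩)
    rintro _ ⟨w, hw, rfl⟩
    exact c.edgeAt_mem h hv hvx hw.1 hw.2
  exact (h1.union (Set.finite_singleton [])).subset (by
    rw [Set.sdiff_union_self]; exact Set.subset_union_left)

theorem finite_offVerts (h : IsEdgeTree p f o col r) (c : IsEdgeCut p f o col S x)
    (hv : v ∈ edgeVerts p f o) (hvx : edgeAt p f o v = (x, false)) :
    (PlaneTree.offVerts (edgeCount p f o) v).Finite :=
  (c.finite_offVerts' h hv hvx).subset (PlaneTree.offVerts_subset _ _)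

theorem edgeCount_black {w : List ℕ} (hc : (edgeAt p f o w).2 = true) :
    edgeCount p f o w = (cycleSet f (edgeAt p f o w).1).ncard - 1 := by
  have : w ≠ [] := by
    rintro rfl
    simp [IsEdgeTree.edgeAt_nil] at hc
  rw [edgeCount, if_neg this, hc, turn, cycleSet_inv]

/-- The weight of a finite piece of the tree, in terms of the edges. -/
theorem prod_weights (h : IsEdgeTree p f o col r) (c : IsEdgeCut p f o col S x)
    (hv : v ∈ edgeVerts p f o) (hvx : edgeAt p f o v = (x, false)) (down : α → Prop)
    [DecidablePred down] (hdown : ∀ i, ∃! t, f.SameCycle i t ∧ down t)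
    {F : Finset (List ℕ)} (hF : (F : Set (List ℕ)) = PlaneTree.offVerts (edgeCount p f o) v)
    (a q : ℝ≥0∞) (g : ℕ → ℝ≥0∞) :
    ∏ w ∈ F, (if Even w.length then a * q ^ edgeCount p f o w else g (edgeCount p f o w))
      = ∏ i ∈ S, if down i then q * g ((cycleSet f i).ncard - 1) else a := by
  classical
  have hv0 := c.ne_nil hvx h
  set k := edgeCount p f o with hk
  have hmem : ∀ w, w ∈ F ↔ w ∈ PlaneTree.offVerts k v := fun w => by rw [← hF]; rfl
  have hvF : v ∉ F := fun hvF => ((hmem v).1 hvF).2 List.prefix_rfl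
  have hcol : ∀ w ∈ edgeVerts p f o, w ≠ [] → col (edgeAt p f o w).1 = !decide (Even w.length) :=
    fun w hw hw0 => by rw [h.col_edgeAt hw hw0, edgeAt_snd]
  have hoff' : ∀ w, w ∈ PlaneTree.offVerts' k v ↔ w ∈ insert v F := by
    intro w
    rw [Finset.mem_insert, hmem]
    constructor
    · intro hw
      by_cases hvw : v <+: w
      · exact Or.inl (hw.2 hvw)
      · exact Or.inr ⟨hw.1, hvw⟩
    · rintro (rfl | hw)
      · exact ⟨hv, fun _ => rfl⟩
      · exact PlaneTree.offVerts_subset _ _ hw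
  have hveven : Even v.length := by
    have := edgeAt_snd p f o v
    rw [hvx] at this
    simpa using this.symm
  have heS : ∀ w ∈ insert v F, w ≠ [] → (edgeAt p f o w).1 ∈ S := fun w hw hw0 =>
    c.edgeAt_mem h hv hvx ((hoff' w).2 hw) hw0
  have hvert : ∀ w ∈ insert v F, w ∈ edgeVerts p f o := fun w hw => ((hoff' w).2 hw).1
  have hsurj : ∀ i ∈ S, ∃ w ∈ insert v F, w ≠ [] ∧ edgeAt p f o w = (i, col i) := by
    intro i hi
    obtain ⟨w, hw, hw0, hwi⟩ := h.exists_word i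
    exact ⟨w, (hoff' w).1 (c.mem_offVerts' h hvx hw hw0 (by rw [hwi]; exact hi)), hw0, hwi⟩
  have odd_ne : ∀ {w : List ℕ}, ¬ Even w.length → w ≠ [] := by
    rintro w hw rfl
    exact hw (by simp)
  -- the black vertices and the black edges
  have hB : ∏ w ∈ F.filter (fun w => ¬ Even w.length), g (k w)
      = ∏ i ∈ S.filter (fun i => col i = true), g ((cycleSet f i).ncard - 1) := by
    refine Finset.prod_nbij (fun w => (edgeAt p f o w).1) ?_ ?_ ?_ ?_
    · intro w hw
      obtain ⟨hw1, hw2⟩ := Finset.mem_filter.1 hw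
      have hw1' := Finset.mem_insert_of_mem (b := v) hw1
      refine Finset.mem_filter.2 ⟨heS w hw1' (odd_ne hw2), ?_⟩
      rw [hcol w (hvert w hw1') (odd_ne hw2)]
      simpa using hw2
    · intro w hw w' hw' he
      obtain ⟨hw1, hw2⟩ := Finset.mem_filter.1 (Finset.mem_coe.1 hw)
      obtain ⟨hw1', hw2'⟩ := Finset.mem_filter.1 (Finset.mem_coe.1 hw')
      exact h.edgeAt_injOn (hvert w (Finset.mem_insert_of_mem hw1))
        (hvert w' (Finset.mem_insert_of_mem hw1')) (odd_ne hw2) (odd_ne hw2') he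
    · intro i hi
      obtain ⟨hi1, hi2⟩ := Finset.mem_filter.1 (Finset.mem_coe.1 hi)
      obtain ⟨w, hw, hw0, hwi⟩ := hsurj i hi1
      have hodd : ¬ Even w.length := by
        have := hcol w (hvert w hw) hw0
        rw [hwi, hi2] at this
        simpa using this.symm
      refine ⟨w, Finset.mem_coe.2 (Finset.mem_filter.2 ⟨?_, hodd⟩), by simp only [hwi]⟩
      rcases Finset.mem_insert.1 hw with rfl | hw
      · exact absurd hveven hodd
      · exact hw
    · intro w hw
      obtain ⟨hw1, hw2⟩ := Finset.mem_filter.1 hw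
      rw [hk, edgeCount_black (by rw [edgeAt_snd]; simpa using hw2)]
  -- Each face has one black edge and one down-step, both in `S` or both outside, so the two
  -- families correspond.
  choose d hd hdu using hdown
  have hbd : ∀ {g : ℕ → ℝ≥0∞},
      ∏ i ∈ S.filter (fun i => col i = true), g ((cycleSet f i).ncard - 1)
      = ∏ i ∈ S.filter (fun i => down i), g ((cycleSet f i).ncard - 1) := by
    intro g
    refine Finset.prod_nbij d ?_ ?_ ?_ ?_
    · intro i hi
      obtain ⟨hi1, hi2⟩ := Finset.mem_filter.1 hi
      exact Finset.mem_filter.2 ⟨c.sameCycle_mem hi1 (hd i).1, (hd i).2⟩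
    · intro i hi j hj hij
      obtain ⟨hi1, hi2⟩ := Finset.mem_filter.1 (Finset.mem_coe.1 hi)
      obtain ⟨hj1, hj2⟩ := Finset.mem_filter.1 (Finset.mem_coe.1 hj)
      have h1 := (hd i).1
      have h2 := (hd j).1
      rw [← hij] at h2
      exact h.unique true i j (Equiv.Perm.sameCycle_inv.2 (h1.trans h2.symm)) hi2 hj2
    · intro t ht
      obtain ⟨ht1, ht2⟩ := Finset.mem_filter.1 (Finset.mem_coe.1 ht)
      obtain ⟨b, hb1, hb2, -⟩ := h.exists_black t
      exact ⟨b, Finset.mem_coe.2 (Finset.mem_filter.2 ⟨c.sameCycle_mem ht1 hb1, hb2⟩),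
        (hdu b t ⟨hb1.symm, ht2⟩).symm⟩
    · intro i hi
      rw [cycleSet_eq (hd i).1]
  have hcardBD : (S.filter (fun i => col i = true)).card = (S.filter (fun i => down i)).card := by
    -- For a constant weight the identity of products becomes an identity of cardinalities.
    have := hbd (g := fun _ => 2)
    rw [Finset.prod_const, Finset.prod_const] at this
    have h2 : ((2 ^ (S.filter (fun i => col i = true)).card : ℕ) : ℝ≥0∞)
        = ((2 ^ (S.filter (fun i => down i)).card : ℕ) : ℝ≥0∞) := by push_cast; exact this
    exact Nat.pow_right_injective le_rfl (by exact_mod_cast h2)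
  -- the number of black vertices
  have hcardFB : (F.filter (fun w => ¬ Even w.length)).card
      = (S.filter (fun i => col i = true)).card := by
    refine Finset.card_nbij (fun w => (edgeAt p f o w).1) ?_ ?_ ?_
    · intro w hw
      obtain ⟨hw1, hw2⟩ := Finset.mem_filter.1 hw
      have hw1' := Finset.mem_insert_of_mem (b := v) hw1
      refine Finset.mem_filter.2 ⟨heS w hw1' (odd_ne hw2), ?_⟩
      rw [hcol w (hvert w hw1') (odd_ne hw2)]
      simpa using hw2
    · intro w hw w' hw' he
      obtain ⟨hw1, hw2⟩ := Finset.mem_filter.1 (Finset.mem_coe.1 hw)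
      obtain ⟨hw1', hw2'⟩ := Finset.mem_filter.1 (Finset.mem_coe.1 hw')
      exact h.edgeAt_injOn (hvert w (Finset.mem_insert_of_mem hw1))
        (hvert w' (Finset.mem_insert_of_mem hw1')) (odd_ne hw2) (odd_ne hw2') he
    · intro i hi
      obtain ⟨hi1, hi2⟩ := Finset.mem_filter.1 (Finset.mem_coe.1 hi)
      obtain ⟨w, hw, hw0, hwi⟩ := hsurj i hi1
      have hodd : ¬ Even w.length := by
        have := hcol w (hvert w hw) hw0
        rw [hwi, hi2] at this
        simpa using this.symm
      refine ⟨w, Finset.mem_coe.2 (Finset.mem_filter.2 ⟨?_, hodd⟩), by simp only [hwi]⟩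
      rcases Finset.mem_insert.1 hw with rfl | hw
      · exact absurd hveven hodd
      · exact hw
  -- the white vertices
  have hnilF : [] ∈ F := (hmem []).2 ⟨PlaneTree.nil_mem _, fun hc => hv0 (List.prefix_nil.1 hc)⟩
  -- The edges in `S` are the parent edges of the vertices of `F`, with `v` added and the root,
  -- which has no parent, removed.
  have hcardF : F.card = S.card := by
    have h1 : ((insert v F).erase []).card = S.card := by
      refine Finset.card_nbij (fun w => (edgeAt p f o w).1) ?_ ?_ ?_
      · intro w hw
        obtain ⟨hw0, hw1⟩ := Finset.mem_erase.1 hw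
        exact heS w hw1 hw0
      · intro w hw w' hw' he
        obtain ⟨hw0, hw1⟩ := Finset.mem_erase.1 (Finset.mem_coe.1 hw)
        obtain ⟨hw0', hw1'⟩ := Finset.mem_erase.1 (Finset.mem_coe.1 hw')
        exact h.edgeAt_injOn (hvert w hw1) (hvert w' hw1') hw0 hw0' he
      · intro i hi
        obtain ⟨w, hw, hw0, hwi⟩ := hsurj i (Finset.mem_coe.1 hi)
        exact ⟨w, Finset.mem_coe.2 (Finset.mem_erase.2 ⟨hw0, hw⟩), by simp only [hwi]⟩
    rw [Finset.card_erase_of_mem (Finset.mem_insert_of_mem hnilF),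
      Finset.card_insert_of_notMem hvF] at h1
    omega
  have hcardW : (F.filter (fun w => Even w.length)).card
      = (S.filter (fun i => ¬ down i)).card := by
    have h1 := Finset.card_filter_add_card_filter_not (s := F) (fun w => Even w.length)
    have h2 := Finset.card_filter_add_card_filter_not (s := S) (fun i => down i)
    omega
  -- The children of a white vertex of `F` are all in `F`, since only `v` could be missing and `v`
  -- is white; and every black vertex of `F` is such a child.
  have hsum : ∑ w ∈ F.filter (fun w => Even w.length), k w
      = (F.filter (fun w => ¬ Even w.length)).card := by
    have hmaps : ∀ w ∈ F.filter (fun w => ¬ Even w.length),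
        w.dropLast ∈ F.filter (fun w => Even w.length) := by
      intro w hw
      obtain ⟨hw1, hw2⟩ := Finset.mem_filter.1 hw
      rcases List.eq_nil_or_concat' w with rfl | ⟨u, j, rfl⟩
      · exact absurd rfl (odd_ne hw2)
      · have h1 := PlaneTree.concat_mem_offVerts'.1 ((hoff' _).2 (Finset.mem_insert_of_mem hw1))
        rw [List.dropLast_concat]
        refine Finset.mem_filter.2 ⟨(hmem u).2 h1.1, ?_⟩
        rw [List.length_append, List.length_singleton, Nat.even_add_one, not_not] at hw2
        exact hw2
    rw [Finset.card_eq_sum_card_fiberwise hmaps]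
    refine Finset.sum_congr rfl fun w hw => ?_
    obtain ⟨hw1, hw2⟩ := Finset.mem_filter.1 hw
    have : (F.filter (fun w => ¬ Even w.length)).filter (fun u => u.dropLast = w)
        = (Finset.range (k w)).image fun j => w ++ [j] := by
      ext u
      simp only [Finset.mem_filter, Finset.mem_image, Finset.mem_range]
      constructor
      · rintro ⟨⟨hu1, hu2⟩, rfl⟩
        rcases List.eq_nil_or_concat' u with rfl | ⟨u, j, rfl⟩
        · exact absurd rfl (odd_ne hu2)
        · rw [List.dropLast_concat] at *
          exact ⟨j, (PlaneTree.concat_mem_offVerts'.1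
            ((hoff' _).2 (Finset.mem_insert_of_mem hu1))).2, rfl⟩
      · rintro ⟨j, hj, rfl⟩
        have hodd : ¬ Even (w ++ [j]).length := by
          rw [List.length_append, List.length_singleton, Nat.even_add_one, not_not]
          exact hw2
        refine ⟨⟨?_, hodd⟩, List.dropLast_concat⟩
        have := (hoff' _).1 (PlaneTree.concat_mem_offVerts'.2 ⟨(hmem w).1 hw1, hj⟩)
        rcases Finset.mem_insert.1 this with he | hm
        · rw [he] at hodd
          exact absurd hveven hodd
        · exact hm
    rw [this, Finset.card_image_of_injective _ fun a b hab => by simpa using hab, Finset.card_range]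
  rw [← Finset.prod_filter_mul_prod_filter_not F (fun w => Even w.length),
    ← Finset.prod_filter_mul_prod_filter_not S (fun i => down i)]
  have e1 : ∏ w ∈ F.filter (fun w => Even w.length),
      (if Even w.length then a * q ^ k w else g (k w))
      = a ^ (S.filter (fun i => ¬ down i)).card * q ^ (S.filter (fun i => down i)).card := by
    rw [Finset.prod_congr rfl fun w hw => if_pos (Finset.mem_filter.1 hw).2,
      Finset.prod_mul_distrib, Finset.prod_const, Finset.prod_pow_eq_pow_sum, hsum, hcardW,
      hcardFB, hcardBD]
  have e2 : ∏ w ∈ F.filter (fun w => ¬ Even w.length),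
      (if Even w.length then a * q ^ k w else g (k w))
      = ∏ i ∈ S.filter (fun i => down i), g ((cycleSet f i).ncard - 1) := by
    rw [Finset.prod_congr rfl fun w hw => if_neg (Finset.mem_filter.1 hw).2, hB, hbd]
  have e3 : ∏ i ∈ S.filter (fun i => down i),
      (if down i then q * g ((cycleSet f i).ncard - 1) else a)
      = q ^ (S.filter (fun i => down i)).card *
        ∏ i ∈ S.filter (fun i => down i), g ((cycleSet f i).ncard - 1) := by
    rw [Finset.prod_congr rfl fun w hw => if_pos (Finset.mem_filter.1 hw).2,
      Finset.prod_mul_distrib, Finset.prod_const]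
  have e4 : ∏ i ∈ S.filter (fun i => ¬ down i),
      (if down i then q * g ((cycleSet f i).ncard - 1) else a)
      = a ^ (S.filter (fun i => ¬ down i)).card := by
    rw [Finset.prod_congr rfl fun w hw => if_neg (Finset.mem_filter.1 hw).2, Finset.prod_const]
  rw [e1, e2, e3, e4]
  ring

end IsEdgeCut
end EdgeCut

/-! ### Comparison of two trees coded by permutations -/

theorem zpow_apply_eq_pow {α : Type*} {g : Equiv.Perm α} {d : α} (hf : (cycleSet g d).Finite)
    (z : ℤ) : (g ^ z) d = (g ^ (z % (cycleSet g d).ncard).toNat) d := by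
  have h : g.IsCycleOn (hf.toFinset : Set α) := by simpa using isCycleOn_cycleSet g d
  have hpos := ncard_cycleSet_pos hf
  rw [Set.ncard_eq_toFinset_card _ hf] at *
  have h1 := (h.zpow_apply_eq_zpow_apply (a := d) (by simpa using self_mem_cycleSet g d) (m := z)
    (n := z % hf.toFinset.card)).2 (Int.mod_modEq _ _).symm
  rw [h1, ← zpow_natCast, Int.toNat_of_nonneg (Int.emod_nonneg _ (by omega))]

section Compare

variable {α α' : Type*} {p f : Equiv.Perm α} {o : α} {col : α → Bool} {r : α → ℕ}
  {p' f' : Equiv.Perm α'} {o' : α'} {col' : α' → Bool} {r' : α' → ℕ}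

variable (p f o p' f' o') in
/-- The edges `i` and `i'` of two trees have the same word, which is not below `v`. -/
def SameWord (v : List ℕ) (i : α) (i' : α') : Prop :=
  ∃ w, w ∈ PlaneTree.offVerts' (edgeCount p f o) v ∧ w ∈ PlaneTree.offVerts' (edgeCount p' f' o') v
    ∧ w ≠ [] ∧ (edgeAt p f o w).1 = i ∧ (edgeAt p' f' o' w).1 = i'

theorem edgeAt_snd_eq (w : List ℕ) : (edgeAt p f o w).2 = (edgeAt p' f' o' w).2 := by
  rw [edgeAt_snd, edgeAt_snd]

theorem edgeAt_snd_of_eq {w : List ℕ} {b : Bool} (h : (edgeAt p f o w).2 = b) :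
    (edgeAt p' f' o' w).2 = b := by
  rw [← h, edgeAt_snd, edgeAt_snd]

theorem edgeCount_nil : edgeCount p f o [] = (cycleSet p (p⁻¹ o)).ncard := by
  rw [edgeCount, if_pos rfl]
  rfl

/-- Equal numbers of children give the same words around a vertex. -/
theorem sameWord_zpow (h : IsEdgeTree p f o col r) (h' : IsEdgeTree p' f' o' col' r')
    {v w : List ℕ} (hw : w ∈ PlaneTree.offVerts (edgeCount p f o) v)
    (hw' : w ∈ PlaneTree.offVerts (edgeCount p' f' o') v)
    (hk : edgeCount p f o w = edgeCount p' f' o' w) (z : ℤ) :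
    SameWord p f o p' f' o' v ((turn p f (edgeAt p f o w).2 ^ z) (edgeAt p f o w).1)
      ((turn p' f' (edgeAt p' f' o' w).2 ^ z) (edgeAt p' f' o' w).1) := by
  have hf := h.finite (edgeAt p f o w).2 (edgeAt p f o w).1
  have hf' := h'.finite (edgeAt p' f' o' w).2 (edgeAt p' f' o' w).1
  have hpos := ncard_cycleSet_pos hf
  have hpos' := ncard_cycleSet_pos hf'
  have hn : (cycleSet (turn p f (edgeAt p f o w).2) (edgeAt p f o w).1).ncard
      = (cycleSet (turn p' f' (edgeAt p' f' o' w).2) (edgeAt p' f' o' w).1).ncard := by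
    unfold edgeCount at hk
    split_ifs at hk with h0 <;> omega
  have child : ∀ j < edgeCount p f o w, SameWord p f o p' f' o' v
      ((turn p f (edgeAt p f o w).2 ^ (j + 1)) (edgeAt p f o w).1)
      ((turn p' f' (edgeAt p' f' o' w).2 ^ (j + 1)) (edgeAt p' f' o' w).1) := by
    intro j hj
    exact ⟨w ++ [j], PlaneTree.concat_mem_offVerts'.2 ⟨hw, hj⟩,
      PlaneTree.concat_mem_offVerts'.2 ⟨hw', by rwa [← hk]⟩, by simp,
      by rw [edgeAt_concat]; rfl, by rw [edgeAt_concat]; rfl⟩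
  rw [zpow_apply_eq_pow hf, zpow_apply_eq_pow hf', ← hn]
  set n := (cycleSet (turn p f (edgeAt p f o w).2) (edgeAt p f o w).1).ncard with hn'
  have hmod : (z % (n : ℤ)).toNat < n := by
    have := Int.emod_lt_of_pos z (show (0 : ℤ) < n by omega)
    have := Int.emod_nonneg z (show (n : ℤ) ≠ 0 by omega)
    omega
  generalize (z % (n : ℤ)).toNat = m at hmod
  have hkn : edgeCount p f o w = n - if w = [] then 0 else 1 := rfl
  rcases m with _ | j
  -- Exponent `0` is the edge to the parent. At the root it is instead the last child, obtained at
  -- exponent `n`.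
  · by_cases h0 : w = []
    · rw [if_pos h0] at hkn
      have := child (n - 1) (by omega)
      rw [Nat.sub_add_cancel hpos] at this
      have e : ((turn p f (edgeAt p f o w).2 ^ n) (edgeAt p f o w).1)
          = ((turn p f (edgeAt p f o w).2 ^ 0) (edgeAt p f o w).1) :=
        (pow_apply_eq_pow_apply_iff hf (self_mem_cycleSet _ _)).2 (by simp [Nat.ModEq, ← hn'])
      have e' : ((turn p' f' (edgeAt p' f' o' w).2 ^ n) (edgeAt p' f' o' w).1)
          = ((turn p' f' (edgeAt p' f' o' w).2 ^ 0) (edgeAt p' f' o' w).1) :=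
        (pow_apply_eq_pow_apply_iff hf' (self_mem_cycleSet _ _)).2 (by simp [Nat.ModEq, ← hn])
      rwa [e, e'] at this
    · exact ⟨w, PlaneTree.offVerts_subset _ _ hw, PlaneTree.offVerts_subset _ _ hw', h0, rfl, rfl⟩
  · exact child j (by split_ifs at hkn <;> omega)

variable {S : Finset α} {x : α} {S' : Finset α'} {x' : α'} {v : List ℕ}

/-- The data of two trees that agree off the descendants of a white vertex `v`. -/
structure IsAgreeing (p f : Equiv.Perm α) (o : α) (col : α → Bool) (r : α → ℕ)
    (p' f' : Equiv.Perm α') (o' : α') (col' : α' → Bool) (r' : α' → ℕ) (x : α) (x' : α')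
    (v : List ℕ) : Prop where
  tree : IsEdgeTree p f o col r
  tree' : IsEdgeTree p' f' o' col' r'
  mem : v ∈ edgeVerts p f o
  mem' : v ∈ edgeVerts p' f' o'
  edge : edgeAt p f o v = (x, false)
  edge' : edgeAt p' f' o' v = (x', false)
  count : ∀ w ∈ PlaneTree.offVerts (edgeCount p f o) v, edgeCount p f o w = edgeCount p' f' o' w

namespace IsAgreeing

/-- The rotation takes place at the black endpoint of the edge, which is the vertex itself or its
parent. It is never `v`, so the numbers of children agree there. -/
theorem sameWord_face (a : IsAgreeing p f o col r p' f' o' col' r' x x' v) {i : α} {i' : α'}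
    (hi : SameWord p f o p' f' o' v i i') (z : ℤ) :
    SameWord p f o p' f' o' v ((f ^ z) i) ((f' ^ z) i') := by
  obtain ⟨w, hw, hw', hw0, rfl, rfl⟩ := hi
  have key : ∀ u ∈ PlaneTree.offVerts (edgeCount p f o) v, ∀ z : ℤ, (edgeAt p f o u).2 = true →
      SameWord p f o p' f' o' v ((f ^ z) (edgeAt p f o u).1) ((f' ^ z) (edgeAt p' f' o' u).1) := by
    intro u hu z hc
    have hu' := PlaneTree.offVerts_subset_of_agree a.count hu
    have := sameWord_zpow a.tree a.tree' hu hu' (a.count u hu) (-z)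
    rw [hc, edgeAt_snd_of_eq hc] at this
    simpa [turn] using this
  rcases hc : (edgeAt p f o w).2 with _ | _
  · rcases List.eq_nil_or_concat' w with rfl | ⟨u, j, rfl⟩
    · exact absurd rfl hw0
    · have hu := (PlaneTree.concat_mem_offVerts'.1 hw).1
      have hcu : (edgeAt p f o u).2 = true := by
        simpa [edgeAt_concat, edgeStep] using hc
      have := key u hu (z + -((j + 1 : ℕ) : ℤ)) hcu
      rw [zpow_add, Equiv.Perm.mul_apply, zpow_add, Equiv.Perm.mul_apply] at this
      rw [edgeAt_concat, edgeAt_concat, edgeStep, edgeStep, hcu, edgeAt_snd_of_eq hcu]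
      simpa only [turn, inv_pow, zpow_neg, zpow_natCast] using this
  · refine key w ⟨hw.1, fun hv => ?_⟩ z hc
    rw [hw.2 hv, a.edge] at hc
    cases hc

/-- The rotation takes place at the white endpoint, which is `v` only for the edge `x`. -/
theorem sameWord_class (a : IsAgreeing p f o col r p' f' o' col' r' x x' v) {i : α} {i' : α'}
    (hi : SameWord p f o p' f' o' v i i') (hx : i ≠ x) (z : ℤ) :
    SameWord p f o p' f' o' v ((p ^ z) i) ((p' ^ z) i') := by
  obtain ⟨w, hw, hw', hw0, rfl, rfl⟩ := hi
  have key : ∀ u ∈ PlaneTree.offVerts (edgeCount p f o) v, ∀ z : ℤ, (edgeAt p f o u).2 = false →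
      SameWord p f o p' f' o' v ((p ^ z) (edgeAt p f o u).1) ((p' ^ z) (edgeAt p' f' o' u).1) := by
    intro u hu z hc
    have hu' := PlaneTree.offVerts_subset_of_agree a.count hu
    have := sameWord_zpow a.tree a.tree' hu hu' (a.count u hu) z
    rw [hc, edgeAt_snd_of_eq hc] at this
    simpa [turn] using this
  rcases hc : (edgeAt p f o w).2 with _ | _
  · refine key w ⟨hw.1, fun hv => ?_⟩ z hc
    rw [hw.2 hv, a.edge] at hx
    exact hx rfl
  · rcases List.eq_nil_or_concat' w with rfl | ⟨u, j, rfl⟩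
    · exact absurd rfl hw0
    · have hu := (PlaneTree.concat_mem_offVerts'.1 hw).1
      have hcu : (edgeAt p f o u).2 = false := by
        simpa [edgeAt_concat, edgeStep] using hc
      have := key u hu (z + ((j + 1 : ℕ) : ℤ)) hcu
      rw [zpow_add, Equiv.Perm.mul_apply, zpow_add, Equiv.Perm.mul_apply] at this
      rw [edgeAt_concat, edgeAt_concat, edgeStep, edgeStep, hcu, edgeAt_snd_of_eq hcu]
      simpa only [turn, zpow_natCast] using this

theorem sameWord_root (a : IsAgreeing p f o col r p' f' o' col' r' x x' v) (hv : v ≠ []) :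
    SameWord p f o p' f' o' v o o' := by
  have hnil : [] ∈ PlaneTree.offVerts (edgeCount p f o) v :=
    ⟨PlaneTree.nil_mem _, fun hc => hv (List.prefix_nil.1 hc)⟩
  have := sameWord_zpow a.tree a.tree' hnil
    (PlaneTree.offVerts_subset_of_agree a.count hnil) (a.count _ hnil) 1
  simpa [IsEdgeTree.edgeAt_nil, turn] using this

theorem sameWord_cut (a : IsAgreeing p f o col r p' f' o' col' r' x x' v) {i' : α'}
    (hi : SameWord p f o p' f' o' v x i') (hv : v ≠ []) : i' = x' := by
  obtain ⟨w, hw, hw', hw0, hx, rfl⟩ := hi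
  rw [a.tree.edgeAt_injOn hw.1 a.mem hw0 hv (by rw [hx, a.edge]), a.edge']

theorem sameWord_color (a : IsAgreeing p f o col r p' f' o' col' r' x x' v) {i : α} {i' : α'}
    (hi : SameWord p f o p' f' o' v i i') : col i = col' i' := by
  obtain ⟨w, hw, hw', hw0, rfl, rfl⟩ := hi
  rw [a.tree.col_edgeAt hw.1 hw0, a.tree'.col_edgeAt hw'.1 hw0, edgeAt_snd_eq]

theorem sameWord_ncard (a : IsAgreeing p f o col r p' f' o' col' r' x x' v) {i : α} {i' : α'}
    (hi : SameWord p f o p' f' o' v i i') :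
    (cycleSet f i).ncard = (cycleSet f' i').ncard := by
  obtain ⟨w, hw, hw', hw0, rfl, rfl⟩ := hi
  have key : ∀ u ∈ PlaneTree.offVerts (edgeCount p f o) v, (edgeAt p f o u).2 = true →
      (cycleSet f (edgeAt p f o u).1).ncard = (cycleSet f' (edgeAt p' f' o' u).1).ncard := by
    intro u hu hc
    have h1 := a.count u hu
    rw [IsEdgeCut.edgeCount_black hc, IsEdgeCut.edgeCount_black (edgeAt_snd_of_eq hc)] at h1
    have h2 := a.tree.finite true (edgeAt p f o u).1
    have h3 := a.tree'.finite true (edgeAt p' f' o' u).1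
    rw [turn, cycleSet_inv] at h2 h3
    have := ncard_cycleSet_pos h2
    have := ncard_cycleSet_pos h3
    omega
  rcases hc : (edgeAt p f o w).2 with _ | _
  · rcases List.eq_nil_or_concat' w with rfl | ⟨u, j, rfl⟩
    · exact absurd rfl hw0
    · have hu := (PlaneTree.concat_mem_offVerts'.1 hw).1
      have hcu : (edgeAt p f o u).2 = true := by
        simpa [edgeAt_concat, edgeStep] using hc
      have hs := IsEdgeTree.sameCycle_concat (p := p) (f := f) (o := o) u j
      have hs' := IsEdgeTree.sameCycle_concat (p := p') (f := f') (o := o') u j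
      rw [edgeAt_snd_of_eq hcu] at hs'
      rw [hcu] at hs
      rw [cycleSet_eq (Equiv.Perm.sameCycle_inv.1 hs), cycleSet_eq (Equiv.Perm.sameCycle_inv.1 hs')]
      exact key u hu hcu
  · refine key w ⟨hw.1, fun hv => ?_⟩ hc
    rw [hw.2 hv, a.edge] at hc
    cases hc

end IsAgreeing

end Compare

/-! ### Permutations that agree on a cut -/

section Determined

variable {α : Type*} {p f p' f' : Equiv.Perm α} {o : α} {col col' : α → Bool} {r r' : α → ℕ}

theorem pow_eq_of_eqOn {g g' : Equiv.Perm α} {A : Set α} (h : ∀ i ∈ A, g i = g' i)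
    (hA : ∀ i ∈ A, g i ∈ A) {i : α} (hi : i ∈ A) (n : ℕ) :
    (g ^ n) i = (g' ^ n) i ∧ (g ^ n) i ∈ A := by
  induction n with
  | zero => exact ⟨rfl, hi⟩
  | succ n ih =>
    rw [pow_succ', pow_succ', Equiv.Perm.mul_apply, Equiv.Perm.mul_apply, ← ih.1]
    exact ⟨h _ ih.2, hA _ ih.2⟩

theorem cycleSet_eq_of_eqOn {g g' : Equiv.Perm α} {A : Set α} (h : ∀ i ∈ A, g i = g' i)
    (hA : ∀ i ∈ A, g i ∈ A) {i : α} (hi : i ∈ A) (hf : (cycleSet g i).Finite)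
    (hf' : (cycleSet g' i).Finite) : cycleSet g i = cycleSet g' i := by
  ext j
  constructor
  · intro hj
    obtain ⟨n, -, rfl⟩ := exists_pow_lt hf (self_mem_cycleSet _ _) hj
    rw [(pow_eq_of_eqOn h hA hi n).1]
    exact ⟨n, by simp⟩
  · intro hj
    obtain ⟨n, -, rfl⟩ := exists_pow_lt hf' (self_mem_cycleSet _ _) hj
    rw [← (pow_eq_of_eqOn h hA hi n).1]
    exact ⟨n, by simp⟩

/-- Permutations that agree on a cut give trees that agree off the subtree above it. -/
theorem IsEdgeCut.agree {S : Finset α} {x : α} {v : List ℕ} (h : IsEdgeTree p f o col r)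
    (h' : IsEdgeTree p' f' o col' r') (c : IsEdgeCut p f o col S x)
    (hf : ∀ i ∈ S, f i = f' i) (hp : ∀ i ∈ S, i ≠ x → p i = p' i)
    (hv : v ∈ edgeVerts p f o) (hvx : edgeAt p f o v = (x, false)) {w : List ℕ}
    (hw : w ∈ PlaneTree.offVerts' (edgeCount p f o) v) :
    w ∈ edgeVerts p' f' o ∧ (w ≠ [] → edgeAt p f o w = edgeAt p' f' o w) ∧
      (w ≠ v → edgeCount p f o w = edgeCount p' f' o w) := by
  have hv0 := c.ne_nil hvx h
  -- Once `x` is removed, `S` is stable under `p` and not only under `f`.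
  have hA : ∀ i ∈ {i | i ∈ S ∧ i ≠ x}, p i ∈ {i | i ∈ S ∧ i ≠ x} := by
    rintro i ⟨hi, hix⟩
    have hs : p.SameCycle i (p i) := Equiv.Perm.sameCycle_apply_right.2 Equiv.Perm.SameCycle.rfl
    refine ⟨c.class_mem i hi hix _ hs, fun hc => hix ?_⟩
    rw [hc] at hs
    exact c.eq_of_class i hi hs.symm
  have hpA : ∀ i ∈ {i | i ∈ S ∧ i ≠ x}, p i = p' i := fun i hi => hp i hi.1 hi.2
  have hB : ∀ i ∈ (S : Set α), f⁻¹ i ∈ (S : Set α) := fun i hi =>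
    c.sameCycle_mem hi ⟨-1, by simp⟩
  have hfB : ∀ i ∈ (S : Set α), f⁻¹ i = f'⁻¹ i := by
    intro i hi
    have := hf _ (hB i hi)
    rw [eq_comm, Equiv.Perm.inv_eq_iff_eq, ← this]
    simp
  have hox : o ≠ x := by
    intro he
    have := h.root o Equiv.Perm.SameCycle.rfl
    rw [he, c.white] at this
    cases this
  have hoA : o ∈ {i | i ∈ S ∧ i ≠ x} := ⟨c.root_mem, hox⟩
  -- agreement of the edges around a vertex
  have around : ∀ u ∈ PlaneTree.offVerts (edgeCount p f o) v,
      (u ≠ [] → edgeAt p f o u = edgeAt p' f' o u) →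
      edgeCount p f o u = edgeCount p' f' o u ∧
        ∀ j, edgeAt p f o (u ++ [j]) = edgeAt p' f' o (u ++ [j]) := by
    intro u hu he
    by_cases hu0 : u = []
    · subst hu0
      have hf1 := h.finite false o
      have hf2 := h'.finite false o
      refine ⟨?_, fun j => ?_⟩
      · rw [edgeCount_nil, edgeCount_nil, IsEdgeTree.cycleSet_root, IsEdgeTree.cycleSet_root,
          cycleSet_eq_of_eqOn hpA hA hoA hf1 hf2]
      · rw [edgeAt_concat, edgeAt_concat, IsEdgeTree.edgeAt_nil, IsEdgeTree.edgeAt_nil, edgeStep,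
          edgeStep]
        have := (pow_eq_of_eqOn hpA hA hoA j).1
        simp [turn, pow_succ, this]
    · have hS := c.edgeAt_mem h hv hvx (PlaneTree.offVerts_subset _ _ hu) hu0
      have he := he hu0
      simp only [edgeCount, edgeAt_concat, if_neg hu0, ← he, edgeStep]
      have hne : (edgeAt p f o u).1 ≠ x := fun hc => hu.2 (by
        rw [h.edgeAt_injOn hu.1 hv hu0 hv0 (by rw [hc, hvx])])
      have hf1 := h.finite (edgeAt p f o u).2 (edgeAt p f o u).1
      have hf2 := h'.finite (edgeAt p f o u).2 (edgeAt p f o u).1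
      rcases hc : (edgeAt p f o u).2 with _ | _
      · rw [hc] at hf1 hf2
        have hmem : (edgeAt p f o u).1 ∈ {i | i ∈ S ∧ i ≠ x} := ⟨hS, hne⟩
        refine ⟨congrArg (fun A => A.ncard - 1)
          (cycleSet_eq_of_eqOn (g := turn p f false) (g' := turn p' f' false) hpA hA hmem hf1 hf2),
          fun j => ?_⟩
        have := (pow_eq_of_eqOn hpA hA hmem (j + 1)).1
        simp only [turn, this]
      · rw [hc] at hf1 hf2
        refine ⟨congrArg (fun A => A.ncard - 1)
          (cycleSet_eq_of_eqOn (g := turn p f true) (g' := turn p' f' true) hfB hB hS hf1 hf2),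
          fun j => ?_⟩
        have := (pow_eq_of_eqOn hfB hB hS (j + 1)).1
        simp only [turn, this]
  have main : ∀ w, w ∈ PlaneTree.offVerts' (edgeCount p f o) v →
      w ∈ edgeVerts p' f' o ∧ (w ≠ [] → edgeAt p f o w = edgeAt p' f' o w) := by
    intro w
    induction w using List.reverseRecOn with
    | nil => exact fun _ => ⟨IsEdgeTree.nil_mem, fun hc => absurd rfl hc⟩
    | append_singleton u j ih =>
      intro hw
      obtain ⟨hu, hj⟩ := PlaneTree.concat_mem_offVerts'.1 hw
      obtain ⟨h1, h2⟩ := ih (PlaneTree.offVerts_subset _ _ hu)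
      obtain ⟨h3, h4⟩ := around u hu h2
      exact ⟨IsEdgeTree.concat_mem.2 ⟨h1, by rwa [← h3]⟩, fun _ => h4 j⟩
  refine ⟨(main w hw).1, (main w hw).2, fun hwv => ?_⟩
  exact (around w ⟨hw.1, fun hc => hwv (hw.2 hc)⟩ (main w hw).2).1

end Determined

/-! ### Reading the tree of components off finite pieces of a coding pair -/

theorem IsAgreeing.sameWord_unique {α α' : Type*} {p f : Equiv.Perm α} {o : α} {col : α → Bool}
    {r : α → ℕ} {p' f' : Equiv.Perm α'} {o' : α'} {col' : α' → Bool} {r' : α' → ℕ} {x : α} {x' : α'}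
    {v : List ℕ} (a : IsAgreeing p f o col r p' f' o' col' r' x x' v) {i : α} {i' i'' : α'}
    (hi : SameWord p f o p' f' o' v i i') (hi' : SameWord p f o p' f' o' v i i'') : i' = i'' := by
  obtain ⟨w, hw, hw', hw0, hx, rfl⟩ := hi
  obtain ⟨u, hu, hu', hu0, hx', rfl⟩ := hi'
  rw [a.tree.edgeAt_injOn hw.1 hu.1 hw0 hu0 (by rw [hx, hx'])]

section WalkPair

variable {E D : ℤ → ℤ} {s : Setoid ℤ} {N x : ℤ} {E' D' : ℤ → ℤ} {s' : Setoid ℤ} {N' x' : ℤ}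

theorem IsCut.isEdgeCut (c : IsCut E D N x) (h : IsWalkPair E D s) :
    IsEdgeCut (predPerm s) (facePerm s) 0 (edgeColor E D) (Finset.Ico x N) x where
  mem := Finset.mem_Ico.2 ⟨le_rfl, by have := c.neg; have := c.pos; omega⟩
  root_mem := Finset.mem_Ico.2 ⟨c.neg.le, c.pos⟩
  white := c.edgeColor_eq
  face_mem i hi := by
    obtain ⟨h1, h2⟩ := Finset.mem_Ico.1 hi
    exact Finset.mem_Ico.2 (c.facePerm_mem h h1 h2)
  class_mem i hi hix j hj := by
    obtain ⟨h1, h2⟩ := Finset.mem_Ico.1 hi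
    obtain ⟨h3, h4⟩ := c.class_mem h (by omega) h2 (h.sameCycle_iff.1 hj)
    exact Finset.mem_Ico.2 ⟨h3.le, h4⟩
  eq_of_class i hi hs := by
    obtain ⟨h1, h2⟩ := Finset.mem_Ico.1 hi
    exact c.eq_of_rel h h1 h2 (h.sameCycle_iff.1 hs)

/-- A finite piece of the tree of components determines the walks. -/
theorem IsCut.eq_of_agree (c : IsCut E D N x) (h : IsWalkPair E D s) (c' : IsCut E' D' N' x')
    (h' : IsWalkPair E' D' s') {v : List ℕ} (hv0 : v ≠ [])
    (a : IsAgreeing (predPerm s) (facePerm s) 0 (edgeColor E D) (edgeRank E D)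
      (predPerm s') (facePerm s') 0 (edgeColor E' D') (edgeRank E' D') x x' v) :
    N = N' ∧ x = x' ∧
      ∀ i, x ≤ i → i < N → IsWalkPair.step E D i = IsWalkPair.step E' D' i := by
  have hN := c.pos
  have hx := c.neg
  have h0 := a.sameWord_root hv0
  -- The edge after `i` is `p⁻¹ (f i)` and the one before is `f⁻¹ (p i)`. Equality of words
  -- therefore spreads from the root edge along the chain, in both directions, until the cut stops
  -- it.
  have hpos : ∀ k : ℕ, (k : ℤ) < N →
      SameWord (predPerm s) (facePerm s) 0 (predPerm s') (facePerm s') 0 v (k : ℤ) (k : ℤ) := by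
    intro k
    induction k with
    | zero => exact fun _ => h0
    | succ k ih =>
      intro hk
      push_cast at hk ⊢
      have h1 := a.sameWord_face (ih (by omega)) 1
      rw [zpow_one, zpow_one] at h1
      have h2 := a.sameWord_class h1 (fun he => by
        rw [facePerm_apply, ← c.predPerm_eq h] at he
        have := (predPerm s).injective he
        omega) (-1)
      rwa [zpow_neg_one, zpow_neg_one, predPerm_inv_facePerm, predPerm_inv_facePerm] at h2
  have hneg : ∀ k : ℕ, x ≤ -(k : ℤ) →
      SameWord (predPerm s) (facePerm s) 0 (predPerm s') (facePerm s') 0 v (-(k : ℤ))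
        (-(k : ℤ)) := by
    intro k
    induction k with
    | zero => exact fun _ => h0
    | succ k ih =>
      intro hk
      push_cast at hk
      have h1 := a.sameWord_class (ih (by omega)) (by omega) 1
      rw [zpow_one, zpow_one] at h1
      have h2 := a.sameWord_face h1 (-1)
      rw [zpow_neg_one, zpow_neg_one, facePerm_inv_predPerm, facePerm_inv_predPerm] at h2
      rwa [show -((k + 1 : ℕ) : ℤ) = -(k : ℤ) - 1 by push_cast; ring]
  have hall : ∀ i, x ≤ i → i < N →
      SameWord (predPerm s) (facePerm s) 0 (predPerm s') (facePerm s') 0 v i i := by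
    intro i hi1 hi2
    rcases le_or_gt 0 i with hi | hi
    · have := hpos i.toNat (by omega)
      rwa [Int.toNat_of_nonneg hi] at this
    · have := hneg (-i).toNat (by omega)
      rwa [Int.toNat_of_nonneg (by omega), neg_neg] at this
  refine ⟨?_, a.sameWord_cut (hall x le_rfl (by omega)) hv0, fun i hi1 hi2 => ?_⟩
  -- The edge `N - 1` is the one that `facePerm` sends to the cut edge, which recovers `N`.
  · have h1 := a.sameWord_face (hall (N - 1) (by omega) (by omega)) 1
    rw [zpow_one, zpow_one, facePerm_apply, facePerm_apply, sub_add_cancel, c.predPerm_eq h] at h1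
    have h2 := a.sameWord_cut h1 hv0
    rw [← c'.predPerm_eq h'] at h2
    exact (predPerm s').injective h2
  · have hi := hall i hi1 hi2
    have h1 := a.sameWord_face hi 1
    rw [zpow_one, zpow_one] at h1
    have h2 := c.facePerm_mem h hi1 hi2
    -- Since `facePerm s i` is in the window, it corresponds to itself, so both face permutations
    -- agree at `i`. This settles the comparison of `facePerm i` with `i` in `step_eq`.
    have h3 := a.sameWord_unique h1 (hall _ h2.1 h2.2)
    rw [h.step_eq, h'.step_eq, h3, a.sameWord_ncard hi, a.sameWord_color hi]

/-- Finite pieces of the walks determine the vertices of the looptree. -/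
theorem IsCut.rel_iff (c : IsCut E D N x) (h : IsWalkPair E D s) (c' : IsCut E' D' N x)
    (h' : IsWalkPair E' D' s') (hE : ∀ i, 0 ≤ i → i ≤ N → E i = E' i)
    (hD : ∀ i, x ≤ i → i ≤ 0 → D i = D' i) {i j : ℤ} (hi : x < i) (hij : i ≤ j) (hj : j < N) :
    s i j ↔ s' i j := by
  rcases le_or_gt 0 i with h0 | h0
  · rw [h.rel_pos i j h0 hij, h'.rel_pos i j h0 hij, Exc, Exc, hE i h0 (by omega),
      hE j (by omega) hj.le]
    refine and_congr_right fun _ => forall_congr' fun k => forall_congr' fun hk =>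
      forall_congr' fun hk' => ?_
    rw [hE k (by omega) (by omega)]
  · rcases le_or_gt j 0 with h1 | h1
    · rw [h.rel_neg i j hij h1, h'.rel_neg i j hij h1, Exc, Exc, hD i hi.le h0.le,
        hD j (by omega) h1]
      refine and_congr_right fun _ => forall_congr' fun k => forall_congr' fun hk =>
        forall_congr' fun hk' => ?_
      rw [hD k (by omega) (by omega)]
    · rw [h.rel_ray i j h0.le h1.le, h'.rel_ray i j h0.le h1.le, hD i hi.le h0.le,
        hE j h1.le hj.le]
      have hDx := hD x le_rfl c.neg.le
      -- Being on the ray involves the whole past of `i`. Before `x` the condition is automatic,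
      -- because both `D` and `D'` are at least `D x` there.
      refine and_congr ⟨fun hr l hl => ?_, fun hr l hl => ?_⟩ (and_congr_right fun _ =>
        forall_congr' fun k => forall_congr' fun hk => forall_congr' fun hk' => ?_)
      · rcases le_or_gt x l with hxl | hxl
        · rw [← hD l hxl (by omega)]
          exact hr l hl
        · have := hr x hi.le
          have := c'.ray l hxl.le
          omega
      · rcases le_or_gt x l with hxl | hxl
        · rw [hD l hxl (by omega)]
          exact hr l hl
        · have := hr x hi.le
          have := c.ray l hxl.le
          omega
      · rw [hE k hk (by omega)]

theorem IsCut.predPerm_eq_of_eqOn (c : IsCut E D N x) (h : IsWalkPair E D s) (c' : IsCut E' D' N x)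
    (h' : IsWalkPair E' D' s') (hE : ∀ i, 0 ≤ i → i ≤ N → E i = E' i)
    (hD : ∀ i, x ≤ i → i ≤ 0 → D i = D' i) {i : ℤ} (hi : x < i) (hiN : i ≤ N) :
    predPerm s i = predPerm s' i := by
  rcases eq_or_lt_of_le hiN with rfl | hiN
  · rw [c.predPerm_eq h, c'.predPerm_eq h']
  · have hcl : classOf s i = classOf s' i := by
      have rel : ∀ j, x < j → j < N → (s i j ↔ s' i j) := by
        intro j hj1 hj2
        rcases le_total i j with hij | hij
        · exact c.rel_iff h c' h' hE hD hi hij hj2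
        · have := c.rel_iff h c' h' hE hD hj1 hij hiN
          exact ⟨fun hs => Setoid.symm' _ (this.1 (Setoid.symm' _ hs)),
            fun hs => Setoid.symm' _ (this.2 (Setoid.symm' _ hs))⟩
      ext j
      constructor
      · intro hj
        have := c.class_mem h hi hiN hj
        exact (rel j this.1 this.2).1 hj
      · intro hj
        have := c'.class_mem h' hi hiN hj
        exact (rel j this.1 this.2).2 hj
    rw [predPerm_apply, predPerm_apply, cyclicPred, cyclicPred, hcl]

end WalkPair

/-! ### Records and spine vertices -/

/-- The strict descending record times of `C`. -/
noncomputable def recTime (C : ℕ → ℤ) : ℕ → ℕ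
  | 0 => 0
  | n + 1 => sInf {t | C t < C (recTime C n)}

/-- The time after which `C'` stays above `b`. -/
noncomputable def rayTime (C' : ℕ → ℤ) (b : ℤ) : ℕ := sInf {m | ∀ l, m ≤ l → b ≤ C' l}

/-- The time of `C'` at which the spine is cut. -/
noncomputable def cutTime (C C' : ℕ → ℤ) (n : ℕ) : ℕ := rayTime C' (-C (recTime C n))

/-- The initial segments of a coding pair that determine the tree of components off the
descendants of the `n`-th white vertex of the spine. -/
noncomputable def cutKey (n : ℕ) (X : (ℕ → ℤ) × (ℕ → ℤ)) : List ℤ × List ℤ :=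
  ((List.range (recTime X.1 n + 1)).map X.1, (List.range (cutTime X.1 X.2 n + 1)).map X.2)

namespace IsCodingPair

variable {C C' : ℕ → ℤ}

theorem recTime_spec (h : IsCodingPair C C') (n : ℕ) :
    C (recTime C (n + 1)) < C (recTime C n) ∧
      ∀ k < recTime C (n + 1), C (recTime C n) ≤ C k := by
  have hne : {t | C t < C (recTime C n)}.Nonempty := (h.frequently_lt _).exists
  exact ⟨Nat.sInf_mem hne, fun k hk => not_lt.1 fun hc => absurd (Nat.sInf_le hc) (not_le.2 hk)⟩

theorem recTime_lt (h : IsCodingPair C C') (n : ℕ) : recTime C n < recTime C (n + 1) := by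
  obtain ⟨h1, h2⟩ := h.recTime_spec n
  rcases n with _ | n
  · rw [recTime] at *
    by_contra! hc
    obtain hc := Nat.le_zero.1 hc
    rw [hc] at h1
    exact lt_irrefl _ h1
  · have h3 := (h.recTime_spec n).2
    by_contra! hc
    rcases eq_or_lt_of_le hc with hc | hc
    · rw [hc] at h1
      exact lt_irrefl _ h1
    · have := h3 _ hc
      have := (h.recTime_spec n).1
      omega

theorem recTime_record (h : IsCodingPair C C') (n : ℕ) {k : ℕ} (hk : k < recTime C n) :
    C (recTime C n) < C k := by
  rcases n with _ | n
  · rw [recTime] at hk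
    omega
  · have := (h.recTime_spec n).2 k hk
    have := (h.recTime_spec n).1
    omega

theorem le_recTime (h : IsCodingPair C C') (n : ℕ) : n ≤ recTime C n := by
  induction n with
  | zero => omega
  | succ n ih => have := h.recTime_lt n; omega

theorem neg_recTime (h : IsCodingPair C C') {n : ℕ} (hn : n ≠ 0) : C (recTime C n) < 0 := by
  rw [← h.zero]
  have := h.le_recTime n
  exact h.recTime_record n (by omega)

/-- The level `b` is hit exactly: just before, `C'` is below `b`, and its steps are at most one. -/
theorem rayTime_spec (h : IsCodingPair C C') {b : ℤ} (hb : 0 < b) :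
    0 < rayTime C' b ∧ (∀ l, rayTime C' b ≤ l → b ≤ C' l) ∧ C' (rayTime C' b) = b ∧
      C' (rayTime C' b - 1) < b := by
  have hne : {m | ∀ l, m ≤ l → b ≤ C' l}.Nonempty :=
    Filter.eventually_atTop.1 (h.tendsto'.eventually_ge_atTop b)
  have h1 : ∀ l, rayTime C' b ≤ l → b ≤ C' l := Nat.sInf_mem hne
  have h2 : 0 < rayTime C' b := by
    by_contra! hc
    have := h1 0 hc
    rw [h.zero'] at this
    omega
  have h3 : C' (rayTime C' b - 1) < b := by
    by_contra! hc
    have : rayTime C' b ≤ rayTime C' b - 1 := Nat.sInf_le fun l hl => by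
      rcases eq_or_lt_of_le hl with rfl | hl
      · exact hc
      · exact h1 l (by omega)
    omega
  have h4 := h1 _ le_rfl
  have h5 := h.step_le' (rayTime C' b - 1)
  rw [Nat.sub_add_cancel h2] at h5
  exact ⟨h2, h1, by omega, h3⟩

theorem isCut (h : IsCodingPair C C') {n : ℕ} (hn : n ≠ 0) :
    IsCut (fwd C) (back C') (recTime C n) (-(cutTime C C' n : ℤ)) := by
  obtain ⟨h1, h2, h3, h4⟩ := h.rayTime_spec (b := -C (recTime C n))
    (by have := h.neg_recTime hn; omega)
  have h5 := h.le_recTime n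
  have e1 : back C' (-(cutTime C C' n : ℤ)) = -C (recTime C n) := by
    rw [back_neg_natCast]; exact h3
  have e2 : back C' (-(cutTime C C' n : ℤ) + 1) = C' (cutTime C C' n - 1) := by
    rw [back]
    congr 1
    unfold cutTime
    omega
  refine ⟨by omega, fun k hk1 hk2 => ?_, by unfold cutTime; omega, by rw [e1, fwd_natCast],
    by rw [e1, e2]; exact h4, fun l hl => ?_⟩
  · rw [fwd_natCast]
    exact h.recTime_record n (by omega)
  · rw [e1]
    exact h2 _ (by unfold cutTime at hl; omega)

/-- The `n`-th cut is at the `n`-th white vertex of the spine. -/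
theorem exists_spine_word (h : IsCodingPair C C') (n : ℕ) :
    ∃ v ∈ edgeVerts (predPerm (gluedSetoid C C')) (facePerm (gluedSetoid C C')) 0,
      v.length = 2 * n ∧ (n ≠ 0 → edgeAt (predPerm (gluedSetoid C C'))
        (facePerm (gluedSetoid C C')) 0 v = (-(cutTime C C' n : ℤ), false)) := by
  have hw := h.isWalkPair
  have ht := hw.isEdgeTree
  induction n with
  | zero => exact ⟨[], IsEdgeTree.nil_mem, rfl, fun hc => absurd rfl hc⟩
  | succ n ih =>
    obtain ⟨v, hv, hlen, hve⟩ := ih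
    have c := h.isCut (n := n + 1) (by omega)
    obtain ⟨h1, h2⟩ := h.recTime_spec n
    have h3 := h.recTime_lt n
    set N := recTime C (n + 1) with hN
    -- The index `b` is the last one before `N` at the level of the previous record. It is both in
    -- the class of that record and in the face of the down-step `N - 1`, so it is the edge that
    -- joins the previous spine vertex to its black child on the spine.
    obtain ⟨b, b1, b2, b3, b4⟩ := exists_last (P := fun k => fwd C k ≤ C (recTime C n))
      (a := (recTime C n : ℤ)) (b := (N : ℤ) - 1) (by omega) (by simp [fwd_natCast])
    have hfwd : ∀ k, 0 ≤ k → k < (N : ℤ) → C (recTime C n) ≤ fwd C k := fun k hk1 hk2 =>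
      h2 k.toNat (by omega)
    have hb : fwd C b = C (recTime C n) := le_antisymm b3 (hfwd b (by omega) (by omega))
    have hbN : gluedSetoid C C' (recTime C n) b := by
      refine (hw.rel_pos _ b (by omega) b1).2 ⟨by rw [hb, fwd_natCast], fun k hk1 hk2 => ?_⟩
      rw [fwd_natCast]
      exact hfwd k (by omega) (by omega)
    -- the black child
    have hblack : ∃ j, v ++ [j] ∈ edgeVerts (predPerm (gluedSetoid C C'))
        (facePerm (gluedSetoid C C')) 0 ∧ edgeAt (predPerm (gluedSetoid C C'))
        (facePerm (gluedSetoid C C')) 0 (v ++ [j]) = (b, true) := by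
      by_cases hn : n = 0
      · subst hn
        obtain rfl : v = [] := List.length_eq_zero_iff.1 (by omega)
        exact ht.exists_black_child hv rfl (show (predPerm (gluedSetoid C C')).SameCycle _ b from by
          have := hw.sameCycle_iff.2 hbN
          simpa [recTime] using this) (by simp)
      · have c' := h.isCut hn
        refine ht.exists_black_child hv (hve hn) (hw.sameCycle_iff.2 (Setoid.trans' _ ?_ hbN))
          fun _ => by have := c'.neg; omega
        rw [← c'.predPerm_eq hw]
        exact Setoid.symm' _ (show gluedSetoid C C' _ _ from
          predPerm_mem_classOf (s := gluedSetoid C C') (recTime C n : ℤ))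
    obtain ⟨j, hj, hje⟩ := hblack
    -- the white child
    have hF : Face (fwd C) (back C') ((N : ℤ) - 1) (fwd C b - fwd C ((N : ℤ) - 1 + 1)) b := by
      refine Or.inl ⟨by omega, b2, ?_, fun k hk1 hk2 => ?_, rfl⟩
      · rw [sub_add_cancel, hb, fwd_natCast]
        exact h1.le
      · rw [hb]
        exact not_le.1 (b4 k hk1 hk2)
    have hF' : Face (fwd C) (back C') ((N : ℤ) - 1) 0 (-(cutTime C C' (n + 1) : ℤ)) := by
      rw [← c.predPerm_eq hw]
      have := hw.face_rotate_down (t := (N : ℤ) - 1) (by omega) (by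
        rw [sub_add_cancel]
        exact c.record _ (by omega) (by omega))
      rwa [sub_add_cancel] at this
    obtain ⟨i, hi, hie⟩ := ht.exists_white_child hj hje
      ((hw.sameCycle_facePerm_iff hF).2 ⟨0, hF'⟩) (by have := c.neg; omega)
    exact ⟨_, hi, by simp [hlen]; ring, fun _ => hie⟩

end IsCodingPair

/-! ### Correspondence between path segments and finite pieces of the tree -/

section Key

variable {C C' B B' : ℕ → ℤ} {n : ℕ}

theorem cutKey_eq_iff {X Y : (ℕ → ℤ) × (ℕ → ℤ)} : cutKey n X = cutKey n Y ↔
    recTime X.1 n = recTime Y.1 n ∧ cutTime X.1 X.2 n = cutTime Y.1 Y.2 n ∧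
      (∀ k ≤ recTime X.1 n, X.1 k = Y.1 k) ∧ ∀ k ≤ cutTime X.1 X.2 n, X.2 k = Y.2 k := by
  have key : ∀ {a b : ℕ} {f g : ℕ → ℤ}, (List.range (a + 1)).map f = (List.range (b + 1)).map g ↔
      a = b ∧ ∀ k ≤ a, f k = g k := by
    intro a b f g
    constructor
    · intro he
      have hl := congrArg List.length he
      simp only [List.length_map, List.length_range, add_left_inj] at hl
      subst hl
      refine ⟨rfl, fun k hk => ?_⟩
      exact List.map_inj_left.1 he k (List.mem_range.2 (by omega))
    · rintro ⟨rfl, he⟩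
      exact List.map_inj_left.2 fun k hk => he k (by have := List.mem_range.1 hk; omega)
  rw [cutKey, cutKey, Prod.mk_inj, key, key]
  tauto

/-- The initial segments of a coding pair determine the tree off the spine vertex. -/
theorem IsCodingPair.agree_of_cutKey_eq (h : IsCodingPair C C') (h' : IsCodingPair B B')
    (hn : n ≠ 0) (hk : cutKey n (C, C') = cutKey n (B, B')) {v : List ℕ}
    (hv : v ∈ edgeVerts (predPerm (gluedSetoid C C')) (facePerm (gluedSetoid C C')) 0)
    (hve : edgeAt (predPerm (gluedSetoid C C')) (facePerm (gluedSetoid C C')) 0 v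
      = (-(cutTime C C' n : ℤ), false)) {w : List ℕ}
    (hw : w ∈ PlaneTree.offVerts (edgeCount (predPerm (gluedSetoid C C'))
      (facePerm (gluedSetoid C C')) 0) v) :
    edgeCount (predPerm (gluedSetoid C C')) (facePerm (gluedSetoid C C')) 0 w
      = edgeCount (predPerm (gluedSetoid B B')) (facePerm (gluedSetoid B B')) 0 w := by
  obtain ⟨hN, hM, hC, hC'⟩ := cutKey_eq_iff.1 hk
  have c := h.isCut hn
  have c' := h'.isCut hn
  dsimp only at hN hM hC hC'
  rw [← hN, ← hM] at c'
  have hE : ∀ i : ℤ, 0 ≤ i → i ≤ (recTime C n : ℤ) → fwd C i = fwd B i := fun i hi1 hi2 =>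
    hC _ (by omega)
  have hD : ∀ i : ℤ, -(cutTime C C' n : ℤ) ≤ i → i ≤ 0 → back C' i = back B' i := fun i hi1 hi2 =>
    hC' _ (by omega)
  have hp := fun i => c.predPerm_eq_of_eqOn h.isWalkPair c' h'.isWalkPair hE hD (i := i)
  refine ((c.isEdgeCut h.isWalkPair).agree h.isWalkPair.isEdgeTree h'.isWalkPair.isEdgeTree
    (fun i hi => ?_) (fun i hi hix => ?_) hv hve (PlaneTree.offVerts_subset _ _ hw)).2.2 ?_
  · obtain ⟨h1, h2⟩ := Finset.mem_Ico.1 hi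
    exact hp (i + 1) (by omega) (by omega)
  · obtain ⟨h1, h2⟩ := Finset.mem_Ico.1 hi
    exact hp i (by omega) (by omega)
  · rintro rfl
    exact hw.2 List.prefix_rfl

/-- The tree off the spine vertex determines the initial segments of the coding pair. -/
theorem IsCodingPair.cutKey_eq_of_agree (h : IsCodingPair C C') (h' : IsCodingPair B B')
    (hn : n ≠ 0) {v : List ℕ}
    (hv : v ∈ edgeVerts (predPerm (gluedSetoid C C')) (facePerm (gluedSetoid C C')) 0)
    (hve : edgeAt (predPerm (gluedSetoid C C')) (facePerm (gluedSetoid C C')) 0 v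
      = (-(cutTime C C' n : ℤ), false))
    (hv' : v ∈ edgeVerts (predPerm (gluedSetoid B B')) (facePerm (gluedSetoid B B')) 0)
    (hve' : edgeAt (predPerm (gluedSetoid B B')) (facePerm (gluedSetoid B B')) 0 v
      = (-(cutTime B B' n : ℤ), false))
    (hcount : ∀ w ∈ PlaneTree.offVerts (edgeCount (predPerm (gluedSetoid C C'))
      (facePerm (gluedSetoid C C')) 0) v,
      edgeCount (predPerm (gluedSetoid C C')) (facePerm (gluedSetoid C C')) 0 w
        = edgeCount (predPerm (gluedSetoid B B')) (facePerm (gluedSetoid B B')) 0 w) :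
    cutKey n (C, C') = cutKey n (B, B') := by
  have c := h.isCut hn
  have c' := h'.isCut hn
  have hx := c.neg
  have hNp := c.pos
  have hv0 := (c.isEdgeCut h.isWalkPair).ne_nil hve h.isWalkPair.isEdgeTree
  obtain ⟨hN, hM, hstep⟩ := c.eq_of_agree h.isWalkPair c' h'.isWalkPair hv0
    ⟨h.isWalkPair.isEdgeTree, h'.isWalkPair.isEdgeTree, hv, hv', hve, hve', hcount⟩
  refine cutKey_eq_iff.2 ⟨by dsimp only; omega, by dsimp only; omega, fun k => ?_, fun k => ?_⟩
  · induction k with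
    | zero => exact fun _ => h.zero.trans h'.zero.symm
    | succ k ih =>
      intro hk
      dsimp only at hk ih ⊢
      have h1 := ih (by omega)
      have h2 := hstep k (by omega) (by omega)
      rw [IsWalkPair.step, IsWalkPair.step, if_pos (by omega), if_pos (by omega)] at h2
      have e : ∀ f : ℕ → ℤ, fwd f ((k : ℤ) + 1) = f (k + 1) := fun f => by
        rw [← fwd_natCast f (k + 1)]; push_cast; rfl
      rw [e, e, fwd_natCast, fwd_natCast] at h2
      omega
  · induction k with
    | zero => exact fun _ => h.zero'.trans h'.zero'.symm
    | succ k ih =>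
      intro hk
      dsimp only at hk ih ⊢
      have h1 := ih (by omega)
      have h2 := hstep (-((k + 1 : ℕ) : ℤ)) (by omega) (by omega)
      rw [IsWalkPair.step, IsWalkPair.step, if_neg (by omega), if_neg (by omega)] at h2
      have e : ∀ f : ℕ → ℤ, back f (-((k + 1 : ℕ) : ℤ) + 1) = f k := fun f => by
        rw [← back_neg_natCast f k]; congr 1; push_cast; ring
      rw [e, e, back_neg_natCast, back_neg_natCast] at h2
      omega

end Key

/-! ### Cylinders and killed walks -/

/-- The paths that coincide with `c` up to time `m`. -/
def cyl (c : ℕ → ℤ) (m : ℕ) : Set (ℕ → ℤ) := {z | ∀ i ≤ m, z i = c i}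

/-- The probability of the steps of `c` up to time `m`. -/
noncomputable def pathWeight (ν : PMF ℤ) (c : ℕ → ℤ) (m : ℕ) : ℝ≥0∞ :=
  ∏ i ∈ Finset.range m, ν (c (i + 1) - c i)

/-- The transition operator of the random walk killed when it becomes negative. -/
noncomputable def killed (ν : PMF ℤ) (f : ℕ → ℝ≥0∞) (x : ℕ) : ℝ≥0∞ :=
  ∑' y : ℕ, ν ((y : ℤ) - x) * f y

/-- The paths that stay above `b` on `[m, m + n]` and are in `A` at time `m + n`. -/
def stays (b : ℤ) (A : Set ℤ) (m n : ℕ) : Set (ℕ → ℤ) :=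
  {z | (∀ i ≤ n, b ≤ z (m + i)) ∧ z (m + n) ∈ A}

theorem measurableSet_cyl (c : ℕ → ℤ) (m : ℕ) : MeasurableSet (cyl c m) := by
  have : cyl c m = ⋂ i ∈ Set.Iic m, (fun z : ℕ → ℤ => z i) ⁻¹' {c i} := by
    ext z
    simp [cyl]
  rw [this]
  exact MeasurableSet.biInter (Set.to_countable _) fun i _ =>
    measurable_pi_apply i (MeasurableSet.singleton _)

theorem measurableSet_stays (b : ℤ) (A : Set ℤ) (m n : ℕ) : MeasurableSet (stays b A m n) := by
  have : stays b A m n = (⋂ i ∈ Set.Iic n, (fun z : ℕ → ℤ => z (m + i)) ⁻¹' Set.Ici b) ∩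
      (fun z : ℕ → ℤ => z (m + n)) ⁻¹' A := by
    ext z
    simp [stays]
  rw [this]
  exact (MeasurableSet.biInter (Set.to_countable _) fun i _ =>
    measurable_pi_apply _ measurableSet_Ici).inter (measurable_pi_apply _ (Set.to_countable A).measurableSet)

variable {ν : PMF ℤ}

theorem measurable_walk (x : ℤ) :
    Measurable fun (ξ : ℕ → ℤ) (n : ℕ) => x + ∑ i ∈ Finset.range n, ξ i := by
  fun_prop

instance (x : ℤ) : IsProbabilityMeasure (walkLaw ν x) :=
  Measure.isProbabilityMeasure_map (measurable_walk x).aemeasurable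

theorem ae_walkLaw_iff {x : ℤ} {p : (ℕ → ℤ) → Prop} (hp : MeasurableSet {z | p z}) :
    (∀ᵐ z ∂walkLaw ν x, p z) ↔ ∀ᵐ ξ ∂Measure.infinitePi fun _ : ℕ => ν.toMeasure,
      p fun n => x + ∑ i ∈ Finset.range n, ξ i :=
  ae_map_iff (measurable_walk x).aemeasurable hp

theorem walkLaw_cyl (c : ℕ → ℤ) (m : ℕ) : walkLaw ν (c 0) (cyl c m) = pathWeight ν c m := by
  rw [walkLaw, Measure.map_apply (measurable_walk _) (measurableSet_cyl c m)]
  have : (fun (ξ : ℕ → ℤ) (n : ℕ) => c 0 + ∑ i ∈ Finset.range n, ξ i) ⁻¹' cyl c m =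
      Set.pi (Finset.range m) fun i => {c (i + 1) - c i} := by
    ext ξ
    simp only [cyl, Set.mem_preimage, Set.mem_ofPred_eq, Set.mem_pi, Finset.coe_range, Set.mem_Iio,
      Set.mem_singleton_iff]
    constructor
    · intro h i hi
      have h1 := h (i + 1) hi
      have h2 := h i hi.le
      rw [Finset.sum_range_succ] at h1
      linarith
    · intro h i hi
      rw [Finset.sum_congr rfl fun j hj => h j (by have := Finset.mem_range.1 hj; omega),
        Finset.sum_range_sub]
      ring
  rw [this, Measure.infinitePi_pi]
  · exact Finset.prod_congr rfl fun i _ => PMF.toMeasure_apply_singleton _ _ (by measurability)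
  · intros
    measurability

theorem ae_walkLaw_step (hν : IsStepLaw ν) (x : ℤ) :
    ∀ᵐ z ∂walkLaw ν x, z 0 = x ∧ ∀ k, z (k + 1) - z k ≤ 1 ∧ z (k + 1) ≠ z k := by
  refine (ae_walkLaw_iff ?_).2 ?_
  · have e : {z : ℕ → ℤ | z 0 = x ∧ ∀ k, z (k + 1) - z k ≤ 1 ∧ z (k + 1) ≠ z k} =
        (fun z : ℕ → ℤ => z 0) ⁻¹' {x} ∩
          ⋂ k, (fun z : ℕ → ℤ => z (k + 1) - z k) ⁻¹' {a | a ≤ 1 ∧ a ≠ 0} := by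
      ext z
      simp [sub_eq_zero]
    rw [e]
    refine (measurable_pi_apply _ (Set.to_countable _).measurableSet).inter
      (MeasurableSet.iInter fun k => ?_)
    have : Measurable fun z : ℕ → ℤ => z (k + 1) - z k := by fun_prop
    exact this (Set.to_countable _).measurableSet
  · have key : ∀ i : ℕ, ∀ᵐ ξ ∂Measure.infinitePi fun _ : ℕ => ν.toMeasure, ν (ξ i) ≠ 0 := by
      intro i
      have h1 : ∀ᵐ a ∂ν.toMeasure, ν a ≠ 0 := by
        have h2 : ν.toMeasure {a | ¬ ν a ≠ 0} = 0 := by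
          rw [PMF.toMeasure_apply_eq_zero_iff _ (Set.to_countable _).measurableSet, Set.disjoint_left]
          intro a ha hc
          exact (PMF.mem_support_iff _ _).1 ha (not_not.1 hc)
        exact h2
      exact (measurePreserving_eval_infinitePi (fun _ : ℕ => ν.toMeasure) i).quasiMeasurePreserving.ae h1
    filter_upwards [ae_all_iff.2 key] with ξ hξ
    refine ⟨by simp, fun k => ?_⟩
    have e : x + ∑ i ∈ Finset.range (k + 1), ξ i - (x + ∑ i ∈ Finset.range k, ξ i) = ξ k := by
      rw [Finset.sum_range_succ]
      ring
    refine ⟨?_, fun hc => ?_⟩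
    · rw [e]
      by_contra! hc
      exact hξ k (hν.eq_zero_of_one_lt _ hc)
    · rw [← sub_eq_zero, e] at hc
      exact hξ k (hc ▸ hν.apply_zero)

/-- A walk that follows `c` and then stays above `b`. -/
theorem measure_cyl_inter_stays {μ : Measure (ℕ → ℤ)} {ok : ℤ → Prop} {g : ℤ → ℝ≥0∞} {b : ℤ}
    (hb : ∀ y, b ≤ y → ok y)
    (hμ : ∀ (m : ℕ) (c : ℕ → ℤ), c 0 = 0 → (∀ i ≤ m, ok (c i)) →
      μ (cyl c m) = pathWeight ν c m * g (c m)) (A : Set ℤ) (n : ℕ) :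
    ∀ (m : ℕ) (c : ℕ → ℤ) (x : ℕ), c 0 = 0 → (∀ i ≤ m, ok (c i)) → c m = b + x →
      μ (cyl c m ∩ stays b A m n) =
        pathWeight ν c m * ((killed ν)^[n] fun y => A.indicator g (b + y)) x := by
  -- One conditions on the value `b + y` at the next time, and the sum over `y` is `killed`. The
  -- predicate `ok` delimits the paths for which `hμ` is available: the nonnegative ones for the
  -- conditioned walk, all of them for the free walk.
  induction n with
  | zero =>
    intro m c x h0 hc hx
    simp only [Function.iterate_zero, id_eq]
    by_cases hA : c m ∈ A
    · rw [Set.indicator_of_mem (by rwa [← hx]), ← hx, ← hμ m c h0 hc, Set.inter_eq_left.2]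
      intro z hz
      have := hz m le_rfl
      refine ⟨fun i hi => ?_, ?_⟩
      · obtain rfl := Nat.le_zero.1 hi
        rw [add_zero, this, hx]
        omega
      · rwa [add_zero, this]
    · rw [Set.indicator_of_notMem (by rwa [← hx]), mul_zero, Set.eq_empty_of_forall_notMem
        (s := cyl c m ∩ stays b A m 0), measure_empty]
      rintro z ⟨hz, hz'⟩
      have := hz'.2
      rw [add_zero, hz m le_rfl] at this
      exact hA this
  | succ n ih =>
    intro m c x h0 hc hx
    have hU : ∀ y : ℕ, ∀ i ≤ m, Function.update c (m + 1) (b + y) i = c i := fun y i hi =>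
      Function.update_of_ne (by omega) _ _
    have hU' : ∀ y : ℕ, Function.update c (m + 1) (b + y) (m + 1) = b + y := fun y =>
      Function.update_self ..
    have hset : cyl c m ∩ stays b A m (n + 1) =
        ⋃ y : ℕ, cyl (Function.update c (m + 1) (b + y)) (m + 1) ∩ stays b A (m + 1) n := by
      ext z
      simp only [Set.mem_iUnion, Set.mem_inter_iff]
      constructor
      · rintro ⟨hz, hz1, hz2⟩
        have h1 := hz1 1 (by omega)
        refine ⟨(z (m + 1) - b).toNat, fun i hi => ?_, fun i hi => ?_, ?_⟩
        · rcases Nat.le_succ_iff.1 hi with hi | rfl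
          · rw [hU _ i hi, hz i hi]
          · rw [hU', Int.toNat_of_nonneg (by omega)]
            ring
        · rw [add_assoc, add_comm 1 i]
          exact hz1 _ (by omega)
        · rwa [add_assoc, add_comm 1 n]
      · rintro ⟨y, hz, hz1, hz2⟩
        refine ⟨fun i hi => by rw [hz i (by omega), hU y i hi], fun i hi => ?_, ?_⟩
        · rcases i with _ | i
          · rw [add_zero, hz m (by omega), hU y m le_rfl, hx]
            omega
          · have := hz1 i (by omega)
            rwa [add_assoc, add_comm 1 i] at this
        · rwa [add_assoc, add_comm 1 n] at hz2
    rw [hset, measure_iUnion]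
    · have step : ∀ y : ℕ, μ (cyl (Function.update c (m + 1) (b + y)) (m + 1) ∩
          stays b A (m + 1) n) = pathWeight ν c m * (ν ((y : ℤ) - x) *
            ((killed ν)^[n] fun y => A.indicator g (b + y)) y) := by
        intro y
        rw [ih (m + 1) _ y (by rw [hU y 0 (by omega), h0]) _ (hU' y), pathWeight,
          Finset.prod_range_succ, hU', hU y m le_rfl, hx, ← mul_assoc]
        · congr 2
          · exact Finset.prod_congr rfl fun i hi => by
              have := Finset.mem_range.1 hi
              rw [hU y i (by omega), hU y (i + 1) (by omega)]
          · congr 1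
            ring
        · intro i hi
          rcases Nat.le_succ_iff.1 hi with hi | rfl
          · rw [hU y i hi]
            exact hc i hi
          · rw [hU']
            exact hb _ (by omega)
      simp_rw [step]
      rw [ENNReal.tsum_mul_left, Function.iterate_succ_apply']
      rfl
    · intro y y' hyy'
      refine Set.disjoint_left.2 ?_
      rintro z ⟨hz, -⟩ ⟨hz', -⟩
      have h1 := hz (m + 1) le_rfl
      have h2 := hz' (m + 1) le_rfl
      rw [hU'] at h1 h2
      omega
    · exact fun y => (measurableSet_cyl _ _).inter (measurableSet_stays _ _ _ _)

/-! ### The killed transition operator -/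

theorem killed_mono {f g : ℕ → ℝ≥0∞} (h : f ≤ g) : killed ν f ≤ killed ν g := fun _ =>
  ENNReal.tsum_le_tsum fun y => by gcongr; exact h y

theorem killed_add (f g : ℕ → ℝ≥0∞) : killed ν (f + g) = killed ν f + killed ν g := by
  ext x
  simp only [killed, Pi.add_apply, mul_add]
  exact ENNReal.tsum_add

theorem killed_smul (a : ℝ≥0∞) (f : ℕ → ℝ≥0∞) :
    killed ν (fun y => a * f y) = fun y => a * killed ν f y := by
  ext x
  simp only [killed]
  rw [← ENNReal.tsum_mul_left]
  exact tsum_congr fun y => by ring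

theorem iterate_killed_mono {f g : ℕ → ℝ≥0∞} (h : f ≤ g) (n : ℕ) :
    (killed ν)^[n] f ≤ (killed ν)^[n] g :=
  Monotone.iterate (fun _ _ h => killed_mono h) n h

theorem iterate_killed_add (f g : ℕ → ℝ≥0∞) (n : ℕ) :
    (killed ν)^[n] (f + g) = (killed ν)^[n] f + (killed ν)^[n] g := by
  induction n with
  | zero => rfl
  | succ n ih => simp only [Function.iterate_succ_apply', ih, killed_add]

theorem iterate_killed_smul (a : ℝ≥0∞) (f : ℕ → ℝ≥0∞) (n : ℕ) :
    (killed ν)^[n] (fun y => a * f y) = fun y => a * (killed ν)^[n] f y := by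
  induction n with
  | zero => rfl
  | succ n ih => simp only [Function.iterate_succ_apply', ih, killed_smul]

theorem killed_one_le : killed ν 1 ≤ 1 := by
  intro x
  simp only [killed, Pi.one_apply, mul_one]
  have hinj : Function.Injective fun y : ℕ => (y : ℤ) - x := fun y y' h => by
    simpa using h
  calc ∑' y : ℕ, ν ((y : ℤ) - x) ≤ ∑' k : ℤ, ν k := ENNReal.tsum_comp_le_tsum_of_injective hinj ν
    _ = 1 := ν.tsum_coe

theorem iterate_killed_one_antitone : Antitone fun n => (killed ν)^[n] 1 :=
  antitone_nat_of_succ_le fun n => by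
    rw [Function.iterate_succ_apply]
    exact iterate_killed_mono killed_one_le n

theorem iterate_killed_one_le (n : ℕ) : (killed ν)^[n] 1 ≤ 1 :=
  iterate_killed_one_antitone (Nat.zero_le n)

/-- Skip-freeness leaves finitely many targets. Hence pointwise limits pass through `killed`, and
for harmonic functions the value at `x + 1` is determined by the previous ones. -/
theorem killed_eq_sum (hν : IsStepLaw ν) (f : ℕ → ℝ≥0∞) (x : ℕ) :
    killed ν f x = ν 1 * f (x + 1) + ∑ k ∈ Finset.range (x + 1), ν (-(k : ℤ)) * f (x - k) := by
  rw [killed, tsum_eq_sum (s := Finset.range (x + 2)) fun y hy => by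
    rw [hν.eq_zero_of_one_lt _ (by have := Finset.mem_range.not.1 hy; omega), zero_mul],
    Finset.sum_range_succ, add_comm]
  congr 1
  · push_cast
    rw [add_sub_cancel_left]
  · rw [← Finset.sum_range_reflect]
    refine Finset.sum_congr rfl fun k hk => ?_
    have := Finset.mem_range.1 hk
    rw [show x + 1 - 1 - k = x - k by omega]
    congr 2
    omega

/-! ### Harmonic functions of the killed walk -/

/-- `W` is a harmonic function, normalized at `0`, of the walk killed when it becomes negative,
where `a` is the probability of the step `1` and `q k` that of the step `-k`. -/
structure IsHarmonic (a : ℝ) (q : ℕ → ℝ) (W : ℕ → ℝ) : Prop where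
  pos : 0 < a
  nonneg : ∀ k, 0 ≤ q k
  sum : HasSum q (1 - a)
  mean : HasSum (fun k : ℕ => (k : ℝ) * q k) a
  zero : W 0 = 1
  eq : ∀ x, W x = a * W (x + 1) + ∑ k ∈ Finset.range (x + 1), q k * W (x - k)

/-- The extension of a function on `ℕ` to `ℤ` by `0`. -/
def zeroExtend (W : ℕ → ℝ) (z : ℤ) : ℝ := if z < 0 then 0 else W z.toNat

theorem zeroExtend_natCast (W : ℕ → ℝ) (x : ℕ) : zeroExtend W x = W x := by simp [zeroExtend]

theorem zeroExtend_of_neg (W : ℕ → ℝ) {z : ℤ} (hz : z < 0) : zeroExtend W z = 0 := by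
  simp [zeroExtend, hz]

namespace IsHarmonic

variable {a : ℝ} {q W : ℕ → ℝ}

theorem hasSum (h : IsHarmonic a q W) (x : ℕ) :
    HasSum (fun k : ℕ => q k * (W x - zeroExtend W (x - k))) (a * (W (x + 1) - W x)) := by
  have h1 := h.sum.mul_right (W x)
  have h2 : HasSum (fun k : ℕ => q k * zeroExtend W ((x : ℤ) - k))
      (∑ k ∈ Finset.range (x + 1), q k * W (x - k)) := by
    have e : ∑ k ∈ Finset.range (x + 1), q k * W (x - k) =
        ∑ k ∈ Finset.range (x + 1), q k * zeroExtend W ((x : ℤ) - k) :=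
      Finset.sum_congr rfl fun k hk => by
        rw [← zeroExtend_natCast W (x - k),
          Nat.cast_sub (by have := Finset.mem_range.1 hk; omega)]
    rw [e]
    refine hasSum_sum_of_ne_finset_zero fun k hk => ?_
    rw [zeroExtend_of_neg W (by have := Finset.mem_range.not.1 hk; omega), mul_zero]
  have h3 := h1.sub h2
  have h4 := h.eq x
  simp only [mul_sub]
  rw [show a * W (x + 1) - a * W x =
    (1 - a) * W x - ∑ k ∈ Finset.range (x + 1), q k * W (x - k) by linarith]
  exact h3

/-- By `hasSum`, `a` times the new increment is the sum of `q k (W x - W (x - k))`. By strong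
induction each difference is between `0` and `k`, and centering, in the form `∑ k q k = a`, bounds
the increment by `1`. -/
theorem sub_mem (h : IsHarmonic a q W) (x : ℕ) :
    0 ≤ zeroExtend W x - zeroExtend W (x - 1) ∧ zeroExtend W x - zeroExtend W (x - 1) ≤ 1 := by
  induction x using Nat.strong_induction_on with
  | _ x ih =>
    rcases x with _ | x
    · rw [zeroExtend_natCast, h.zero, zeroExtend_of_neg W (by simp)]
      norm_num
    · have key : ∀ k : ℕ, 0 ≤ W x - zeroExtend W (x - k) ∧ W x - zeroExtend W (x - k) ≤ k := by
        intro k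
        induction k with
        | zero => simp [zeroExtend_natCast]
        | succ k ihk =>
          have h1 : 0 ≤ zeroExtend W (x - k) - zeroExtend W (x - (k + 1 : ℕ)) ∧
              zeroExtend W (x - k) - zeroExtend W (x - (k + 1 : ℕ)) ≤ 1 := by
            rcases le_or_gt k x with hk | hk
            · have := ih (x - k) (by omega)
              rw [Nat.cast_sub hk] at this
              convert this using 4 <;> push_cast <;> ring
            · rw [zeroExtend_of_neg W (by omega), zeroExtend_of_neg W (by omega)]
              norm_num
          push_cast at h1 ⊢
          constructor <;> linarith [ihk.1, ihk.2, h1.1, h1.2]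
      have hs := h.hasSum x
      have h1 : 0 ≤ a * (W (x + 1) - W x) := hs.nonneg fun k => mul_nonneg (h.nonneg k) (key k).1
      have h2 : a * (W (x + 1) - W x) ≤ a := hasSum_le (fun k => by
        rw [mul_comm (k : ℝ)]
        exact mul_le_mul_of_nonneg_left (key k).2 (h.nonneg k)) hs h.mean
      have ha := h.pos
      rw [zeroExtend_natCast, show ((x + 1 : ℕ) : ℤ) - 1 = (x : ℤ) by push_cast; ring,
        zeroExtend_natCast]
      exact ⟨by nlinarith, by nlinarith⟩

theorem zeroExtend_mono (h : IsHarmonic a q W) : Monotone (zeroExtend W) := by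
  refine monotone_int_of_le_succ fun z => ?_
  rcases lt_or_ge z (-1) with hz | hz
  · rw [zeroExtend_of_neg W (by omega), zeroExtend_of_neg W (by omega)]
  · have := (h.sub_mem (z + 1).toNat).1
    rw [Int.toNat_of_nonneg (by omega), add_sub_cancel_right] at this
    linarith

theorem mono (h : IsHarmonic a q W) : Monotone W := fun x y hxy => by
  rw [← zeroExtend_natCast W x, ← zeroExtend_natCast W y]
  exact h.zeroExtend_mono (by exact_mod_cast hxy)

theorem le_add (h : IsHarmonic a q W) (x k : ℕ) : W (x + k) ≤ W x + k := by
  induction k with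
  | zero => simp
  | succ k ih =>
    have := (h.sub_mem (x + (k + 1))).2
    rw [show ((x + (k + 1) : ℕ) : ℤ) - 1 = (x + k : ℕ) by push_cast; ring, zeroExtend_natCast,
      zeroExtend_natCast] at this
    push_cast
    linarith

/-- Summing the increment identity over `x ≤ Z` and telescoping in `x` gives `a (W (Z + 1) - 1) = ∑
q k ∑_{j < k} W (Z - j)`. If the supremum `L` were finite, monotonicity and `∑ k q k = a` would
yield `a L ≤ a (L - 1)`. -/
theorem not_bddAbove (h : IsHarmonic a q W) : ¬ BddAbove (Set.range W) := by
  intro hb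
  have ha := h.pos
  have hsum : ∀ Z : ℕ, HasSum
      (fun k : ℕ => q k * ∑ x ∈ Finset.range (Z + 1), (W x - zeroExtend W (x - k)))
      (a * (W (Z + 1) - 1)) := by
    intro Z
    have h1 := hasSum_sum fun x (_ : x ∈ Finset.range (Z + 1)) => h.hasSum x
    rw [← Finset.mul_sum, Finset.sum_range_sub, h.zero] at h1
    simpa only [Finset.mul_sum] using h1
  have hnn : ∀ x k : ℕ, 0 ≤ W x - zeroExtend W (x - k) := fun x k => by
    rw [← zeroExtend_natCast W x]
    linarith [h.zeroExtend_mono (show (x : ℤ) - k ≤ x by omega)]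
  have hlow : ∀ Z k : ℕ, k * zeroExtend W (Z + 1 - k) ≤
      ∑ x ∈ Finset.range (Z + 1), (W x - zeroExtend W (x - k)) := by
    intro Z k
    have htel : ∑ x ∈ Finset.range (Z + 1), (W x - zeroExtend W (x - k)) =
        ∑ j ∈ Finset.range k, zeroExtend W (Z - j) := by
      induction k with
      | zero => simp [zeroExtend_natCast]
      | succ k ih =>
        rw [Finset.sum_range_succ (fun j : ℕ => zeroExtend W ((Z : ℤ) - j)), ← ih, ← sub_eq_iff_eq_add', ← Finset.sum_sub_distrib]
        have : ∀ x : ℕ, W x - zeroExtend W (x - (k + 1 : ℕ)) - (W x - zeroExtend W (x - k)) =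
            zeroExtend W ((x + 1 : ℕ) - (k + 1 : ℕ)) - zeroExtend W (x - (k + 1 : ℕ)) := by
          intro x
          rw [show ((x + 1 : ℕ) : ℤ) - (k + 1 : ℕ) = x - k by push_cast; ring]
          ring
        simp_rw [this]
        rw [Finset.sum_range_sub (fun x : ℕ => zeroExtend W (x - (k + 1 : ℕ))),
          zeroExtend_of_neg W (z := ((0 : ℕ) : ℤ) - (k + 1 : ℕ)) (by omega), sub_zero]
        congr 1
        push_cast
        ring
    rw [htel, ← nsmul_eq_mul]
    have := Finset.card_nsmul_le_sum (Finset.range k) (fun j => zeroExtend W ((Z : ℤ) - j))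
      (zeroExtend W (Z + 1 - k)) fun j hj => h.zeroExtend_mono (by
        have := Finset.mem_range.1 hj; omega)
    simpa using this
  set L := sSup (Set.range W) with hL
  have hle : ∀ x, W x ≤ L := fun x => le_csSup hb ⟨x, rfl⟩
  -- The sum is truncated at `K`, with `Z = z + K` so that `Z + 1 - k ≥ z` for all `k < K`.
  have h1 : ∀ z K : ℕ, (∑ k ∈ Finset.range K, (k : ℝ) * q k) * W z ≤ a * (L - 1) := by
    intro z K
    have h2 := sum_le_hasSum (Finset.range K) (fun k _ => mul_nonneg (h.nonneg k)
      (Finset.sum_nonneg fun x _ => hnn x k)) (hsum (z + K))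
    have h3 : a * (W (z + K + 1) - 1) ≤ a * (L - 1) := by
      have := hle (z + K + 1)
      gcongr
    refine le_trans ?_ (h2.trans h3)
    rw [Finset.sum_mul]
    refine Finset.sum_le_sum fun k hk => ?_
    have h4 := hlow (z + K) k
    have h5 : W z ≤ zeroExtend W ((z + K : ℕ) + 1 - k) := by
      rw [← zeroExtend_natCast W z]
      exact h.zeroExtend_mono (by have := Finset.mem_range.1 hk; push_cast; omega)
    have h6 : (k : ℝ) * W z ≤ k * zeroExtend W ((z + K : ℕ) + 1 - k) :=
      mul_le_mul_of_nonneg_left h5 (Nat.cast_nonneg k)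
    calc (k : ℝ) * q k * W z = q k * (k * W z) := by ring
      _ ≤ _ := mul_le_mul_of_nonneg_left (h6.trans h4) (h.nonneg k)
  have h2 : ∀ z, W z ≤ L - 1 := by
    intro z
    have h3 : a * W z ≤ a * (L - 1) :=
      le_of_tendsto (h.mean.tendsto_sum_nat.mul_const (W z)) (Filter.Eventually.of_forall (h1 z))
    exact le_of_mul_le_mul_left h3 ha
  have h3 : L ≤ L - 1 := csSup_le ⟨W 0, 0, rfl⟩ (by rintro _ ⟨z, rfl⟩; exact h2 z)
  linarith

/-- As `a ≠ 0`, the equation at `x` gives `u (x + 1)` in terms of the earlier values, so the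
solutions form a line. -/
theorem eq_mul (h : IsHarmonic a q W) {u : ℕ → ℝ}
    (hu : ∀ x, u x = a * u (x + 1) + ∑ k ∈ Finset.range (x + 1), q k * u (x - k)) (x : ℕ) :
    u x = u 0 * W x := by
  induction x using Nat.strong_induction_on with
  | _ x ih =>
    rcases x with _ | x
    · rw [h.zero, mul_one]
    · have h1 := hu x
      have h2 := h.eq x
      rw [ih x (by omega), Finset.sum_congr rfl fun k _ => by rw [ih (x - k) (by omega)]] at h1
      have h3 : a * u (x + 1) = a * (u 0 * W (x + 1)) := by
        have : ∑ k ∈ Finset.range (x + 1), q k * (u 0 * W (x - k)) =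
            u 0 * ∑ k ∈ Finset.range (x + 1), q k * W (x - k) := by
          rw [Finset.mul_sum]
          exact Finset.sum_congr rfl fun k _ => by ring
        rw [this] at h1
        rw [h2] at h1
        linarith
      exact mul_left_cancel₀ h.pos.ne' h3

/-- There is no nonzero bounded harmonic function. -/
theorem eq_zero_of_bounded (h : IsHarmonic a q W) {u : ℕ → ℝ}
    (hu : ∀ x, u x = a * u (x + 1) + ∑ k ∈ Finset.range (x + 1), q k * u (x - k))
    (hu0 : ∀ x, 0 ≤ u x) (hu1 : ∀ x, u x ≤ 1) (x : ℕ) : u x = 0 := by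
  have h0 : u 0 = 0 := by
    by_contra hne
    have hpos : 0 < u 0 := lt_of_le_of_ne (hu0 0) (Ne.symm hne)
    refine h.not_bddAbove ⟨1 / u 0, ?_⟩
    rintro _ ⟨z, rfl⟩
    rw [le_div_iff₀ hpos, mul_comm, ← h.eq_mul hu]
    exact hu1 z
  rw [h.eq_mul hu, h0, zero_mul]

end IsHarmonic

section Killed

variable {ν : PMF ℤ}

theorem IsStepLaw.summable (hν : IsStepLaw ν) : Summable fun k : ℕ => (k : ℝ) * (ν (-(k : ℤ))).toReal := by
  have hinj : Function.Injective fun k : ℕ => -(k : ℤ) := fun x y h => by simpa using h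
  have := (hν.centered.summable.comp_injective hinj).neg
  refine this.congr fun k => ?_
  simp

/-- The only positive step is `1`, so centering equates `ν 1` with the mean size of the down-steps.
-/
theorem IsStepLaw.hasSum_mean (hν : IsStepLaw ν) :
    HasSum (fun k : ℕ => (k : ℝ) * (ν (-(k : ℤ))).toReal) (ν 1).toReal := by
  have hs := hν.summable
  have h1 := hs.hasSum
  have h2 := ((hasSum_nat_add_iff' 1).2 h1).neg
  have h3 : HasSum (fun n : ℕ => ((n : ℤ) : ℝ) * (ν (n : ℤ)).toReal) (ν 1).toReal := by
    have := hasSum_single (f := fun n : ℕ => ((n : ℤ) : ℝ) * (ν (n : ℤ)).toReal) 1 fun n hn => by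
      rcases Nat.eq_zero_or_pos n with rfl | hn'
      · simp
      · rw [hν.eq_zero_of_one_lt _ (by omega)]
        simp
    simpa using this
  have h4 := h3.of_nat_of_neg_add_one (f := fun k : ℤ => (k : ℝ) * (ν k).toReal)
    (m' := -(∑' k : ℕ, (k : ℝ) * (ν (-(k : ℤ))).toReal)) (by
      simp only [Finset.range_one, Finset.sum_singleton, Nat.cast_zero, zero_mul, sub_zero] at h2
      refine h2.congr_fun fun k => ?_
      rw [← neg_mul]
      push_cast
      rfl)
  have h5 := h4.unique hν.centered
  rw [show (ν 1).toReal = ∑' k : ℕ, (k : ℝ) * (ν (-(k : ℤ))).toReal by linarith]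
  exact h1

theorem IsStepLaw.hasSum_neg (hν : IsStepLaw ν) :
    HasSum (fun k : ℕ => (ν (-(k : ℤ))).toReal) (1 - (ν 1).toReal) := by
  have h1 := hν.tsum_neg
  have h2 : Summable fun k : ℕ => (ν (-(k : ℤ))).toReal := ENNReal.summable_toReal (by
    rw [h1]
    exact ENNReal.sub_ne_top ENNReal.one_ne_top)
  have h3 := h2.hasSum
  rwa [← ENNReal.tsum_toReal_eq (fun k => ν.apply_ne_top _), h1,
    ENNReal.toReal_sub_of_le (ν.coe_le_one 1) ENNReal.one_ne_top, ENNReal.toReal_one] at h3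

theorem toReal_of_killed_eq (hν : IsStepLaw ν) {f : ℕ → ℝ≥0∞} (hf : ∀ x, f x ≠ ∞)
    (h : killed ν f = f) (x : ℕ) : (f x).toReal = (ν 1).toReal * (f (x + 1)).toReal +
      ∑ k ∈ Finset.range (x + 1), (ν (-(k : ℤ))).toReal * (f (x - k)).toReal := by
  conv_lhs => rw [← h, killed_eq_sum hν]
  rw [ENNReal.toReal_add (ENNReal.mul_ne_top (ν.apply_ne_top _) (hf _))
    (ENNReal.sum_ne_top.2 fun k _ => ENNReal.mul_ne_top (ν.apply_ne_top _) (hf _)),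
    ENNReal.toReal_sum fun k _ => ENNReal.mul_ne_top (ν.apply_ne_top _) (hf _)]
  simp [ENNReal.toReal_mul]

theorem isHarmonic_of_killed_eq (hν : IsStepLaw ν) {W : ℕ → ℝ≥0∞} (hf : ∀ x, W x ≠ ∞)
    (h : killed ν W = W) (h0 : W 0 = 1) :
    IsHarmonic (ν 1).toReal (fun k => (ν (-(k : ℤ))).toReal) fun x => (W x).toReal where
  pos := ENNReal.toReal_pos hν.apply_one_ne_zero (ν.apply_ne_top 1)
  nonneg _ := ENNReal.toReal_nonneg
  sum := hν.hasSum_neg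
  mean := hν.hasSum_mean
  zero := by rw [h0, ENNReal.toReal_one]
  eq := toReal_of_killed_eq hν hf h

/-- The walk killed when it becomes negative is eventually killed. -/
theorem tendsto_iterate_killed_one (hν : IsStepLaw ν) {W : ℕ → ℝ≥0∞} (hf : ∀ x, W x ≠ ∞)
    (h : killed ν W = W) (h0 : W 0 = 1) (x : ℕ) :
    Filter.Tendsto (fun n => (killed ν)^[n] 1 x) Filter.atTop (nhds 0) := by
  -- The survival probability `u` is a decreasing limit of iterates, hence a fixed point of `killed`
  -- with values in `[0, 1]`, hence zero.
  set u : ℕ → ℝ≥0∞ := fun x => ⨅ n, (killed ν)^[n] 1 x with hu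
  have ht : ∀ x, Filter.Tendsto (fun n => (killed ν)^[n] 1 x) Filter.atTop (nhds (u x)) := fun x =>
    tendsto_atTop_iInf fun _ _ hmn => iterate_killed_one_antitone hmn x
  have hu1 : ∀ x, u x ≤ 1 := fun x => (iInf_le _ 0).trans le_rfl
  have hut : ∀ x, u x ≠ ∞ := fun x => ne_top_of_le_ne_top ENNReal.one_ne_top (hu1 x)
  have hku : killed ν u = u := by
    ext x
    refine tendsto_nhds_unique ?_ ((ht x).comp (Filter.tendsto_add_atTop_nat 1))
    have h1 : ∀ n, ((fun n => (killed ν)^[n] 1 x) ∘ fun n => n + 1) n =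
        ν 1 * (killed ν)^[n] 1 (x + 1) +
          ∑ k ∈ Finset.range (x + 1), ν (-(k : ℤ)) * (killed ν)^[n] 1 (x - k) := fun n => by
      rw [Function.comp_apply, Function.iterate_succ_apply', killed_eq_sum hν]
    rw [killed_eq_sum hν]
    refine Filter.Tendsto.congr (fun n => (h1 n).symm) ?_
    refine (ENNReal.Tendsto.const_mul (ht _) (Or.inr (ν.apply_ne_top _))).add
      (tendsto_finsetSum _ fun k _ =>
        ENNReal.Tendsto.const_mul (ht _) (Or.inr (ν.apply_ne_top _)))
  have hz := (isHarmonic_of_killed_eq hν hf h h0).eq_zero_of_bounded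
    (toReal_of_killed_eq hν hut hku) (fun _ => ENNReal.toReal_nonneg)
    (fun x => ENNReal.toReal_mono ENNReal.one_ne_top (hu1 x)) x
  have := ht x
  rwa [((ENNReal.toReal_eq_zero_iff _).1 hz).resolve_right (hut x)] at this

end Killed

/-! ### The walk conditioned to stay nonnegative -/

/-- The renewal function normalized at `0`. -/
noncomputable def normRenewal (ν : PMF ℤ) (x : ℤ) : ℝ≥0∞ := (renewal ν 0)⁻¹ * renewal ν x

variable {ν : PMF ℤ} {Q : Measure (ℕ → ℤ)}

theorem measurable_restrictFin (k : ℕ) : Measurable fun (z : ℕ → ℤ) (i : Fin (k + 1)) => z i :=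
  measurable_pi_iff.2 fun _ => measurable_pi_apply _

theorem pathWeight_ne_top (c : ℕ → ℤ) (m : ℕ) : pathWeight ν c m ≠ ∞ :=
  ENNReal.prod_ne_top fun _ _ => ν.apply_ne_top _

namespace IsConditionedWalkLaw

/-- The transform formula is applied to the indicator of failure of `p`. Whatever the free walk
satisfies while it is nonnegative passes to `Q`. -/
theorem ae_of_ae_walkLaw (hQ : IsConditionedWalkLaw ν 0 Q) {k : ℕ} {p : (Fin (k + 1) → ℤ) → Prop}
    (h : ∀ᵐ z ∂walkLaw ν 0, (∀ i ≤ k, 0 ≤ z i) → p fun i => z i) :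
    ∀ᵐ z ∂Q, p fun i => z i := by
  have h1 := hQ k (Set.indicator {r | ¬ p r} 1)
  have h2 : ∀ᵐ z ∂walkLaw ν 0, (if ∀ i ≤ k, 0 ≤ z i then
      renewal ν (z k) * Set.indicator {r | ¬ p r} 1 (fun i : Fin (k + 1) => z i) else 0) = 0 := by
    filter_upwards [h] with z hz
    split_ifs with hc
    · rw [Set.indicator_of_notMem (not_not.2 (hz hc)), mul_zero]
    · rfl
  rw [lintegral_congr_ae h2, lintegral_zero, mul_zero] at h1
  have h3 : (fun z : ℕ → ℤ => Set.indicator {r | ¬ p r} (1 : (Fin (k + 1) → ℤ) → ℝ≥0∞)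
      fun i : Fin (k + 1) => z i) = Set.indicator ((fun (z : ℕ → ℤ) (i : Fin (k + 1)) => z i) ⁻¹'
        {r | ¬ p r}) 1 := rfl
  rwa [h3, lintegral_indicator_one (measurable_restrictFin k (Set.to_countable _).measurableSet)]
    at h1

theorem ae_nonneg (hQ : IsConditionedWalkLaw ν 0 Q) : ∀ᵐ z ∂Q, ∀ k, 0 ≤ z k :=
  ae_all_iff.2 fun k => hQ.ae_of_ae_walkLaw (k := k) (p := fun r => 0 ≤ r (Fin.last k))
    (Filter.Eventually.of_forall fun z hz => by simpa using hz k le_rfl)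

theorem ae_zero (hν : IsStepLaw ν) (hQ : IsConditionedWalkLaw ν 0 Q) : ∀ᵐ z ∂Q, z 0 = 0 := by
  refine hQ.ae_of_ae_walkLaw (k := 0) (p := fun r => r 0 = 0) ?_
  filter_upwards [ae_walkLaw_step hν 0] with z hz _
  exact hz.1

theorem ae_step (hν : IsStepLaw ν) (hQ : IsConditionedWalkLaw ν 0 Q) :
    ∀ᵐ z ∂Q, ∀ k, z (k + 1) - z k ≤ 1 ∧ z (k + 1) ≠ z k := by
  refine ae_all_iff.2 fun k => ?_
  have h := hQ.ae_of_ae_walkLaw (k := k + 1) (p := fun r =>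
    r (Fin.last (k + 1)) - r (Fin.last k).castSucc ≤ 1 ∧
      r (Fin.last (k + 1)) ≠ r (Fin.last k).castSucc) (by
    filter_upwards [ae_walkLaw_step hν 0] with z hz _
    simpa using hz.2 k)
  simpa using h

theorem measure_cyl (hQ : IsConditionedWalkLaw ν 0 Q) (m : ℕ) (c : ℕ → ℤ) (h0 : c 0 = 0)
    (hc : ∀ i ≤ m, 0 ≤ c i) : Q (cyl c m) = pathWeight ν c m * normRenewal ν (c m) := by
  have h1 := hQ m (Set.indicator {fun i : Fin (m + 1) => c i} 1)
  have hpre : ∀ z : ℕ → ℤ, (fun i : Fin (m + 1) => z i) = (fun i : Fin (m + 1) => c i) ↔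
      z ∈ cyl c m := by
    intro z
    rw [funext_iff]
    exact ⟨fun h i hi => h ⟨i, by omega⟩, fun h i => h i (by have := i.2; omega)⟩
  have h2 : (fun z : ℕ → ℤ => Set.indicator {fun i : Fin (m + 1) => c i}
      (1 : (Fin (m + 1) → ℤ) → ℝ≥0∞) fun i : Fin (m + 1) => z i) = (cyl c m).indicator 1 := by
    ext z
    by_cases hz : z ∈ cyl c m
    · rw [Set.indicator_of_mem hz, Set.indicator_of_mem (Set.mem_singleton_iff.2 ((hpre z).2 hz))]
      rfl
    · rw [Set.indicator_of_notMem hz, Set.indicator_of_notMem fun h => hz ((hpre z).1 (Set.mem_singleton_iff.1 h))]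
  have h3 : (fun z : ℕ → ℤ => if ∀ i ≤ m, 0 ≤ z i then renewal ν (z m) *
      Set.indicator {fun i : Fin (m + 1) => c i} 1 (fun i : Fin (m + 1) => z i) else 0) =
        (cyl c m).indicator fun _ => renewal ν (c m) := by
    ext z
    by_cases hz : z ∈ cyl c m
    · rw [Set.indicator_of_mem hz, Set.indicator_of_mem (Set.mem_singleton_iff.2 ((hpre z).2 hz)), if_pos, hz m le_rfl]
      · simp
      · intro i hi
        rw [hz i hi]
        exact hc i hi
    · rw [Set.indicator_of_notMem hz, Set.indicator_of_notMem fun h => hz ((hpre z).1 (Set.mem_singleton_iff.1 h))]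
      simp
  rw [h2, h3, lintegral_indicator_one (measurableSet_cyl c m),
    lintegral_indicator_const (measurableSet_cyl c m)] at h1
  have h4 := walkLaw_cyl (ν := ν) c m
  rw [h0] at h4
  rw [h1, h4, normRenewal]
  ring

theorem measure_inter_stays (hQ : IsConditionedWalkLaw ν 0 Q) {b : ℤ} (hb : 0 ≤ b) (A : Set ℤ)
    (n m : ℕ) (c : ℕ → ℤ) (x : ℕ) (h0 : c 0 = 0) (hc : ∀ i ≤ m, 0 ≤ c i) (hx : c m = b + x) :
    Q (cyl c m ∩ stays b A m n) = pathWeight ν c m *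
      ((killed ν)^[n] fun y => A.indicator (normRenewal ν) (b + y)) x :=
  measure_cyl_inter_stays (ok := fun y => 0 ≤ y) (fun _ hy => hb.trans hy)
    (fun m c => hQ.measure_cyl m c) A n m c x h0 hc hx

/-- The path `0, 1, 2, …` has positive weight and reaches every `x`, so it serves to evaluate
functions at `x`. -/
theorem pathWeight_natCast (m : ℕ) : pathWeight ν (fun i => (i : ℤ)) m = ν 1 ^ m := by
  rw [pathWeight, Finset.prod_congr rfl fun i _ => by
    rw [show ((i + 1 : ℕ) : ℤ) - i = 1 by push_cast; ring], Finset.prod_const, Finset.card_range]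

/-- Harmonicity is the consistency of the transform formulas. The mass of the rising path up to `x`
is computed at time `x` and at time `x + 1`; both agree because `Q` charges only nonnegative paths,
and the factor `ν 1 ^ x` cancels. -/
theorem killed_normRenewal (hν : IsStepLaw ν) (hQ : IsConditionedWalkLaw ν 0 Q) :
    killed ν (fun y : ℕ => normRenewal ν y) = fun y : ℕ => normRenewal ν y := by
  ext x
  have h1 := hQ.measure_cyl x (fun i => (i : ℤ)) rfl fun _ _ => by positivity
  have h2 := hQ.measure_inter_stays le_rfl Set.univ 1 x (fun i => (i : ℤ)) x rfl
    (fun _ _ => by positivity) (by simp)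
  have h3 : Q (cyl (fun i => (i : ℤ)) x ∩ stays 0 Set.univ x 1) = Q (cyl (fun i => (i : ℤ)) x) := by
    refine measure_congr ?_
    filter_upwards [hQ.ae_nonneg] with z hz
    refine propext ⟨fun h => h.1, fun h => ⟨h, fun i _ => hz _, trivial⟩⟩
  rw [h3, h1, pathWeight_natCast, ENNReal.mul_right_inj (pow_ne_zero _ hν.apply_one_ne_zero)
    (ENNReal.pow_ne_top (ν.apply_ne_top 1))] at h2
  simpa using h2.symm

theorem measure_eq_stays (hν : IsStepLaw ν) (hQ : IsConditionedWalkLaw ν 0 Q) (n : ℕ) (y : ℕ) :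
    Q {z | z n = y} = normRenewal ν y * (killed ν)^[n] (Set.indicator {y} 1) 0 := by
  have h2 := hQ.measure_inter_stays le_rfl {(y : ℤ)} n 0 0 0 rfl (fun _ _ => le_rfl) (by simp)
  have h3 : Q (cyl 0 0 ∩ stays 0 {(y : ℤ)} 0 n) = Q {z | z n = y} := by
    refine measure_congr ?_
    filter_upwards [hQ.ae_nonneg, hQ.ae_zero hν] with z hz hz0
    refine propext ⟨fun h => ?_, fun h => ⟨fun i hi => ?_, fun i _ => hz _, ?_⟩⟩
    · have := h.2.2
      rwa [zero_add] at this
    · obtain rfl := Nat.le_zero.1 hi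
      exact hz0
    · rw [zero_add]
      exact h
  have h4 : (fun k : ℕ => Set.indicator {(y : ℤ)} (normRenewal ν) (0 + (k : ℤ))) =
      fun k => normRenewal ν y * Set.indicator {y} 1 k := by
    ext k
    by_cases hk : k = y
    · subst hk
      simp
    · rw [Set.indicator_of_notMem (by simpa using hk), Set.indicator_of_notMem (by simpa using hk),
        mul_zero]
  rw [h3, h4, iterate_killed_smul, pathWeight, Finset.range_zero, Finset.prod_empty, one_mul] at h2
  exact h2

variable [IsProbabilityMeasure Q]

/-- The product `V(0)⁻¹ V(0)` is `1` only if `V(0)` is neither zero nor infinite; this is read off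
the total mass of `Q`. -/
theorem normRenewal_zero (hν : IsStepLaw ν) (hQ : IsConditionedWalkLaw ν 0 Q) :
    normRenewal ν 0 = 1 := by
  have h1 := hQ.measure_cyl 0 0 rfl fun _ _ => le_rfl
  rw [pathWeight, Finset.range_zero, Finset.prod_empty, one_mul] at h1
  rw [← show Q (cyl 0 0) = normRenewal ν 0 from h1, ← prob_compl_eq_zero_iff (measurableSet_cyl _ _)]
  have h2 : ∀ᵐ z ∂Q, z ∈ cyl 0 0 := by
    filter_upwards [hQ.ae_zero hν] with z hz i hi
    obtain rfl := Nat.le_zero.1 hi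
    exact hz
  exact mem_ae_iff.1 h2

/-- An infinite value at `x` would give infinite mass to the rising path. -/
theorem normRenewal_ne_top (hν : IsStepLaw ν) (hQ : IsConditionedWalkLaw ν 0 Q) (x : ℕ) :
    normRenewal ν x ≠ ∞ := by
  have h1 := hQ.measure_cyl x (fun i => (i : ℤ)) rfl fun _ _ => by positivity
  intro hc
  rw [hc, pathWeight_natCast, ENNReal.mul_top (pow_ne_zero _ hν.apply_one_ne_zero)] at h1
  exact measure_ne_top Q _ h1

theorem tendsto_killed (hν : IsStepLaw ν) (hQ : IsConditionedWalkLaw ν 0 Q) (x : ℕ) :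
    Filter.Tendsto (fun n => (killed ν)^[n] 1 x) Filter.atTop (nhds 0) :=
  tendsto_iterate_killed_one hν (hQ.normRenewal_ne_top hν) (hQ.killed_normRenewal hν)
    (hQ.normRenewal_zero hν) x

/-- The expected time spent at `y` is finite. -/
theorem tsum_killed_single_ne_top (hν : IsStepLaw ν) (hQ : IsConditionedWalkLaw ν 0 Q) (y : ℕ) :
    ∑' n, (killed ν)^[n] (Set.indicator {y} 1) 0 ≠ ∞ := by
  -- From `y` the walk is killed within `r` steps with probability more than `1/2`. So survival
  -- until `n + r`, plus half the probability of being at `y` at time `n`, is at most survival until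
  -- `n`, and the sum over `n` telescopes to a bound by `r`.
  obtain ⟨r, hr⟩ := ((hQ.tendsto_killed hν y).eventually
    (gt_mem_nhds (show (0 : ℝ≥0∞) < 2⁻¹ by simp))).exists
  have hle : (killed ν)^[r] 1 + (fun k => 2⁻¹ * Set.indicator {y} 1 k) ≤ (1 : ℕ → ℝ≥0∞) := by
    intro k
    by_cases hk : k = y
    · subst hk
      simp only [Pi.add_apply, Set.indicator_of_mem (Set.mem_singleton k), Pi.one_apply, mul_one]
      exact (add_le_add hr.le le_rfl).trans (ENNReal.inv_two_add_inv_two).le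
    · simp only [Pi.add_apply, Pi.one_apply,
        Set.indicator_of_notMem (show k ∉ ({y} : Set ℕ) from hk), mul_zero, add_zero]
      exact iterate_killed_one_le r k
  set e : ℕ → ℝ≥0∞ := fun n => (killed ν)^[n] (Set.indicator {y} 1) 0 with he
  set s : ℕ → ℝ≥0∞ := fun n => (killed ν)^[n] 1 0 with hs
  have hs1 : ∀ n, s n ≤ 1 := fun n => iterate_killed_one_le n 0
  have h1 : ∀ n, s (n + r) + 2⁻¹ * e n ≤ s n := by
    intro n
    have := iterate_killed_mono (ν := ν) hle n 0
    rw [iterate_killed_add, iterate_killed_smul, ← Function.iterate_add_apply] at this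
    exact this
  have h2 : ∀ n, ∑ i ∈ Finset.range n, 2⁻¹ * e i ≤ r := by
    intro n
    have h3 : ∑ i ∈ Finset.range n, s (i + r) + ∑ i ∈ Finset.range n, 2⁻¹ * e i ≤
        ∑ i ∈ Finset.range n, s i := by
      rw [← Finset.sum_add_distrib]
      exact Finset.sum_le_sum fun i _ => h1 i
    have h4 : ∑ i ∈ Finset.range n, s i ≤ ∑ i ∈ Finset.range n, s (i + r) + r := by
      calc ∑ i ∈ Finset.range n, s i ≤ ∑ i ∈ Finset.range (r + n), s i :=
            Finset.sum_le_sum_of_subset (Finset.range_mono (by omega))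
        _ = ∑ i ∈ Finset.range r, s i + ∑ i ∈ Finset.range n, s (i + r) := by
            rw [Finset.sum_range_add]
            simp_rw [add_comm r]
        _ ≤ r + ∑ i ∈ Finset.range n, s (i + r) := by
            gcongr
            calc ∑ i ∈ Finset.range r, s i ≤ ∑ i ∈ Finset.range r, 1 :=
                  Finset.sum_le_sum fun i _ => hs1 i
              _ = r := by simp
        _ = _ := add_comm _ _
    refine (ENNReal.add_le_add_iff_left ?_).1 (h3.trans h4)
    exact ENNReal.sum_ne_top.2 fun i _ => ne_top_of_le_ne_top ENNReal.one_ne_top (hs1 _)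
  have h3 : ∑' n, 2⁻¹ * e n ≤ r := ENNReal.tsum_le_of_sum_range_le h2
  rw [ENNReal.tsum_mul_left] at h3
  intro hc
  rw [hc, ENNReal.mul_top (by simp)] at h3
  simp at h3

/-- The expected number of visits to `y` is `V(y)` times the Green function of the killed walk,
which is finite. By Borel-Cantelli every level is visited finitely often, and a nonnegative integer
path with this property tends to infinity. -/
theorem ae_tendsto (hν : IsStepLaw ν) (hQ : IsConditionedWalkLaw ν 0 Q) :
    ∀ᵐ z ∂Q, Filter.Tendsto z Filter.atTop Filter.atTop := by
  have h1 : ∀ y : ℕ, ∀ᵐ z ∂Q, ∀ᶠ n in Filter.atTop, z n ≠ (y : ℤ) := by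
    intro y
    have := measure_setOfPred_frequently_eq_zero (μ := Q) (p := fun n z => z n = (y : ℤ)) (by
      simp_rw [hQ.measure_eq_stays hν]
      rw [ENNReal.tsum_mul_left]
      exact ENNReal.mul_ne_top (hQ.normRenewal_ne_top hν y) (hQ.tsum_killed_single_ne_top hν y))
    filter_upwards [measure_eq_zero_iff_ae_notMem.1 this] with z hz
    exact Filter.not_frequently.1 hz
  filter_upwards [ae_all_iff.2 h1, hQ.ae_nonneg] with z hz hz0
  refine Filter.tendsto_atTop.2 fun b => ?_
  have h2 : ∀ᶠ n in Filter.atTop, ∀ y ∈ Finset.range b.toNat, z n ≠ (y : ℤ) :=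
    (Filter.eventually_all_finset _).2 fun y _ => hz y
  filter_upwards [h2] with n hn
  by_contra! hc
  have := hz0 n
  exact hn (z n).toNat (Finset.mem_range.2 (by omega)) (by omega)

/-- The probability that the conditioned walk follows `c` and then stays above its final value. -/
theorem measure_forall_le (hν : IsStepLaw ν) (hQ : IsConditionedWalkLaw ν 0 Q) (m : ℕ) (c : ℕ → ℤ)
    (h0 : c 0 = 0) (hc : ∀ i ≤ m, 0 ≤ c i) :
    Q (cyl c m ∩ {z | ∀ l, m ≤ l → c m ≤ z l}) = pathWeight ν c m := by
  set h := (c m).toNat with hh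
  have hcm : c m = h := by rw [hh, Int.toNat_of_nonneg (hc m le_rfl)]
  have hH := isHarmonic_of_killed_eq hν (hQ.normRenewal_ne_top hν) (hQ.killed_normRenewal hν)
    (hQ.normRenewal_zero hν)
  have hiter : ∀ n, (killed ν)^[n] (fun y : ℕ => normRenewal ν y) = fun y : ℕ => normRenewal ν y := fun n =>
    Function.iterate_fixed (hQ.killed_normRenewal hν) n
  -- The increments of `V` give `V(y) ≤ V(h + y) ≤ V(y) + h`. Iterates of `killed` fix `V` and send
  -- constants to `0`, so `V(h + ·)` evaluated at `0` tends to `V(0) = 1`.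
  have hlow : (fun y : ℕ => normRenewal ν y) ≤ fun y : ℕ => normRenewal ν (c m + y) := by
    intro y
    have := hH.mono (Nat.le_add_left y h)
    rw [ENNReal.toReal_le_toReal (hQ.normRenewal_ne_top hν _) (hQ.normRenewal_ne_top hν _)] at this
    rw [hcm]
    exact_mod_cast this
  have hup : (fun y : ℕ => normRenewal ν (c m + y)) ≤
      (fun y : ℕ => normRenewal ν y) + fun y : ℕ => (h : ℝ≥0∞) * (1 : ℕ → ℝ≥0∞) y := by
    intro y
    have := hH.le_add y h
    have e : ((normRenewal ν (y : ℤ)) + h).toReal = (normRenewal ν (y : ℤ)).toReal + h := by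
      rw [ENNReal.toReal_add (hQ.normRenewal_ne_top hν _) (ENNReal.natCast_ne_top h),
        ENNReal.toReal_natCast]
    rw [← e, ENNReal.toReal_le_toReal (hQ.normRenewal_ne_top hν _)
      (ENNReal.add_ne_top.2 ⟨hQ.normRenewal_ne_top hν _, ENNReal.natCast_ne_top h⟩)] at this
    simp only [Pi.add_apply, Pi.one_apply, mul_one]
    rw [hcm, add_comm (h : ℤ)]
    exact_mod_cast this
  have hlim : Filter.Tendsto (fun n => (killed ν)^[n] (fun y : ℕ => normRenewal ν (c m + y)) 0)
      Filter.atTop (nhds 1) := by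
    refine tendsto_of_tendsto_of_tendsto_of_le_of_le (g := fun _ => 1)
      (h := fun n => 1 + (h : ℝ≥0∞) * (killed ν)^[n] 1 0) tendsto_const_nhds ?_ ?_ ?_
    · have := (ENNReal.Tendsto.const_mul (hQ.tendsto_killed hν 0)
        (Or.inr (ENNReal.natCast_ne_top h))).const_add 1
      simpa using this
    · intro n
      have := iterate_killed_mono (ν := ν) hlow n 0
      rw [hiter] at this
      simpa [hQ.normRenewal_zero hν] using this
    · intro n
      have := iterate_killed_mono (ν := ν) hup n 0
      rw [iterate_killed_add, hiter, iterate_killed_smul] at this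
      simpa [hQ.normRenewal_zero hν] using this
  have hset : cyl c m ∩ {z | ∀ l, m ≤ l → c m ≤ z l} =
      ⋂ n, cyl c m ∩ stays (c m) Set.univ m n := by
    ext z
    simp only [Set.mem_iInter, Set.mem_inter_iff]
    constructor
    · exact fun hz n => ⟨hz.1, fun i _ => hz.2 _ (by omega), trivial⟩
    · refine fun hz => ⟨(hz 0).1, fun l hl => ?_⟩
      have := (hz (l - m)).2.1 (l - m) le_rfl
      rwa [Nat.add_sub_cancel' hl] at this
  have hant : Antitone fun n => cyl c m ∩ stays (c m) Set.univ m n := fun n n' hn =>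
    Set.inter_subset_inter_right _ fun z hz => ⟨fun i hi => hz.1 i (hi.trans hn), trivial⟩
  rw [hset]
  refine tendsto_nhds_unique (tendsto_measure_iInter_atTop (fun n =>
    ((measurableSet_cyl c m).inter (measurableSet_stays _ _ _ _)).nullMeasurableSet) hant
    ⟨0, measure_ne_top _ _⟩) ?_
  have h1 : ∀ n, Q (cyl c m ∩ stays (c m) Set.univ m n) = pathWeight ν c m *
      (killed ν)^[n] (fun y : ℕ => normRenewal ν (c m + y)) 0 := fun n => by
    rw [hQ.measure_inter_stays (hc m le_rfl) Set.univ n m c 0 h0 hc (by simp)]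
    simp
  have h2 := ENNReal.Tendsto.const_mul (a := pathWeight ν c m) hlim
    (Or.inr (pathWeight_ne_top c m))
  rw [mul_one] at h2
  exact h2.congr fun n => (h1 n).symm

end IsConditionedWalkLaw

/-- The inferior limit of the random walk is `-∞`. -/
theorem ae_walkLaw_frequently_lt (hν : IsStepLaw ν)
    (h : ∀ x : ℕ, Filter.Tendsto (fun n => (killed ν)^[n] 1 x) Filter.atTop (nhds 0)) :
    ∀ᵐ z ∂walkLaw ν 0, ∀ b : ℤ, ∃ᶠ k in Filter.atTop, z k < b := by
  have h1 : ∀ b : ℕ, ∀ᵐ z ∂walkLaw ν 0, ∃ k, z k < -(b : ℤ) := by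
    intro b
    have hle : ∀ n, walkLaw ν 0 {z | ¬ ∃ k, z k < -(b : ℤ)} ≤ (killed ν)^[n] 1 b := by
      intro n
      have h2 := measure_cyl_inter_stays (μ := walkLaw ν 0) (ok := fun _ => True) (g := 1)
        (b := -(b : ℤ)) (fun _ _ => trivial) (fun m c h0 _ => by
          have := walkLaw_cyl (ν := ν) c m
          rw [h0] at this
          rw [this, Pi.one_apply, mul_one]) Set.univ n 0 0 b rfl (fun _ _ => trivial) (by simp)
      simp only [Set.indicator_univ, Pi.one_apply, pathWeight, Finset.range_zero,
        Finset.prod_empty, one_mul] at h2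
      refine le_trans (measure_mono_ae ?_) h2.le
      filter_upwards [ae_walkLaw_step hν 0] with z hz hz'
      have hz' : ¬ ∃ k, z k < -(b : ℤ) := hz'
      push Not at hz'
      refine ⟨fun i hi => ?_, fun i _ => hz' _, trivial⟩
      obtain rfl := Nat.le_zero.1 hi
      exact hz.1
    exact le_antisymm (ge_of_tendsto (h b) (Filter.Eventually.of_forall hle)) zero_le
  filter_upwards [ae_all_iff.2 h1] with z hz b
  refine Filter.frequently_atTop.2 fun N => ?_
  -- A value smaller than `b` and than the first `N` values can only occur from time `N` on.
  obtain ⟨k, hk⟩ := hz (b.natAbs + ∑ i ∈ Finset.range N, (z i).natAbs)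
  have hNk : N ≤ k := by
    by_contra! hc
    have := Finset.single_le_sum (f := fun i => (z i).natAbs) (fun _ _ => Nat.zero_le _)
      (Finset.mem_range.2 hc)
    omega
  exact ⟨k, hNk, by omega⟩

/-! ### The law of the initial segments of a coding pair -/

variable {ν : PMF ℤ} {Q : Measure (ℕ → ℤ)}

theorem ae_isCodingPair (hν : IsStepLaw ν) [IsProbabilityMeasure Q]
    (hQ : IsConditionedWalkLaw ν 0 Q) :
    ∀ᵐ Y ∂(walkLaw ν 0).prod Q, IsCodingPair Y.1 Y.2 := by
  have h1 : ∀ᵐ Y ∂(walkLaw ν 0).prod Q, (Y.1 0 = 0 ∧ ∀ k, Y.1 (k + 1) - Y.1 k ≤ 1 ∧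
      Y.1 (k + 1) ≠ Y.1 k) ∧ ∀ b : ℤ, ∃ᶠ k in Filter.atTop, Y.1 k < b :=
    Measure.quasiMeasurePreserving_fst.ae
      ((ae_walkLaw_step hν 0).and (ae_walkLaw_frequently_lt hν (hQ.tendsto_killed hν)))
  have h2 : ∀ᵐ Y ∂(walkLaw ν 0).prod Q, (Y.2 0 = 0 ∧ ∀ k, Y.2 (k + 1) - Y.2 k ≤ 1 ∧
      Y.2 (k + 1) ≠ Y.2 k) ∧ (∀ k, 0 ≤ Y.2 k) ∧ Filter.Tendsto Y.2 Filter.atTop Filter.atTop :=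
    Measure.quasiMeasurePreserving_snd.ae
      (((hQ.ae_zero hν).and (hQ.ae_step hν)).and (hQ.ae_nonneg.and (hQ.ae_tendsto hν)))
  filter_upwards [h1, h2] with Y hY hY'
  exact ⟨hY.1.1, hY'.1.1, fun k => (hY.1.2 k).1, fun k => (hY'.1.2 k).1, fun k => (hY.1.2 k).2,
    fun k => (hY'.1.2 k).2, hY.2, hY'.2.1, hY'.2.2⟩

/-- The event that the initial segments of a coding pair are those of `X`. -/
def cutEvent (n : ℕ) (X : (ℕ → ℤ) × (ℕ → ℤ)) : Set ((ℕ → ℤ) × (ℕ → ℤ)) :=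
  cyl X.1 (recTime X.1 n) ×ˢ (cyl X.2 (cutTime X.1 X.2 n) ∩
    {z | ∀ l, cutTime X.1 X.2 n ≤ l → X.2 (cutTime X.1 X.2 n) ≤ z l})

theorem measurableSet_cutEvent (n : ℕ) (X : (ℕ → ℤ) × (ℕ → ℤ)) :
    MeasurableSet (cutEvent n X) := by
  refine (measurableSet_cyl _ _).prod ((measurableSet_cyl _ _).inter ?_)
  simp only [Set.ofPred_forall]
  exact MeasurableSet.iInter fun l => MeasurableSet.iInter fun _ =>
    measurable_pi_apply l measurableSet_Ici

theorem IsCodingPair.recTime_mono {C C' : ℕ → ℤ} (h : IsCodingPair C C') : StrictMono (recTime C) :=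
  strictMono_nat_of_lt_succ h.recTime_lt

theorem IsCodingPair.recTime_eq {B B' C C' : ℕ → ℤ} (h : IsCodingPair B B')
    (h' : IsCodingPair C C') {n : ℕ} (he : ∀ k ≤ recTime B n, C k = B k) :
    ∀ j ≤ n, recTime C j = recTime B j := by
  intro j
  induction j with
  | zero => exact fun _ => rfl
  | succ j ih =>
    intro hj
    have h1 := ih (by omega)
    have h2 := h.recTime_mono.monotone hj
    have h3 := h.recTime_spec j
    have h4 := h'.recTime_spec j
    have h5 := h.recTime_lt j
    rw [h1, he (recTime B j) (by omega)] at h4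
    rcases lt_trichotomy (recTime C (j + 1)) (recTime B (j + 1)) with hlt | heq | hgt
    · have := h3.2 _ hlt
      rw [he _ (by omega)] at h4
      omega
    · exact heq
    · have := h4.2 _ hgt
      rw [he _ h2] at this
      omega

/-- The key of a pair depends on the whole future of `C'`, through a last-passage time. The
condition in `cutEvent` that the path stays at or above its endpoint encodes exactly this. -/
theorem mem_cutEvent_iff {n : ℕ} (hn : n ≠ 0) {X Y : (ℕ → ℤ) × (ℕ → ℤ)}
    (h : IsCodingPair X.1 X.2) (h' : IsCodingPair Y.1 Y.2) :
    Y ∈ cutEvent n X ↔ cutKey n Y = cutKey n X := by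
  have hb := h.neg_recTime hn
  obtain ⟨h1, h2, h3, h4⟩ := h.rayTime_spec (b := -X.1 (recTime X.1 n)) (by omega)
  have hcut : X.2 (cutTime X.1 X.2 n) = -X.1 (recTime X.1 n) := h3
  constructor
  · rintro ⟨hY1, hY2, hY3⟩
    have hr := h.recTime_eq h' hY1 n le_rfl
    have hm : cutTime Y.1 Y.2 n = cutTime X.1 X.2 n := by
      rw [cutTime, hr, hY1 _ le_rfl]
      obtain ⟨g1, g2, g3, g4⟩ := h'.rayTime_spec (b := -X.1 (recTime X.1 n)) (by omega)
      refine le_antisymm (Nat.sInf_le fun l hl => ?_) ?_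
      · rw [← hcut]
        exact hY3 l hl
      · by_contra! hc
        have := g2 (cutTime X.1 X.2 n - 1) (by omega)
        rw [hY2 _ (Nat.sub_le _ _)] at this
        have h4' : X.2 (cutTime X.1 X.2 n - 1) < -X.1 (recTime X.1 n) := h4
        omega
    refine cutKey_eq_iff.2 ⟨hr, hm, ?_, ?_⟩
    · rw [hr]
      exact hY1
    · rw [hm]
      exact hY2
  · intro hk
    obtain ⟨g1, g2, g3, g4⟩ := cutKey_eq_iff.1 hk
    refine ⟨by rwa [g1] at g3, by rwa [g2] at g4, fun l hl => ?_⟩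
    have g5 := (h'.rayTime_spec (b := -Y.1 (recTime Y.1 n))
      (by have := h'.neg_recTime hn; omega)).2.1 l (by rw [← g2] at hl; exact hl)
    rwa [hcut, ← g1, ← g3 _ le_rfl]

theorem measure_cutEvent (hν : IsStepLaw ν) [IsProbabilityMeasure Q]
    (hQ : IsConditionedWalkLaw ν 0 Q) (n : ℕ) {X : (ℕ → ℤ) × (ℕ → ℤ)} (h : IsCodingPair X.1 X.2) :
    (walkLaw ν 0).prod Q (cutEvent n X) =
      pathWeight ν X.1 (recTime X.1 n) * pathWeight ν X.2 (cutTime X.1 X.2 n) := by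
  rw [cutEvent, Measure.prod_prod, hQ.measure_forall_le hν _ _ h.zero' fun i _ => h.nonneg' i]
  congr 1
  have := walkLaw_cyl (ν := ν) X.1 (recTime X.1 n)
  rwa [h.zero] at this

/-! ### Cylinders of the Kesten tree -/

/-- The numbers of children in the Kesten tree. -/
def kestenCount (z : (List ℕ → ℕ) × (ℕ → ℕ × ℕ)) (v : List ℕ) : ℕ :=
  if v = spine z.2 v.length then (z.2 v.length).1 else z.1 v

theorem kestenTree_eq (z : (List ℕ → ℕ) × (ℕ → ℕ × ℕ)) :
    kestenTree z = PlaneTree.ofNumChildren (kestenCount z) := rfl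

theorem spine_prefix (s : ℕ → ℕ × ℕ) {m n : ℕ} (h : m ≤ n) : spine s m <+: spine s n := by
  induction n, h using Nat.le_induction with
  | base => exact List.prefix_rfl
  | succ n _ ih => exact ih.trans (List.prefix_append _ _)

theorem measurableSet_spine_eq (n : ℕ) (v : List ℕ) :
    MeasurableSet {s : ℕ → ℕ × ℕ | spine s n = v} := by
  induction n generalizing v with
  | zero => exact MeasurableSet.const ([] = v)
  | succ n ih =>
    have : {s : ℕ → ℕ × ℕ | spine s (n + 1) = v} = ⋃ u : List ℕ, ⋃ j : ℕ,
        {s | spine s n = u} ∩ (fun s : ℕ → ℕ × ℕ => s n) ⁻¹' {x | u ++ [x.2] = v} := by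
      ext s
      simp [spine]
    rw [this]
    exact MeasurableSet.iUnion fun u => MeasurableSet.iUnion fun j =>
      (ih u).inter (measurable_pi_apply n (Set.to_countable _).measurableSet)

theorem measurable_kestenCount (v : List ℕ) : Measurable fun z => kestenCount z v := by
  unfold kestenCount
  refine Measurable.ite ?_ ?_ ?_
  · have : {z : (List ℕ → ℕ) × (ℕ → ℕ × ℕ) | v = spine z.2 v.length} =
        Prod.snd ⁻¹' {s | spine s v.length = v} := by
      ext z
      exact eq_comm
    rw [this]
    exact measurable_snd (measurableSet_spine_eq _ _)
  · fun_prop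
  · fun_prop

theorem measurable_kestenTree : Measurable kestenTree := by
  refine measurable_generateFrom ?_
  rintro _ ⟨w, rfl⟩
  have : kestenTree ⁻¹' {t | w ∈ t.verts} =
      ⋂ v : List ℕ, ⋂ j : ℕ, {z | v ++ [j] <+: w → j < kestenCount z v} := by
    ext z
    simp only [Set.mem_iInter]
    rfl
  rw [this]
  refine MeasurableSet.iInter fun v => MeasurableSet.iInter fun j => ?_
  by_cases h : v ++ [j] <+: w
  · simp only [h, forall_const]
    exact measurable_kestenCount v (measurableSet_Ioi (a := j))
  · simp [h]

/-- The event that the spine of the Kesten tree starts with `v`, and that the numbers of children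
off the descendants of `v` are given by `k`. -/
def kestenEvent (k : List ℕ → ℕ) (v : List ℕ) : Set ((List ℕ → ℕ) × (ℕ → ℕ × ℕ)) :=
  {z | (∀ w ∈ PlaneTree.offVerts k v, ¬ w <+: v → z.1 w = k w) ∧
    ∀ m < v.length, z.2 m = (k (v.take m), v.getD m 0)}

theorem kestenEvent_eq (k : List ℕ → ℕ) (v : List ℕ) : kestenEvent k v =
    (Set.pi {w | w ∈ PlaneTree.offVerts k v ∧ ¬ w <+: v} fun w => {k w}) ×ˢ
      (Set.pi (Finset.range v.length) fun m => {(k (v.take m), v.getD m 0)}) := by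
  ext z
  simp [kestenEvent, Set.mem_pi]

theorem measurableSet_kestenEvent (k : List ℕ → ℕ) (v : List ℕ) :
    MeasurableSet (kestenEvent k v) := by
  rw [kestenEvent_eq]
  exact (MeasurableSet.pi (Set.to_countable _) fun _ _ => MeasurableSet.singleton _).prod
    (MeasurableSet.pi (Set.to_countable _) fun _ _ => MeasurableSet.singleton _)

section Event

variable {k : List ℕ → ℕ} {v : List ℕ} {z : (List ℕ → ℕ) × (ℕ → ℕ × ℕ)}

theorem spine_of_mem_kestenEvent (hz : z ∈ kestenEvent k v) {m : ℕ} (hm : m ≤ v.length) :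
    spine z.2 m = v.take m := by
  induction m with
  | zero => simp [spine]
  | succ m ih =>
    rw [spine, ih (by omega), hz.2 m (by omega), List.take_succ_eq_append_getElem (by omega)]
    simp [List.getD_eq_getElem?_getD, List.getElem?_eq_getElem (show m < v.length by omega)]

/-- The proper prefixes of `v` are on the spine, and any other vertex off the descendants of `v` is
not, because the spine passes through `v`. -/
theorem kestenCount_of_mem_kestenEvent (hz : z ∈ kestenEvent k v) {w : List ℕ}
    (hw : w ∈ PlaneTree.offVerts k v) : kestenCount z w = k w := by
  by_cases hv : w <+: v
  · have hlt : w.length < v.length := by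
      refine lt_of_le_of_ne hv.length_le fun h => hw.2 ?_
      rw [hv.eq_of_length h]
    have hw' : v.take w.length = w := (List.prefix_iff_eq_take.1 hv).symm
    rw [kestenCount, spine_of_mem_kestenEvent hz hlt.le, hw', if_pos rfl, hz.2 _ hlt, hw']
  · rw [kestenCount, if_neg, hz.1 w hw hv]
    intro h
    rcases le_total w.length v.length with hl | hl
    · rw [spine_of_mem_kestenEvent hz hl] at h
      exact hv (h ▸ List.take_prefix _ _)
    · have h1 := spine_prefix z.2 hl
      rw [← h, spine_of_mem_kestenEvent hz le_rfl, List.take_length] at h1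
      exact hw.2 h1

theorem offVerts_kestenCount (hz : z ∈ kestenEvent k v) :
    PlaneTree.offVerts (kestenCount z) v = PlaneTree.offVerts k v := by
  refine Set.Subset.antisymm (fun w hw => ?_) (PlaneTree.offVerts_subset_of_agree fun w hw =>
    (kestenCount_of_mem_kestenEvent hz hw).symm)
  have key : ∀ u, u <+: w → u ∈ PlaneTree.offVerts k v := by
    intro u
    induction u using List.reverseRecOn with
    | nil =>
      exact fun _ => ⟨(PlaneTree.ofNumChildren k).nil_mem, fun h => hw.2 (h.trans (List.nil_prefix))⟩
    | append_singleton u j ih =>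
      intro hu
      have h1 := ih ((List.prefix_append _ _).trans hu)
      have h2 := hw.1 u j hu
      rw [kestenCount_of_mem_kestenEvent hz h1] at h2
      exact ⟨PlaneTree.concat_mem_ofNumChildren.2 ⟨h1.1, h2⟩, fun h => hw.2 (h.trans hu)⟩
  exact key w List.prefix_rfl

theorem mem_kestenTree_iff (hz : z ∈ kestenEvent k v) {w : List ℕ} (hw : w.length ≤ v.length) :
    w ∈ (kestenTree z).verts ↔ w ∈ (PlaneTree.ofNumChildren k).verts := by
  rw [kestenTree_eq, PlaneTree.mem_iff_mem_offVerts' hw, PlaneTree.mem_iff_mem_offVerts' hw]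
  constructor
  · exact fun h => PlaneTree.offVerts'_subset_of_agree (fun u hu =>
      kestenCount_of_mem_kestenEvent hz (offVerts_kestenCount hz ▸ hu)) h
  · exact fun h => PlaneTree.offVerts'_subset_of_agree (fun u hu =>
      (kestenCount_of_mem_kestenEvent hz hu).symm) h

end Event

/-! ### The probability of a cylinder -/

/-- Size-biasing multiplies by `k / m` and the uniform choice of the child divides by `k`. -/
theorem spineLaw_apply {p : PMF ℕ} (h0 : mean p ≠ 0) (h1 : mean p ≠ ∞) {k j : ℕ} (hj : j < k) :
    spineLaw p (k, j) = p k * (mean p)⁻¹ := by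
  obtain ⟨k, rfl⟩ : ∃ l, k = l + 1 := ⟨k - 1, by omega⟩
  have hch : ∀ l, withUniformChild l (k + 1, j) = if l = k + 1 then ((k + 1 : ℕ) : ℝ≥0∞)⁻¹ else 0 := by
    intro l
    rcases l with _ | l
    · simp [withUniformChild]
    · have hmap : withUniformChild (l + 1) =
          (PMF.uniformOfFintype (Fin (l + 1))).map fun i : Fin (l + 1) => (l + 1, (i : ℕ)) := by
        change PMF.map _ (PMF.map Fin.val _) = _
        rw [PMF.map_comp]
        rfl
      rw [hmap, PMF.map_apply]
      by_cases hl : l = k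
      · subst hl
        rw [if_pos rfl, tsum_eq_single ⟨j, hj⟩]
        · simp
        · intro i hi
          rw [if_neg]
          intro h
          exact hi (Fin.ext (Prod.mk_inj.1 h).2.symm)
      · rw [if_neg (by omega)]
        refine ENNReal.tsum_eq_zero.2 fun i => if_neg fun h => ?_
        have := (Prod.mk_inj.1 h).1
        omega
  have hs : sizeBiased p (k + 1) = ((k + 1 : ℕ) : ℝ≥0∞) * p (k + 1) * (mean p)⁻¹ := by
    rw [sizeBiased, dif_pos ⟨h0, h1⟩]
    exact PMF.normalize_apply _ _ _
  rw [spineLaw, PMF.bind_apply]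
  simp_rw [hch]
  rw [tsum_eq_single (k + 1)]
  · rw [if_pos rfl, hs, mul_assoc, mul_assoc, mul_comm]
    rw [show p (k + 1) * ((mean p)⁻¹ * ((k + 1 : ℕ) : ℝ≥0∞)⁻¹) * ((k + 1 : ℕ) : ℝ≥0∞) =
      p (k + 1) * (mean p)⁻¹ * (((k + 1 : ℕ) : ℝ≥0∞)⁻¹ * ((k + 1 : ℕ) : ℝ≥0∞)) by ring]
    rw [ENNReal.inv_mul_cancel (by simp) (ENNReal.natCast_ne_top _), mul_one]
  · intro l hl
    rw [if_neg hl, mul_zero]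

/-- The product space on which the Kesten tree is defined. -/
noncomputable def kestenMeasure (white black : PMF ℕ) :
    Measure ((List ℕ → ℕ) × (ℕ → ℕ × ℕ)) :=
  (Measure.infinitePi fun v : List ℕ => (if Even v.length then white else black).toMeasure).prod
    (Measure.infinitePi fun n : ℕ =>
      (if Even n then spineLaw white else spineLaw black).toMeasure)

instance (white black : PMF ℕ) : IsProbabilityMeasure (kestenMeasure white black) := by
  unfold kestenMeasure
  infer_instance

theorem kestenLaw_eq (white black : PMF ℕ) :
    kestenLaw white black = (kestenMeasure white black).map kestenTree := rfl

theorem prod_range_two_mul_alternate (a b : ℝ≥0∞) (n : ℕ) :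
    ∏ m ∈ Finset.range (2 * n), (if Even m then a else b) = (a * b) ^ n := by
  induction n with
  | zero => simp
  | succ n ih =>
    rw [show 2 * (n + 1) = 2 * n + 1 + 1 by ring, Finset.prod_range_succ, Finset.prod_range_succ, ih,
      if_pos (by simp), if_neg (by simp), pow_succ]
    ring

/-- The proper prefixes of `v` are `n` white and `n` black spine vertices. Each brings the inverse
of its mean, and these factors cancel as the means have product one. The spine vertices then weigh
as much as ordinary ones. -/
theorem kestenMeasure_kestenEvent {white black : PMF ℕ} (hw0 : mean white ≠ 0)
    (hw1 : mean white ≠ ∞) (hb0 : mean black ≠ 0) (hb1 : mean black ≠ ∞)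
    (hwb : mean white * mean black = 1) {k : List ℕ → ℕ} {v : List ℕ} {n : ℕ}
    (hv : v ∈ (PlaneTree.ofNumChildren k).verts) (hn : v.length = 2 * n) {F : Finset (List ℕ)}
    (hF : (F : Set (List ℕ)) = PlaneTree.offVerts k v) :
    kestenMeasure white black (kestenEvent k v) =
      ∏ w ∈ F, (if Even w.length then white (k w) else black (k w)) := by
  classical
  have hmem : ∀ w, w ∈ F ↔ w ∈ PlaneTree.offVerts k v := fun w => by rw [← hF]; rfl
  have hset : {w | w ∈ PlaneTree.offVerts k v ∧ ¬ w <+: v} = ((F.filter fun w => ¬ w <+: v :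
      Finset (List ℕ)) : Set (List ℕ)) := by
    ext w
    simp [hmem]
  have happ : ∀ (b : Prop) [Decidable b] (m : ℕ),
      (if b then white else black) m = if b then white m else black m := fun b _ m => by
    split_ifs <;> rfl
  -- As `v` is in the tree, the marked ranks are those of actual children, as `spineLaw_apply`
  -- requires.
  have htake : ∀ m < v.length, v.getD m 0 < k (v.take m) := by
    intro m hm
    refine hv _ _ ?_
    have h1 := List.take_prefix (m + 1) v
    rw [List.take_succ_eq_append_getElem hm] at h1
    rwa [List.getD_eq_getElem?_getD, List.getElem?_eq_getElem hm]
  rw [kestenMeasure, kestenEvent_eq, Measure.prod_prod, hset,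
    Measure.infinitePi_pi _ (fun _ _ => MeasurableSet.singleton _),
    Measure.infinitePi_pi _ (fun _ _ => MeasurableSet.singleton _)]
  have hspine : ∏ m ∈ Finset.range v.length,
      (if Even m then spineLaw white else spineLaw black).toMeasure {(k (v.take m), v.getD m 0)} =
      ∏ m ∈ Finset.range v.length,
        if Even m then white (k (v.take m)) else black (k (v.take m)) := by
    have h1 : ∀ m ∈ Finset.range v.length, (if Even m then spineLaw white else
        spineLaw black).toMeasure {(k (v.take m), v.getD m 0)} =
        (if Even m then white (k (v.take m)) else black (k (v.take m))) *
          (if Even m then (mean white)⁻¹ else (mean black)⁻¹) := by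
      intro m hm
      have := htake m (Finset.mem_range.1 hm)
      rw [PMF.toMeasure_apply_singleton _ _ (MeasurableSet.singleton _)]
      split_ifs
      · exact spineLaw_apply hw0 hw1 this
      · exact spineLaw_apply hb0 hb1 this
    rw [Finset.prod_congr rfl h1, Finset.prod_mul_distrib, hn, prod_range_two_mul_alternate,
      ← ENNReal.mul_inv (Or.inl hw0) (Or.inl hw1), hwb, inv_one, one_pow, mul_one]
  have himg : F.filter (fun w => w <+: v) = (Finset.range v.length).image fun m => v.take m := by
    ext w
    simp only [Finset.mem_filter, Finset.mem_image, Finset.mem_range, hmem]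
    constructor
    · rintro ⟨h1, h2⟩
      refine ⟨w.length, lt_of_le_of_ne h2.length_le fun h => h1.2 ?_,
        (List.prefix_iff_eq_take.1 h2).symm⟩
      rw [h2.eq_of_length h]
    · rintro ⟨m, hm, rfl⟩
      refine ⟨⟨PlaneTree.mem_of_prefix (List.take_prefix _ _) hv, fun h => ?_⟩,
        List.take_prefix _ _⟩
      have := h.length_le
      rw [List.length_take] at this
      omega
  have hinj : Set.InjOn (fun m => v.take m) (Finset.range v.length : Finset ℕ) := by
    intro m hm m' hm' h
    have := congrArg List.length h
    simp only [List.length_take] at this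
    have h1 := Finset.mem_range.1 hm
    have h2 := Finset.mem_range.1 hm'
    omega
  rw [hspine, ← Finset.prod_filter_not_mul_prod_filter F (fun w => w <+: v), himg,
    Finset.prod_image hinj]
  congr 1
  · refine Finset.prod_congr rfl fun w _ => ?_
    rw [PMF.toMeasure_apply_singleton _ _ (MeasurableSet.singleton _), happ]
  · refine Finset.prod_congr rfl fun m hm => ?_
    rw [List.length_take, min_eq_left (Finset.mem_range.1 hm).le]

/-! ### Means of the offspring distributions -/

section Mean

variable {ν : PMF ℤ}

theorem mean_nuBlack (hν : IsStepLaw ν) : mean (nuBlack ν hν) = ν 1 / (1 - ν 1) := by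
  have h1 : ∑' k : ℕ, (k : ℝ≥0∞) * ν (-(k : ℤ)) = ν 1 := by
    have h2 := hν.hasSum_mean
    have h3 := ENNReal.ofReal_tsum_of_nonneg (f := fun k : ℕ => (k : ℝ) * (ν (-(k : ℤ))).toReal)
      (fun _ => by positivity) h2.summable
    rw [h2.tsum_eq, ENNReal.ofReal_toReal (ν.apply_ne_top 1)] at h3
    rw [h3]
    refine tsum_congr fun k => ?_
    rw [ENNReal.ofReal_mul (by positivity), ENNReal.ofReal_toReal (ν.apply_ne_top _),
      ENNReal.ofReal_natCast]
  rw [mean, div_eq_mul_inv, ← h1, ← ENNReal.tsum_mul_right]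
  refine tsum_congr fun k => ?_
  rw [h1, mul_assoc]
  rfl

theorem mean_nuWhite (hν : IsStepLaw ν) : mean (nuWhite ν hν) = (1 - ν 1) / ν 1 := by
  set a := (ν 1).toReal with ha
  have ha0 : 0 < a := ENNReal.toReal_pos hν.apply_one_ne_zero (ν.apply_ne_top 1)
  have ha1 : a ≤ 1 := by
    have := ENNReal.toReal_mono ENNReal.one_ne_top (ν.coe_le_one 1)
    simpa using this
  have hν1 : ν 1 = ENNReal.ofReal a := (ENNReal.ofReal_toReal (ν.apply_ne_top 1)).symm
  have hq : 1 - ν 1 = ENNReal.ofReal (1 - a) := by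
    rw [hν1, ENNReal.ofReal_sub _ ha0.le, ENNReal.ofReal_one]
  have h1 : HasSum (fun k : ℕ => (k : ℝ) * (1 - a) ^ k) ((1 - a) / (1 - (1 - a)) ^ 2) :=
    hasSum_coe_mul_geometric_of_norm_lt_one (by rw [Real.norm_eq_abs, abs_lt]; constructor <;> linarith)
  have h2 := h1.mul_left a
  have h3 := ENNReal.ofReal_tsum_of_nonneg (f := fun k : ℕ => a * ((k : ℝ) * (1 - a) ^ k))
    (fun _ => by have : 0 ≤ 1 - a := by linarith
                 positivity) h2.summable
  rw [h2.tsum_eq] at h3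
  rw [hq, hν1, ← ENNReal.ofReal_div_of_pos ha0, show (1 - a) / a = a * ((1 - a) / (1 - (1 - a)) ^ 2) by
    rw [sub_sub_cancel]
    field_simp, h3, mean]
  refine tsum_congr fun k => ?_
  change (k : ℝ≥0∞) * (ν 1 * (1 - ν 1) ^ k) = _
  rw [hq, hν1, ENNReal.ofReal_mul ha0.le, ENNReal.ofReal_mul (by positivity), ENNReal.ofReal_natCast,
    ENNReal.ofReal_pow (by linarith)]
  ring

theorem IsStepLaw.one_sub_ne_zero (hν : IsStepLaw ν) : 1 - ν 1 ≠ 0 := by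
  rw [Ne, tsub_eq_zero_iff_le, not_le]
  exact lt_of_le_of_ne (ν.coe_le_one 1) hν.apply_one_ne_one

theorem mean_nuWhite_mul_mean_nuBlack (hν : IsStepLaw ν) :
    mean (nuWhite ν hν) * mean (nuBlack ν hν) = 1 := by
  have h1 : 1 - ν 1 ≠ ∞ := ENNReal.sub_ne_top ENNReal.one_ne_top
  rw [mean_nuWhite, mean_nuBlack, div_eq_mul_inv, div_eq_mul_inv,
    show (1 - ν 1) * (ν 1)⁻¹ * (ν 1 * (1 - ν 1)⁻¹) =
      ((1 - ν 1) * (1 - ν 1)⁻¹) * (ν 1 * (ν 1)⁻¹) by ring,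
    ENNReal.mul_inv_cancel hν.one_sub_ne_zero h1,
    ENNReal.mul_inv_cancel hν.apply_one_ne_zero (ν.apply_ne_top 1), one_mul]

end Mean

/-! ### Countable partitions -/

section Partition

variable {α ι : Type*} [MeasurableSpace α] {μ : Measure α} {G : ι → Set α}

theorem ae_eq_iUnion_of_cover (hcov : ∀ᵐ a ∂μ, ∃ i, a ∈ G i) {A : Set α} {S : Set ι}
    (hA : ∀ᵐ a ∂μ, ∀ i, a ∈ G i → (a ∈ A ↔ i ∈ S)) : A =ᵐ[μ] ⋃ i ∈ S, G i := by
  filter_upwards [hcov, hA] with a ⟨i, hi⟩ ha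
  refine propext ⟨fun h => Set.mem_biUnion ((ha i hi).1 h) hi, fun h => ?_⟩
  obtain ⟨j, hj, hj'⟩ := Set.mem_iUnion₂.1 h
  exact (ha j hj').2 hj

theorem measure_eq_tsum_of_cover [Countable ι] (hG : ∀ i, MeasurableSet (G i))
    (hdisj : Pairwise (Function.onFun (AEDisjoint μ) G)) (hcov : ∀ᵐ a ∂μ, ∃ i, a ∈ G i)
    {A : Set α} {S : Set ι}
    (hA : ∀ᵐ a ∂μ, ∀ i, a ∈ G i → (a ∈ A ↔ i ∈ S)) :
    μ A = ∑' i, S.indicator (fun i => μ (G i)) i := by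
  rw [measure_congr (ae_eq_iUnion_of_cover hcov hA), measure_biUnion₀ (Set.to_countable S)
    (fun i _ j _ hij => hdisj hij) fun i _ => (hG i).nullMeasurableSet, ← tsum_subtype]

/-- Two events that are unions of the same pieces of two partitions with the same weights have the
same probability. -/
theorem measure_eq_measure_of_cover {β : Type*} [MeasurableSpace β] {μ' : Measure β} {D : ι → Set β}
    [IsProbabilityMeasure μ] [IsProbabilityMeasure μ'] [Countable ι]
    (hG : ∀ i, MeasurableSet (G i)) (hD : ∀ i, MeasurableSet (D i))
    (hdisj : Pairwise (Function.onFun (AEDisjoint μ) G))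
    (hdisj' : Pairwise (Function.onFun (AEDisjoint μ') D))
    (hcov : ∀ᵐ a ∂μ, ∃ i, a ∈ G i) (hGD : ∀ i, μ (G i) = μ' (D i)) {A : Set α} {B : Set β}
    {S : Set ι} (hA : ∀ᵐ a ∂μ, ∀ i, a ∈ G i → (a ∈ A ↔ i ∈ S))
    (hB : ∀ i, ∀ b ∈ D i, (b ∈ B ↔ i ∈ S)) : μ A = μ' B := by
  -- Since the pieces `G i` cover almost everything, their masses add up to one. The disjoint pieces
  -- `D i` have the same masses, so they also cover almost everything, with no separate argument on
  -- that side.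
  have h1 : ∑' i, μ (G i) = 1 := by
    have := measure_eq_tsum_of_cover hG hdisj hcov (A := Set.univ) (S := Set.univ)
      (Filter.Eventually.of_forall fun _ _ _ => by simp)
    rw [measure_univ, Set.indicator_univ] at this
    exact this.symm
  have hcov' : ∀ᵐ b ∂μ', ∃ i, b ∈ D i := by
    have h2 : μ' (⋃ i, D i) = 1 := by
      rw [measure_iUnion₀ hdisj' fun i => (hD i).nullMeasurableSet, ← h1]
      exact tsum_congr fun i => (hGD i).symm
    have h3 := (prob_compl_eq_zero_iff (MeasurableSet.iUnion hD)).2 h2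
    filter_upwards [compl_mem_ae_iff.2 h3] with b hb
    exact Set.mem_iUnion.1 (not_not.1 hb)
  rw [measure_eq_tsum_of_cover hG hdisj hcov hA, measure_eq_tsum_of_cover hD hdisj' hcov'
    (Filter.Eventually.of_forall fun b i hb => hB i b hb)]
  exact tsum_congr fun i => by
    simp only [Set.indicator]
    rw [hGD]

end Partition

/-! ### The space of plane trees -/

instance : MeasurableSpace.CountablyGenerated PlaneTree where
  isCountablyGenerated := ⟨_, by
    have : {A : Set PlaneTree | ∃ w : List ℕ, A = {t : PlaneTree | w ∈ t.verts}} =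
        Set.range fun w : List ℕ => {t : PlaneTree | w ∈ t.verts} := by
      ext A
      exact exists_congr fun w => eq_comm
    rw [this]
    exact Set.countable_range _, rfl⟩

theorem PlaneTree.measurableSet_mem (w : List ℕ) : MeasurableSet {t : PlaneTree | w ∈ t.verts} :=
  MeasurableSpace.measurableSet_generateFrom ⟨w, rfl⟩

theorem PlaneTree.measurableSet_forall_mem (F : Finset (List ℕ)) :
    MeasurableSet {t : PlaneTree | ∀ w ∈ F, w ∈ t.verts} := by
  simp only [Set.ofPred_forall]
  exact MeasurableSet.biInter (Set.to_countable _) fun w _ => measurableSet_mem w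

theorem PlaneTree.measure_ext {μ μ' : Measure PlaneTree} [IsProbabilityMeasure μ]
    [IsProbabilityMeasure μ'] (h : ∀ F : Finset (List ℕ),
      μ {t | ∀ w ∈ F, w ∈ t.verts} = μ' {t | ∀ w ∈ F, w ∈ t.verts}) : μ = μ' := by
  classical
  refine ext_of_generate_finite (Set.range fun F : Finset (List ℕ) =>
    {t : PlaneTree | ∀ w ∈ F, w ∈ t.verts}) (le_antisymm ?_ ?_) ?_ ?_ (by simp)
  · refine MeasurableSpace.generateFrom_le ?_
    rintro _ ⟨w, rfl⟩
    exact MeasurableSpace.measurableSet_generateFrom ⟨{w}, by simp⟩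
  · refine MeasurableSpace.generateFrom_le ?_
    rintro _ ⟨F, rfl⟩
    exact measurableSet_forall_mem F
  · rintro _ ⟨F, rfl⟩ _ ⟨F', rfl⟩ -
    refine ⟨F ∪ F', ?_⟩
    ext t
    simp only [Finset.mem_union, Set.mem_inter_iff, Set.mem_ofPred_eq]
    exact ⟨fun h => ⟨fun w hw => h w (Or.inl hw), fun w hw => h w (Or.inr hw)⟩,
      fun h w hw => hw.elim (h.1 w) (h.2 w)⟩
  · rintro _ ⟨F, rfl⟩
    exact h F

/-! ### The law of the tree of components -/

/-- The numbers of children in the tree of components. -/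
noncomputable def treeCount (X : (ℕ → ℤ) × (ℕ → ℤ)) : List ℕ → ℕ :=
  edgeCount (predPerm (gluedSetoid X.1 X.2)) (facePerm (gluedSetoid X.1 X.2)) 0

theorem componentTree_eq (X : (ℕ → ℤ) × (ℕ → ℤ)) :
    componentTree X.1 X.2 = PlaneTree.ofNumChildren (treeCount X) :=
  chainMap_treeOfComponents _

/-- `v` is the `n`-th white vertex of the spine of the tree of components. -/
def IsSpineWord (n : ℕ) (X : (ℕ → ℤ) × (ℕ → ℤ)) (v : List ℕ) : Prop :=
  v ∈ (PlaneTree.ofNumChildren (treeCount X)).verts ∧ v.length = 2 * n ∧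
    edgeAt (predPerm (gluedSetoid X.1 X.2)) (facePerm (gluedSetoid X.1 X.2)) 0 v =
      (-(cutTime X.1 X.2 n : ℤ), false)

variable {ν : PMF ℤ} {Q : Measure (ℕ → ℤ)} {n : ℕ} {X Y : (ℕ → ℤ) × (ℕ → ℤ)} {v : List ℕ}

theorem prod_range_eq_prod_Ico (f : ℤ → ℝ≥0∞) (N M : ℕ) :
    ∏ i ∈ Finset.Ico (-(M : ℤ)) N, f i =
      (∏ i ∈ Finset.range N, f i) * ∏ j ∈ Finset.range M, f (-((j + 1 : ℕ) : ℤ)) := by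
  rw [← Finset.Ico_union_Ico_eq_Ico (b := 0) (by omega) (by omega),
    Finset.prod_union (Finset.Ico_disjoint_Ico_consecutive _ _ _), mul_comm]
  congr 1
  · symm
    refine Finset.prod_bij (fun (i : ℕ) _ => (i : ℤ)) (fun i hi => ?_) (fun i _ j _ h => by
      exact_mod_cast h) (fun i hi => ?_) fun _ _ => rfl
    · rw [Finset.mem_range] at hi
      rw [Finset.mem_Ico]
      omega
    · rw [Finset.mem_Ico] at hi
      exact ⟨i.toNat, Finset.mem_range.2 (by omega), Int.toNat_of_nonneg hi.1⟩
  · symm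
    refine Finset.prod_bij (fun (j : ℕ) _ => -((j + 1 : ℕ) : ℤ)) (fun i hi => ?_)
      (fun i _ j _ h => by omega) (fun i hi => ?_) fun _ _ => rfl
    · rw [Finset.mem_range] at hi
      rw [Finset.mem_Ico]
      omega
    · rw [Finset.mem_Ico] at hi
      exact ⟨(-i - 1).toNat, Finset.mem_range.2 (by omega), by omega⟩

theorem IsWalkPair.step_ne_zero {E D : ℤ → ℤ} {s : Setoid ℤ} (h : IsWalkPair E D s) (i : ℤ) :
    step E D i ≠ 0 := by
  rw [step]
  split_ifs with hi
  · have := h.E_ne i hi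
    omega
  · have := h.D_ne i (not_le.1 hi)
    omega

/-- This is `prod_weights` with `a = ν 1`, `q = 1 - ν 1` and `g k = ν (-k) / (1 - ν 1)`: the factor
`q` attached to a down-step cancels the denominator, and every edge of the window contributes `ν` of
its step. -/
theorem IsCodingPair.kestenMeasure_kestenEvent (hν : IsStepLaw ν) (h : IsCodingPair X.1 X.2)
    (hn : n ≠ 0) (hv : IsSpineWord n X v) :
    kestenMeasure (nuWhite ν hν) (nuBlack ν hν) (kestenEvent (treeCount X) v) =
      pathWeight ν X.1 (recTime X.1 n) * pathWeight ν X.2 (cutTime X.1 X.2 n) := by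
  classical
  have hw := h.isWalkPair
  have ht := hw.isEdgeTree
  have c := (h.isCut hn).isEdgeCut hw
  obtain ⟨hv1, hv2, hv3⟩ := hv
  have hfin := c.finite_offVerts ht hv1 hv3
  have hq1 : 1 - ν 1 ≠ ∞ := ENNReal.sub_ne_top ENNReal.one_ne_top
  have hwb := mean_nuWhite_mul_mean_nuBlack hν
  have hm0 : mean (nuWhite ν hν) ≠ 0 := fun h => by simp [h] at hwb
  have hm0' : mean (nuBlack ν hν) ≠ 0 := fun h => by simp [h] at hwb
  have hm1 : mean (nuWhite ν hν) ≠ ∞ := fun h => by simp [h, ENNReal.top_mul hm0'] at hwb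
  have hm1' : mean (nuBlack ν hν) ≠ ∞ := fun h => by simp [h, ENNReal.mul_top hm0] at hwb
  rw [ComponentTree.kestenMeasure_kestenEvent hm0 hm1 hm0' hm1' hwb hv1 hv2
    (F := hfin.toFinset) (by simp [treeCount])]
  have h1 := c.prod_weights ht hv1 hv3 (fun i => IsWalkPair.step (fwd X.1) (back X.2) i < 0)
    hw.exists_unique_down (F := hfin.toFinset) (by simp) (ν 1) (1 - ν 1)
    fun k => ν (-(k : ℤ)) / (1 - ν 1)
  refine h1.trans ?_
  have h2 : ∀ i, (if IsWalkPair.step (fwd X.1) (back X.2) i < 0 then (1 - ν 1) *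
      (ν (-(((cycleSet (facePerm (gluedSetoid X.1 X.2)) i).ncard - 1 : ℕ) : ℤ)) / (1 - ν 1))
        else ν 1) = ν (IsWalkPair.step (fwd X.1) (back X.2) i) := by
    intro i
    have h3 := hw.step_eq i
    have h4 := hw.step_ne_zero i
    split_ifs with hd
    · rw [ENNReal.mul_div_cancel hν.one_sub_ne_zero hq1]
      congr 1
      split_ifs at h3 <;> omega
    · congr 1
      split_ifs at h3 <;> omega
  rw [Finset.prod_congr rfl fun i _ => h2 i, prod_range_eq_prod_Ico]
  refine congrArg₂ (· * ·) ?_ ?_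
  · refine Finset.prod_congr rfl fun i _ => ?_
    rw [IsWalkPair.step, if_pos (by omega), fwd_natCast, ← fwd_natCast X.1 (i + 1)]
    push_cast
    rfl
  · refine Finset.prod_congr rfl fun j _ => ?_
    rw [IsWalkPair.step, if_neg (by omega), back_neg_natCast, ← back_neg_natCast X.2 j]
    congr 3
    push_cast
    ring

theorem IsCodingPair.exists_isSpineWord (h : IsCodingPair X.1 X.2) (hn : n ≠ 0) :
    ∃ v, IsSpineWord n X v := by
  obtain ⟨v, h1, h2, h3⟩ := h.exists_spine_word n
  exact ⟨v, h1, h2, h3 hn⟩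

/-- The cylinders of the Kesten tree associated with different keys are disjoint. -/
theorem cutKey_eq_of_mem_kestenEvent (h : IsCodingPair X.1 X.2) (h' : IsCodingPair Y.1 Y.2)
    (hn : n ≠ 0) {u : List ℕ} (hu : IsSpineWord n X u) (hv : IsSpineWord n Y v)
    {z : (List ℕ → ℕ) × (ℕ → ℕ × ℕ)} (hz : z ∈ kestenEvent (treeCount X) u)
    (hz' : z ∈ kestenEvent (treeCount Y) v) : cutKey n X = cutKey n Y := by
  have huv : u = v := by
    have h1 := spine_of_mem_kestenEvent hz le_rfl
    have h2 := spine_of_mem_kestenEvent hz' le_rfl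
    rw [List.take_length, hu.2.1] at h1
    rw [List.take_length, hv.2.1] at h2
    exact h1.symm.trans h2
  subst huv
  refine h.cutKey_eq_of_agree h' hn hu.1 hu.2.2 hv.1 hv.2.2 fun w hw => ?_
  have h1 := kestenCount_of_mem_kestenEvent hz hw
  have h2 : w ∈ PlaneTree.offVerts (treeCount Y) u := by
    rw [← offVerts_kestenCount hz', offVerts_kestenCount hz]
    exact hw
  exact h1.symm.trans (kestenCount_of_mem_kestenEvent hz' h2)

/-- The key determines the first generations of the tree of components. -/
theorem mem_componentTree_iff_of_cutKey_eq (h : IsCodingPair X.1 X.2) (h' : IsCodingPair Y.1 Y.2)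
    (hn : n ≠ 0) (hk : cutKey n X = cutKey n Y) {w : List ℕ} (hw : w.length ≤ 2 * n) :
    w ∈ (componentTree X.1 X.2).verts ↔ w ∈ (componentTree Y.1 Y.2).verts := by
  have key : ∀ {X Y : (ℕ → ℤ) × (ℕ → ℤ)}, IsCodingPair X.1 X.2 → IsCodingPair Y.1 Y.2 →
      cutKey n X = cutKey n Y → w ∈ (componentTree X.1 X.2).verts →
        w ∈ (componentTree Y.1 Y.2).verts := by
    intro X Y h h' hk hwX
    obtain ⟨v, hv⟩ := h.exists_isSpineWord hn
    rw [componentTree_eq, PlaneTree.mem_iff_mem_offVerts' (hw.trans hv.2.1.ge)] at *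
    exact PlaneTree.offVerts'_subset_of_agree
      (fun u hu => h.agree_of_cutKey_eq h' hn hk hv.1 hv.2.2 hu) hwX
  exact ⟨key h h' hk, key h' h hk.symm⟩

/-! ### Matching partitions and identification of the law -/

section Law

variable (hν : IsStepLaw ν) [IsProbabilityMeasure Q] (hQ : IsConditionedWalkLaw ν 0 Q)
include hν hQ

/-- The glued looptree and the Kesten tree have partitions, indexed by the keys, with the same
weights and on the pieces of which the first generations of the trees are the same. -/
theorem exists_partition (hn : n ≠ 0) : ∃ (ι : Type) (_ : Countable ι)
    (G : ι → Set ((ℕ → ℤ) × (ℕ → ℤ))) (D : ι → Set ((List ℕ → ℕ) × (ℕ → ℕ × ℕ)))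
    (S : List ℕ → Set ι),
    (∀ i, MeasurableSet (G i)) ∧ (∀ i, MeasurableSet (D i)) ∧
    Pairwise (Function.onFun (AEDisjoint ((walkLaw ν 0).prod Q)) G) ∧
    Pairwise (Function.onFun (AEDisjoint (kestenMeasure (nuWhite ν hν) (nuBlack ν hν))) D) ∧
    (∀ᵐ Y ∂(walkLaw ν 0).prod Q, ∃ i, Y ∈ G i) ∧
    (∀ i, (walkLaw ν 0).prod Q (G i) = kestenMeasure (nuWhite ν hν) (nuBlack ν hν) (D i)) ∧
    (∀ᵐ Y ∂(walkLaw ν 0).prod Q, ∀ i, Y ∈ G i → ∀ w : List ℕ, w.length ≤ 2 * n →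
      (w ∈ (componentTree Y.1 Y.2).verts ↔ i ∈ S w)) ∧
    ∀ i, ∀ z ∈ D i, ∀ w : List ℕ, w.length ≤ 2 * n → (w ∈ (kestenTree z).verts ↔ i ∈ S w) := by
  -- Pieces are indexed by the keys of coding pairs. Keys are pairs of finite lists, hence countably
  -- many.
  let ι := {κ : List ℤ × List ℤ // ∃ X : (ℕ → ℤ) × (ℕ → ℤ), IsCodingPair X.1 X.2 ∧ cutKey n X = κ}
  choose X hX hκ using fun i : ι => i.2
  choose v hv using fun i : ι => (hX i).exists_isSpineWord hn
  have hae := ae_isCodingPair hν hQ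
  refine ⟨ι, inferInstance, fun i => cutEvent n (X i), fun i => kestenEvent (treeCount (X i)) (v i),
    fun w => {i | w ∈ (componentTree (X i).1 (X i).2).verts}, fun i => measurableSet_cutEvent _ _,
    fun i => measurableSet_kestenEvent _ _, fun i j hij => ?_, fun i j hij => ?_, ?_, fun i => ?_,
    ?_, fun i z hz w hw => ?_⟩
  -- Events with different keys can share only points that are not coding pairs, which form a null
  -- set.
  · refine measure_mono_null (t := {Y | ¬ IsCodingPair Y.1 Y.2}) (fun Y hY hc => hij ?_) hae
    have h1 := (mem_cutEvent_iff hn (hX i) hc).1 hY.1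
    have h2 := (mem_cutEvent_iff hn (hX j) hc).1 hY.2
    exact Subtype.ext ((hκ i).symm.trans (h1.symm.trans (h2.trans (hκ j))))
  · refine Disjoint.aedisjoint (Set.disjoint_left.2 fun z hz hz' => hij ?_)
    have h1 := cutKey_eq_of_mem_kestenEvent (hX i) (hX j) hn (hv i) (hv j) hz hz'
    exact Subtype.ext ((hκ i).symm.trans (h1.trans (hκ j)))
  · filter_upwards [hae] with Y hY
    refine ⟨⟨cutKey n Y, Y, hY, rfl⟩, (mem_cutEvent_iff hn (hX _) hY).2 ?_⟩
    exact (hκ ⟨cutKey n Y, Y, hY, rfl⟩).symm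
  · rw [(hX i).kestenMeasure_kestenEvent hν hn (hv i), measure_cutEvent hν hQ n (hX i)]
  · filter_upwards [hae] with Y hY i hi w hw
    exact mem_componentTree_iff_of_cutKey_eq hY (hX i) hn
      ((mem_cutEvent_iff hn (hX i) hY).1 hi) hw
  · rw [mem_kestenTree_iff hz (hw.trans (hv i).2.1.ge), ← componentTree_eq]
    rfl

/-- The presence of a given word is, up to a null set, a countable union of cut events. This gives
null measurability, and the sigma-algebra on trees is countably generated. -/
theorem aemeasurable_componentTree :
    AEMeasurable (fun Y : (ℕ → ℤ) × (ℕ → ℤ) => componentTree Y.1 Y.2) ((walkLaw ν 0).prod Q) := by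
  refine NullMeasurable.aemeasurable ?_
  refine @measurable_generateFrom (NullMeasurableSpace _ ((walkLaw ν 0).prod Q)) _ _ _ _ ?_
  rintro _ ⟨w, rfl⟩
  obtain ⟨ι, _, G, D, S, hG, -, -, -, hcov, -, hA, -⟩ :=
    exists_partition hν hQ (n := w.length + 1) (by omega)
  have h1 := ae_eq_iUnion_of_cover (A := {Y : (ℕ → ℤ) × (ℕ → ℤ) | w ∈ (componentTree Y.1 Y.2).verts})
    (S := S w) hcov (by
      filter_upwards [hA] with Y hY i hi
      exact hY i hi w (by omega))
  exact (MeasurableSet.biUnion (Set.to_countable _) fun i _ => hG i).nullMeasurableSet.congr h1.symm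

theorem hasLaw_componentTree :
    HasLaw (fun Y : (ℕ → ℤ) × (ℕ → ℤ) => componentTree Y.1 Y.2)
      (kestenLaw (nuWhite ν hν) (nuBlack ν hν)) ((walkLaw ν 0).prod Q) where
  aemeasurable := aemeasurable_componentTree hν hQ
  map_eq := by
    have hm := aemeasurable_componentTree hν hQ
    rw [kestenLaw_eq]
    have := Measure.isProbabilityMeasure_map hm
    have := Measure.isProbabilityMeasure_map (μ := kestenMeasure (nuWhite ν hν) (nuBlack ν hν))
      measurable_kestenTree.aemeasurable
    refine PlaneTree.measure_ext fun F => ?_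
    have hF := PlaneTree.measurableSet_forall_mem F
    rw [Measure.map_apply_of_aemeasurable hm hF, Measure.map_apply measurable_kestenTree hF]
    -- All words of `F` have length at most `2n` for this `n`; the added `1` ensures `n ≠ 0`.
    obtain ⟨ι, _, G, D, S, hG, hD, hd, hd', hcov, hGD, hA, hB⟩ :=
      exists_partition hν hQ (n := F.sup List.length + 1) (by omega)
    have hl : ∀ w ∈ F, w.length ≤ 2 * (F.sup List.length + 1) := fun w hw => by
      have := Finset.le_sup (f := List.length) hw
      omega
    refine measure_eq_measure_of_cover hG hD hd hd' hcov hGD (S := {i | ∀ w ∈ F, i ∈ S w}) ?_ ?_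
    · filter_upwards [hA] with Y hY i hi
      exact forall₂_congr fun w hw => hY i hi w (hl w hw)
    · exact fun i z hz => forall₂_congr fun w hw => hB i z hz w (hl w hw)

end Law

end ComponentTree

theorem mainTheorem4 {Ω : Type*} [MeasurableSpace Ω] (P : Measure Ω) [IsProbabilityMeasure P]
    (ν : PMF ℤ) (hν : ComponentTree.IsStepLaw ν)
    (Q : Measure (ℕ → ℤ)) (hQ : ComponentTree.IsConditionedWalkLaw ν 0 Q)
    (C C' : Ω → ℕ → ℤ)
    (hC : HasLaw C (ComponentTree.walkLaw ν 0) P) (hC' : HasLaw C' Q P)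
    (hCC' : IndepFun C C' P) :
    (∀ᵐ ω ∂P, ComponentTree.IsCodingPair (C ω) (C' ω)) ∧
      HasLaw (fun ω => ComponentTree.componentTree (C ω) (C' ω))
        (ComponentTree.kestenLaw (ComponentTree.nuWhite ν hν) (ComponentTree.nuBlack ν hν)) P := by
  have : IsProbabilityMeasure Q := hC'.isProbabilityMeasure_iff.1 inferInstance
  have hX := hCC'.hasLaw_prod hC hC'
  refine ⟨?_, ⟨(ComponentTree.hasLaw_componentTree hν hQ).comp hX |>.aemeasurable,
    (ComponentTree.hasLaw_componentTree hν hQ).comp hX |>.map_eq⟩⟩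
  have h := ComponentTree.ae_isCodingPair hν hQ
  rw [← hX.map_eq] at h
  exact ae_of_ae_map hX.aemeasurable h
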